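/- **Setting.** Fix $K\ge 1$ and $r_1,\dots,r_K$. For $n=1,2,\dots$ let the dimensions $p_k=p_k(n)$, $1\le k\le K$, and the sample size $T=T(n)$ satisfy $\min\{p_1,\dots,p_K,T\}\to\infty$ as $n\to\infty$ (no restriction on relative rates); all quantities below except $K$, $r_k$, $\tau$, $\nu$, $\mathcal A_k$, $\mathfrak F$, $\mathbf\Sigma_{0k}$, $c_k$ may depend on $n$. Write $p=p_1\cdots p_K$ and $p_{-k}=p/p_k$. One observes tensors of size $p_1\times\cdots\times p_K$ $$\mathcal X_t=\mathcal F_{0t}\times_{k=1}^K\mathbf A_{0k}+\mathcal E_t,\qquad 1\le t\le T,$$ with nonrandom $\mathbf A_{0k}\in\mathbb R^{p_k\times r_k}$ and $\mathcal F_{0t}\in\mathbb R^{r_1\times\cdots\times r_K}$. For a tensor $\mathcal F$, $\mathrm{mat}_k(\mathcal F)$ is its mode-$k$ unfolding, and $\|\cdot\|_F$ is the Frobenius norm. Given $\mathcal A_k\subset\mathbb R^{r_k}$ and a set $\mathfrak F\subset\mathbb R^{r_1\times\cdots\times r_K}$, let $\Theta$ be the set of all $\theta=(\mathbf A_1,\dots,\mathbf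 A_K,\mathcal F_1,\dots,\mathcal F_T)$ such that the rows of $\mathbf A_k$ lie in $\mathcal A_k$, $\mathbf A_k^\top\mathbf A_k/p_k=\mathbf I_{r_k}$, $\mathcal F_t\in\mathfrak F$, and for every $k$ the matrix $\frac1T\sum_{t=1}^T\mathrm{mat}_k(\mathcal F_t)\,\mathrm{mat}_k(\mathcal F_t)^\top$ is diagonal with positive, non-increasing diagonal entries. **Assumption 1.** (i) Each $\mathcal A_k$ is closed, $\mathfrak F$ is compact, and $\theta_0=(\mathbf A_{01},\dots,\mathbf A_{0K},\mathcal F_{01},\dots,\mathcal F_{0T})\in\Theta$. (ii) There are constants $0<c_k<\infty$ with $\|\mathbf A_{0k}\|_F=c_kp_k^{1/2}$. (iii) The $\mathcal F_{0t}$ are nonrandom, (a) $\|\mathrm{mat}_k(\mathcal F_{0t})\|_F$ is bounded uniformly in $t$, $k$ and $n$, and (b) for every $k$, $\frac1T\sum_{t=1}^T\mathrm{mat}_k(\mathcal F_{0t})\,\mathrm{mat}_k(\mathcal F_{0t})^\top\to\mathbf\Sigma_{0k}$, where $\mathbf\Sigma_{0k}$ is diagonal with positive, strictly decreasing diagonal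 entries. **Assumption 2.** For each $n$ the entries $e_{t,i_1,\dots,i_K}$ of $\mathcal E_1,\dots,\mathcal E_T$ are independent across $t$ and $i_1,\dots,i_K$ (they need not be identically distributed). **Assumption 3.** (i) $\mathbb E\,e_{t,i_1,\dots,i_K}=0$; (ii) there is a constant $\nu>0$ such that $\mathbb E|e_{t,i_1,\dots,i_K}|^{2d}\le\frac{(2d)!}{2^dd!}\nu^{2d}$ for all $d=1,2,\dots$, all $t,i_1,\dots,i_K$ and all $n$; (iii) $\|\mathcal E_t\|_F>0$ a.s. for all $1\le t\le T$. **Estimator.** Fix $\tau>0$ and let $H_\tau(x)=\frac12x^2$ if $|x|\le\tau$ and $H_\tau(x)=\tau|x|-\frac12\tau^2$ if $|x|>\tau$. Let $\widehat\theta^H=(\widehat{\mathbf A}^H_1,\dots,\widehat{\mathbf A}^H_K,\widehat{\mathcal F}^H_1,\dots,\widehat{\mathcal F}^H_T)$ be any estimator which, with probability tending to one (in particular, if almost surely), satisfies $$\widehat\theta^H\in\arg\min_{\theta\in\Theta}\ \frac1T\sum_{t=1}^TH_\tau\!\left(\frac{\|\mathcal X_t-\mathcal F_t\times_{k=1}^K\mathbf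 A_k\|_F}{\sqrt p}\right).$$ Let $\widehat{\mathbf S}^H_k=\mathrm{sgn}(\mathbf A_{0k}^\top\widehat{\mathbf A}^H_k/p_k)$, where $\mathrm{sgn}(\mathbf M)$ is the diagonal matrix whose diagonal entries are the signs of the diagonal entries of $\mathbf M$, and $$L^*=\min\{p,\;p_{-1}^2,\dots,p_{-K}^2,\;Tp_{-1},\dots,Tp_{-K}\}.$$ **Theorem.** Under Assumptions 1–3, as $n\to\infty$, for all $1\le k\le K$, $$\frac1{p_k}\big\|\widehat{\mathbf A}^H_k-\mathbf A_{0k}\widehat{\mathbf S}^H_k\big\|_F^2=O_P\!\left(\frac1{L^*}\right),\qquad \frac1T\sum_{t=1}^T\big\|\widehat{\mathcal F}^H_t-\mathcal F_{0t}\times_{k=1}^K\widehat{\mathbf S}^H_k\big\|_F^2=O_P\!\left(\frac1{L^*}\right).$$ -/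

import Mathlib

open MeasureTheory ProbabilityTheory Filter Topology

noncomputable section

namespace TensorFactor

/-- Real tensors of order `K` and size `d 0 × ⋯ × d (K - 1)`. -/
abbrev Tensor {K : ℕ} (d : Fin K → ℕ) : Type := (∀ k, Fin (d k)) → ℝ

/-- Frobenius norm of a tensor. -/
def tensorNorm {K : ℕ} {d : Fin K → ℕ} (x : Tensor d) : ℝ := √(∑ i, x i ^ 2)

/-- Frobenius norm of a matrix. -/
def matrixNorm {m n : Type*} [Fintype m] [Fintype n] (A : Matrix m n ℝ) : ℝ :=
  √(∑ i, ∑ j, A i j ^ 2)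

/-- The product `F ×₁ A₁ ×₂ ⋯ ×_K A_K` along all the modes. -/
def multiModeProd {K : ℕ} {d m : Fin K → ℕ} (F : Tensor d)
    (A : ∀ k, Matrix (Fin (m k)) (Fin (d k)) ℝ) : Tensor m :=
  fun i => ∑ j : (∀ k, Fin (d k)), F j * ∏ k, A k (i k) (j k)

/-- Mode-`k` unfolding: the rows are indexed by the `k`-th coordinate, the columns (the mode-`k`
fibres) by the remaining coordinates. -/
def unfold {K : ℕ} {d : Fin K → ℕ} (k : Fin K) (x : Tensor d) :
    Matrix (Fin (d k)) (∀ j : {j // j ≠ k}, Fin (d j)) ℝ :=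
  Matrix.of fun a c => x ((Equiv.piSplitAt k fun j => Fin (d j)).symm (a, c))

/-- `(1/T) ∑ₜ F_{k,t} F_{k,t}ᵀ`, where `F_{k,t}` is the mode-`k` unfolding of `Fₜ`. -/
def factorGram {K : ℕ} {r : Fin K → ℕ} {T : ℕ} (F : Fin T → Tensor r) (k : Fin K) :
    Matrix (Fin (r k)) (Fin (r k)) ℝ :=
  (T : ℝ)⁻¹ • ∑ t, unfold k (F t) * (unfold k (F t)).transpose

/-- `p = p₁ ⋯ p_K`. -/
def size {K : ℕ} (p : Fin K → ℕ) : ℕ := ∏ k, p k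

/-- `p_{-k} = p / p_k`. -/
def sizeExcept {K : ℕ} (p : Fin K → ℕ) (k : Fin K) : ℕ := ∏ j ∈ Finset.univ.erase k, p j

/-- `L* = min {p, p_{-1}², …, p_{-K}², T p_{-1}, …, T p_{-K}}` (for `K ≥ 1`). -/
def Lstar {K : ℕ} (p : Fin K → ℕ) (T : ℕ) : ℕ :=
  min (size p) (min (⨅ k, sizeExcept p k ^ 2) (⨅ k, T * sizeExcept p k))

/-- A parameter value `θ = (A₁, …, A_K, F₁, …, F_T)`. -/
structure Param {K : ℕ} (p r : Fin K → ℕ) (T : ℕ) where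
  loading : ∀ k, Matrix (Fin (p k)) (Fin (r k)) ℝ
  factor : Fin T → Tensor r

/-- The common component `Fₜ ×₁ A₁ ×₂ ⋯ ×_K A_K` at time `t`. -/
def Param.common {K : ℕ} {p r : Fin K → ℕ} {T : ℕ} (θ : Param p r T) (t : Fin T) : Tensor p :=
  multiModeProd (θ.factor t) θ.loading

/-- The parameter space `Θ`. -/
def paramSpace {K : ℕ} (p r : Fin K → ℕ) (T : ℕ) (𝒜 : ∀ k, Set (Fin (r k) → ℝ))
    (𝓕 : Set (Tensor r)) : Set (Param p r T) :=
  {θ | (∀ k j, θ.loading k j ∈ 𝒜 k) ∧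
    (∀ k, (p k : ℝ)⁻¹ • ((θ.loading k).transpose * θ.loading k) = 1) ∧
    (∀ t, θ.factor t ∈ 𝓕) ∧
    ∀ k, ∃ σ : Fin (r k) → ℝ, (∀ i, 0 < σ i) ∧ Antitone σ ∧
      factorGram θ.factor k = Matrix.diagonal σ}

/-- The Huber loss function `H_τ`. -/
def huber (τ x : ℝ) : ℝ := if |x| ≤ τ then x ^ 2 / 2 else τ * |x| - τ ^ 2 / 2

/-- `(1/T) ∑ₜ H_τ (‖Xₜ - Fₜ ×₁ A₁ ×₂ ⋯ ×_K A_K‖_F / √p)`. -/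
def huberLoss {K : ℕ} {p r : Fin K → ℕ} {T : ℕ} (τ : ℝ) (X : Fin T → Tensor p)
    (θ : Param p r T) : ℝ :=
  (T : ℝ)⁻¹ * ∑ t, huber τ (tensorNorm (X t - θ.common t) / √(size p : ℝ))

/-- `θ` minimises the Huber loss over `Θ` for the data `X`. -/
def IsHuberEstimator {K : ℕ} {p r : Fin K → ℕ} {T : ℕ} (τ : ℝ) (𝒜 : ∀ k, Set (Fin (r k) → ℝ))
    (𝓕 : Set (Tensor r)) (X : Fin T → Tensor p) (θ : Param p r T) : Prop :=
  θ ∈ paramSpace p r T 𝒜 𝓕 ∧ IsMinOn (huberLoss τ X) (paramSpace p r T 𝒜 𝓕) θ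

/-- `sgn M`: the diagonal matrix of the signs of the diagonal entries of `M`. -/
def signMatrix {n : ℕ} (M : Matrix (Fin n) (Fin n) ℝ) : Matrix (Fin n) (Fin n) ℝ :=
  Matrix.diagonal fun i => Real.sign (M i i)

/-- `S_k = sgn (A_{0k}ᵀ A_k / p_k)`. -/
def signAlign {K : ℕ} {p r : Fin K → ℕ} {T : ℕ} (θ₀ θ : Param p r T) (k : Fin K) :
    Matrix (Fin (r k)) (Fin (r k)) ℝ :=
  signMatrix ((p k : ℝ)⁻¹ • ((θ₀.loading k).transpose * θ.loading k))

/-- `‖A_k - A_{0k} S_k‖_F² / p_k`. -/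
def loadingError {K : ℕ} {p r : Fin K → ℕ} {T : ℕ} (θ₀ θ : Param p r T) (k : Fin K) : ℝ :=
  (p k : ℝ)⁻¹ * matrixNorm (θ.loading k - θ₀.loading k * signAlign θ₀ θ k) ^ 2

/-- `(1/T) ∑ₜ ‖Fₜ - F_{0t} ×₁ S₁ ×₂ ⋯ ×_K S_K‖_F²`. -/
def factorError {K : ℕ} {p r : Fin K → ℕ} {T : ℕ} (θ₀ θ : Param p r T) : ℝ :=
  (T : ℝ)⁻¹ * ∑ t,
    tensorNorm (θ.factor t - multiModeProd (θ₀.factor t) (signAlign θ₀ θ)) ^ 2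

/-- Assumption on the parameter space and on the (nonrandom) true parameters `θ₀ n`, along
dimensions `p n` and sample sizes `T n`. -/
structure ParamAssumption {K : ℕ} (r : Fin K → ℕ) (p : ℕ → Fin K → ℕ) (T : ℕ → ℕ)
    (𝒜 : ∀ k, Set (Fin (r k) → ℝ)) (𝓕 : Set (Tensor r)) (θ₀ : ∀ n, Param (p n) r (T n)) :
    Prop where
  closed_loading : ∀ k, IsClosed (𝒜 k)
  compact_factor : IsCompact 𝓕
  mem : ∀ n, θ₀ n ∈ paramSpace (p n) r (T n) 𝒜 𝓕
  strong : ∀ k, ∃ c : ℝ, 0 < c ∧ ∀ n, matrixNorm ((θ₀ n).loading k) = c * √(p n k : ℝ)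
  bounded : ∃ C : ℝ, ∀ n t k, matrixNorm (unfold k ((θ₀ n).factor t)) ≤ C
  gram_limit : ∀ k, ∃ σ : Fin (r k) → ℝ, (∀ i, 0 < σ i) ∧ StrictAnti σ ∧
    Tendsto (fun n => factorGram (θ₀ n).factor k) atTop (𝓝 (Matrix.diagonal σ))

/-- The entries of the error tensors are random variables, independent across `t` and across
entries. -/
structure IndepErrors {K : ℕ} {Ω : Type*} [MeasurableSpace Ω] (μ : Measure Ω) {p : Fin K → ℕ}
    {T : ℕ} (E : Fin T → Ω → Tensor p) : Prop where
  measurable : ∀ t i, Measurable fun ω => E t ω i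
  indep : iIndepFun (fun (s : Fin T × (∀ k, Fin (p k))) ω => E s.1 ω s.2) μ

/-- The errors are centred and sub-Gaussian with parameter `ν`, and no error tensor vanishes. -/
structure SubGaussianErrors {K : ℕ} {Ω : Type*} [MeasurableSpace Ω] (μ : Measure Ω)
    {p : Fin K → ℕ} {T : ℕ} (ν : ℝ) (E : Fin T → Ω → Tensor p) : Prop where
  mean_zero : ∀ t i, Integrable (fun ω => E t ω i) μ ∧ ∫ ω, E t ω i ∂μ = 0
  moment : ∀ t i (d : ℕ), 1 ≤ d → Integrable (fun ω => |E t ω i| ^ (2 * d)) μ ∧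
    ∫ ω, |E t ω i| ^ (2 * d) ∂μ ≤
      ((2 * d).factorial : ℝ) / (2 ^ d * (d.factorial : ℝ)) * ν ^ (2 * d)
  norm_pos : ∀ t, ∀ᵐ ω ∂μ, 0 < tensorNorm (E t ω)

/-- `Yₙ = O_P(aₙ)` as `n → ∞`, for `Yₙ` defined on the `n`-th of a sequence of probability
spaces. For a set that is not measurable, `μ n` is the outer probability. -/
def IsBigOP {Ω : ℕ → Type*} [∀ n, MeasurableSpace (Ω n)] (μ : ∀ n, Measure (Ω n))
    (Y : ∀ n, Ω n → ℝ) (a : ℕ → ℝ) : Prop :=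
  ∀ ε : ℝ, 0 < ε → ∃ M : ℝ, 0 < M ∧
    ∀ᶠ n in atTop, μ n {ω | M * a n < |Y n ω|} ≤ ENNReal.ofReal ε

end TensorFactor

end

/-!
The rate of convergence of the Huber estimator of a tensor factor model.

Let `C_t` and `C_{0t}` be the estimated and the true common components, and let `D²` be the mean
of `d_t = ‖C_t - C_{0t}‖_F² / p` over time (`commonDist`). The Huber loss is a concave function of
the square of its argument, so it lies below its tangents there. Comparing the losses of the
minimiser and of the true parameter therefore gives the inequality of weighted least squares

  `avg_t w_t d_t ≤ 2 avg_t w_t ⟨E_t, C_t - C_{0t}⟩ / p`,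

where `w_t ∈ (0, 1]` is the Huber weight of the residual at time `t` (`sum_residualWeight_le`).
The weights are bounded below except when `‖E_t‖² / p` is far from its mean, which is rare because
the entries of `E_t` are independent, so the left-hand side dominates `D²`
(`minWeight_mul_commonDist_le`).

For consistency it is enough to bound the right-hand side uniformly. A rank-one form in `E_t` is
controlled by `‖M Mᵀ‖_F`, with `M` one of the unfoldings of `E_t` (`dotProduct_rankOne_sq_le`),
and a computation of fourth moments shows that this is of smaller order than `p`
(`integral_unfoldGramNorm_sq_le`). Hence `D` tends to zero. The loadings are the eigenvectors of
the second moment matrices of the unfolded common components, whose eigenvalues are separated. A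
quantitative Davis–Kahan bound (`one_sub_sq_dotProduct_le`) shows that, up to signs, the squared
errors of the loadings and of the factors are at most a constant times `D²`
(`loadingError_le_commonDist`, `factorError_le_commonDist`).

For the rate, `C_t - C_{0t}` is expanded by multilinearity about the true parameter with aligned
signs (`avg_noise_le`). The terms of degree at least two in the errors are `o(D²)`, by the bound
for rank-one forms. The terms that are linear in the factors are `O(p^{-1/2} D)`. In those that
are linear in the loadings, the weights are first replaced by the weights of the noise alone,
which are within `√d_t / τ`, so that the change is again `o(D²)`. What remains is a weighted
score. Its variance is small because the times are independent, and its mean because a weight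
hardly depends on a single entry of the noise: compared with the weight computed without that
entry it changes by `O(p^{-1/2})` (`abs_integral_residualWeight_mul_entry_le`,
`integral_weighted_score_sq_le`). Altogether `D² ≤ C (√ρ D + ρ) + o(D²)` for every `ρ` that bounds
`1 / p` and all `1 / (T p_{-k})`, in particular for `ρ = 1 / L*`, so `D² = O(ρ)`
(`exists_errors_le_of_noiseBounds`). Markov's inequality for the sum of the noise statistics
(`noiseTotal`) turns this into a statement in probability.

The argument needs `p_{-k} → ∞`, that is, order at least two. In order one `L* = 1`, and the claim
says only that the errors are bounded.
-/

namespace TensorFactor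

/-! ### Multilinear algebra of tensors -/

section TensorAlgebra

variable {K : ℕ} {p r : Fin K → ℕ}

/-- The rank-one tensor `a₁ ⊗ ⋯ ⊗ a_K`. -/
def rankOne (a : ∀ k, Fin (p k) → ℝ) : Tensor p := fun i => ∏ k, a k (i k)

/-- The tuple of the columns number `j k` of the matrices `A k`. -/
def cols (A : ∀ k, Matrix (Fin (p k)) (Fin (r k)) ℝ) (j : ∀ k, Fin (r k)) (k : Fin K) :
    Fin (p k) → ℝ :=
  fun i => A k i (j k)

theorem tensorNorm_nonneg (x : Tensor p) : 0 ≤ tensorNorm x := Real.sqrt_nonneg _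

theorem tensorNorm_sq (x : Tensor p) : tensorNorm x ^ 2 = ∑ i, x i ^ 2 :=
  Real.sq_sqrt (Finset.sum_nonneg fun _ _ => sq_nonneg _)

theorem tensorNorm_eq_norm (x : Tensor p) : tensorNorm x = ‖WithLp.toLp 2 x‖ := by
  simp [EuclideanSpace.norm_eq, tensorNorm]

theorem tensorNorm_sub_le (x y : Tensor p) :
    tensorNorm (x - y) ≤ tensorNorm x + tensorNorm y := by
  simp only [tensorNorm_eq_norm]
  exact norm_sub_le (WithLp.toLp 2 x) (WithLp.toLp 2 y)

theorem tensorNorm_sum_le {ι : Type*} (s : Finset ι) (f : ι → Tensor p) :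
    tensorNorm (∑ i ∈ s, f i) ≤ ∑ i ∈ s, tensorNorm (f i) := by
  simp only [tensorNorm_eq_norm]
  rw [WithLp.toLp_sum]
  exact norm_sum_le _ _

theorem tensorNorm_smul (c : ℝ) (x : Tensor p) : tensorNorm (c • x) = |c| * tensorNorm x := by
  simp only [tensorNorm_eq_norm, WithLp.toLp_smul, norm_smul, Real.norm_eq_abs]

theorem abs_le_tensorNorm (x : Tensor p) (i : ∀ k, Fin (p k)) : |x i| ≤ tensorNorm x := by
  rw [← Real.sqrt_sq_eq_abs]
  exact Real.sqrt_le_sqrt (Finset.single_le_sum (f := fun i => x i ^ 2)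
    (fun _ _ => sq_nonneg _) (Finset.mem_univ i))

theorem abs_dotProduct_le {ι : Type*} [Fintype ι] (x y : ι → ℝ) :
    |x ⬝ᵥ y| ≤ √(∑ i, x i ^ 2) * √(∑ i, y i ^ 2) := by
  rw [← Real.sqrt_mul (Finset.sum_nonneg fun _ _ => sq_nonneg _), ← Real.sqrt_sq_eq_abs]
  exact Real.sqrt_le_sqrt (Finset.sum_mul_sq_le_sq_mul_sq _ _ _)

theorem tensorNorm_sq_add (x y : Tensor p) :
    tensorNorm (x + y) ^ 2 = tensorNorm x ^ 2 + 2 * (x ⬝ᵥ y) + tensorNorm y ^ 2 := by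
  simp only [tensorNorm_sq, dotProduct, Finset.mul_sum, ← Finset.sum_add_distrib, Pi.add_apply]
  exact Finset.sum_congr rfl fun _ _ => by ring

theorem dotProduct_self_eq_tensorNorm_sq (x : Tensor p) : x ⬝ᵥ x = tensorNorm x ^ 2 := by
  rw [tensorNorm_sq]
  exact Finset.sum_congr rfl fun _ _ => (sq _).symm

theorem sum_prod_apply (f : ∀ k, Fin (p k) → ℝ) :
    ∑ i : ∀ k, Fin (p k), ∏ k, f k (i k) = ∏ k, ∑ a, f k a :=
  (Fintype.prod_sum f).symm

theorem rankOne_dotProduct_rankOne (a b : ∀ k, Fin (p k) → ℝ) :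
    rankOne a ⬝ᵥ rankOne b = ∏ k, a k ⬝ᵥ b k := by
  simp only [dotProduct, rankOne, ← Finset.prod_mul_distrib]
  exact sum_prod_apply fun k i => a k i * b k i

theorem tensorNorm_rankOne (a : ∀ k, Fin (p k) → ℝ) :
    tensorNorm (rankOne a) = ∏ k, √(∑ i, a k i ^ 2) := by
  rw [tensorNorm, ← Real.sqrt_prod _ fun k _ => Finset.sum_nonneg fun _ _ => sq_nonneg _]
  congr 1
  rw [← sum_prod_apply fun k i => a k i ^ 2]
  simp [rankOne, Finset.prod_pow]

theorem multiModeProd_eq_sum (F : Tensor r) (A : ∀ k, Matrix (Fin (p k)) (Fin (r k)) ℝ) :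
    multiModeProd F A = ∑ j, F j • rankOne (cols A j) := by
  ext i
  simp [multiModeProd, rankOne, cols]

theorem multiModeProd_sub (F G : Tensor r) (A : ∀ k, Matrix (Fin (p k)) (Fin (r k)) ℝ) :
    multiModeProd (F - G) A = multiModeProd F A - multiModeProd G A := by
  simp [multiModeProd_eq_sum, sub_smul]

theorem dotProduct_multiModeProd (x : Tensor p) (F : Tensor r)
    (A : ∀ k, Matrix (Fin (p k)) (Fin (r k)) ℝ) :
    x ⬝ᵥ multiModeProd F A = ∑ j, F j * (x ⬝ᵥ rankOne (cols A j)) := by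
  simp [multiModeProd_eq_sum, dotProduct_sum]

/-- Expansion of `(a₁ + b₁) ⊗ ⋯ ⊗ (a_K + b_K)` over the subsets of modes that carry `a`. -/
theorem rankOne_add (a b : ∀ k, Fin (p k) → ℝ) :
    rankOne (a + b) = ∑ s : Finset (Fin K), rankOne (s.piecewise a b) := by
  ext i
  simp only [rankOne, Pi.add_apply, Finset.prod_add, Finset.powerset_univ, Finset.sum_apply]
  refine Finset.sum_congr rfl fun s _ => ?_
  rw [← Finset.prod_mul_prod_compl s]
  congr 1
  · exact Finset.prod_congr rfl fun k hk => by simp [hk]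
  · rw [← Finset.compl_eq_univ_sdiff]
    exact Finset.prod_congr rfl fun k hk => by
      rw [Finset.piecewise_eq_of_notMem _ _ _ (Finset.mem_compl.1 hk)]

/-- `ℱ ↦ ℱ ×₁ A₁ ×₂ ⋯ ×_K A_K` scales inner products by `p` when `A_kᵀ A_k = p_k I`. -/
theorem multiModeProd_dotProduct_multiModeProd {A : ∀ k, Matrix (Fin (p k)) (Fin (r k)) ℝ}
    (hA : ∀ k, (A k).transpose * A k = (p k : ℝ) • 1) (F G : Tensor r) :
    multiModeProd F A ⬝ᵥ multiModeProd G A = size p * (F ⬝ᵥ G) := by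
  have key : ∀ j j' : ∀ k, Fin (r k), rankOne (cols A j) ⬝ᵥ rankOne (cols A j') =
      if j = j' then (size p : ℝ) else 0 := by
    intro j j'
    have h : ∀ k, cols A j k ⬝ᵥ cols A j' k = if j k = j' k then (p k : ℝ) else 0 := by
      intro k
      have := congrFun (congrFun (hA k) (j k)) (j' k)
      simp only [Matrix.mul_apply, Matrix.transpose_apply, Matrix.smul_apply, Matrix.one_apply,
        smul_eq_mul, mul_ite, mul_one, mul_zero] at this
      exact this
    rw [rankOne_dotProduct_rankOne, Finset.prod_congr rfl fun k _ => h k]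
    split_ifs with hj
    · simp [hj, size]
    · obtain ⟨k, hk⟩ := Function.ne_iff.1 hj
      exact Finset.prod_eq_zero (Finset.mem_univ k) (by simp [hk])
  rw [multiModeProd_eq_sum F, multiModeProd_eq_sum G]
  simp only [sum_dotProduct, dotProduct_sum, smul_dotProduct, dotProduct_smul, key, smul_eq_mul,
    mul_ite, mul_zero]
  rw [dotProduct, Finset.mul_sum]
  refine Finset.sum_congr rfl fun j _ => ?_
  rw [Finset.sum_ite_eq' _ j, if_pos (Finset.mem_univ j)]
  ring

theorem tensorNorm_multiModeProd {A : ∀ k, Matrix (Fin (p k)) (Fin (r k)) ℝ}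
    (hA : ∀ k, (A k).transpose * A k = (p k : ℝ) • 1) (F : Tensor r) :
    tensorNorm (multiModeProd F A) = √(size p) * tensorNorm F := by
  rw [← Real.sqrt_sq (tensorNorm_nonneg (multiModeProd F A)),
    ← dotProduct_self_eq_tensorNorm_sq, multiModeProd_dotProduct_multiModeProd hA,
    dotProduct_self_eq_tensorNorm_sq, Real.sqrt_mul (by positivity),
    Real.sqrt_sq (tensorNorm_nonneg F)]

theorem matrixNorm_sq {m n : Type*} [Fintype m] [Fintype n] (A : Matrix m n ℝ) :
    matrixNorm A ^ 2 = ∑ i, ∑ j, A i j ^ 2 :=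
  Real.sq_sqrt (Finset.sum_nonneg fun _ _ => Finset.sum_nonneg fun _ _ => sq_nonneg _)

theorem matrixNorm_nonneg {m n : Type*} [Fintype m] [Fintype n] (A : Matrix m n ℝ) :
    0 ≤ matrixNorm A := Real.sqrt_nonneg _

open scoped Matrix.Norms.Frobenius in
theorem matrixNorm_eq_norm {m n : Type*} [Fintype m] [Fintype n] (A : Matrix m n ℝ) :
    matrixNorm A = ‖A‖ := by
  rw [Matrix.frobenius_norm_def, matrixNorm, Real.sqrt_eq_rpow]
  simp

theorem sum_unfold (k : Fin K) (f : Tensor p) :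
    ∑ a, ∑ c, unfold k f a c = ∑ i, f i := by
  rw [← Fintype.sum_prod_type' fun a c => unfold k f a c]
  exact Equiv.sum_comp (Equiv.piSplitAt k fun j => Fin (p j)).symm f

theorem matrixNorm_unfold (k : Fin K) (x : Tensor p) : matrixNorm (unfold k x) = tensorNorm x := by
  rw [matrixNorm, tensorNorm, ← sum_unfold k fun i => x i ^ 2]
  rfl

theorem prod_piSplitAt_symm (k : Fin K) (g : ∀ l, Fin (p l) → ℝ) (a : Fin (p k))
    (c : ∀ j : {j // j ≠ k}, Fin (p j)) :
    ∏ l, g l ((Equiv.piSplitAt k fun j => Fin (p j)).symm (a, c) l) =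
      g k a * ∏ l : {l // l ≠ k}, g l (c l) := by
  rw [Fintype.prod_eq_mul_prod_subtype_ne _ k]
  congr 1
  · simp [Equiv.piSplitAt]
  · refine Finset.prod_congr rfl fun l _ => ?_
    simp [Equiv.piSplitAt, l.2]

/-- The Kronecker product of the matrices `A l`, `l ≠ k`. -/
def kroneckerExcept (A : ∀ k, Matrix (Fin (p k)) (Fin (r k)) ℝ) (k : Fin K) :
    Matrix (∀ j : {j // j ≠ k}, Fin (p j)) (∀ j : {j // j ≠ k}, Fin (r j)) ℝ :=
  Matrix.of fun c b => ∏ l : {l // l ≠ k}, A l (c l) (b l)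

theorem unfold_multiModeProd (k : Fin K) (F : Tensor r)
    (A : ∀ k, Matrix (Fin (p k)) (Fin (r k)) ℝ) :
    unfold k (multiModeProd F A) = A k * unfold k F * (kroneckerExcept A k).transpose := by
  ext a c
  have h1 : unfold k (multiModeProd F A) a c = ∑ j : ∀ k, Fin (r k), F j *
      ∏ l, A l ((Equiv.piSplitAt k fun j => Fin (p j)).symm (a, c) l) (j l) := rfl
  rw [h1, ← sum_unfold k fun j => F j *
      ∏ l, A l ((Equiv.piSplitAt k fun j => Fin (p j)).symm (a, c) l) (j l)]
  simp only [Matrix.mul_apply, Finset.sum_mul]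
  rw [Finset.sum_comm]
  refine Finset.sum_congr rfl fun a' _ => Finset.sum_congr rfl fun b' _ => ?_
  simp only [unfold, Matrix.of_apply, Matrix.transpose_apply, kroneckerExcept]
  rw [Fintype.prod_eq_mul_prod_subtype_ne _ k]
  have h2 : ∀ l : {l // l ≠ k}, A l ((Equiv.piSplitAt k fun j => Fin (p j)).symm (a, c) l)
      ((Equiv.piSplitAt k fun j => Fin (r j)).symm (a', b') l) = A l (c l) (b' l) := by
    intro l
    simp [Equiv.piSplitAt, l.2]
  rw [Finset.prod_congr rfl fun l _ => h2 l]
  have h3 : A k ((Equiv.piSplitAt k fun j => Fin (p j)).symm (a, c) k)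
      ((Equiv.piSplitAt k fun j => Fin (r j)).symm (a', b') k) = A k a a' := by
    simp [Equiv.piSplitAt]
  rw [h3]
  ring

theorem sizeExcept_eq (p : Fin K → ℕ) (k : Fin K) :
    sizeExcept p k = ∏ l : {l // l ≠ k}, p l := by
  rw [sizeExcept, ← Finset.prod_subtype (Finset.univ.erase k) (by simp) p]

theorem size_eq_mul_sizeExcept (p : Fin K → ℕ) (k : Fin K) : size p = p k * sizeExcept p k := by
  rw [size, sizeExcept, Finset.mul_prod_erase _ _ (Finset.mem_univ k)]

theorem kroneckerExcept_transpose_mul_self {A : ∀ k, Matrix (Fin (p k)) (Fin (r k)) ℝ}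
    (hA : ∀ k, (A k).transpose * A k = (p k : ℝ) • 1) (k : Fin K) :
    (kroneckerExcept A k).transpose * kroneckerExcept A k = (sizeExcept p k : ℝ) • 1 := by
  ext b b'
  simp only [Matrix.mul_apply, Matrix.transpose_apply, kroneckerExcept, Matrix.of_apply,
    ← Finset.prod_mul_distrib]
  rw [← Fintype.prod_sum fun (l : {l // l ≠ k}) (c : Fin (p l)) => A l c (b l) * A l c (b' l)]
  have h : ∀ l : {l // l ≠ k}, ∑ c, A l c (b l) * A l c (b' l) =
      if b l = b' l then (p l : ℝ) else 0 := by
    intro l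
    have := congrFun (congrFun (hA l) (b l)) (b' l)
    simpa [Matrix.mul_apply, Matrix.one_apply] using this
  rw [Finset.prod_congr rfl fun l _ => h l, sizeExcept_eq]
  simp only [Matrix.smul_apply, Matrix.one_apply, smul_eq_mul, mul_ite, mul_one, mul_zero]
  split_ifs with hb
  · simp [hb]
  · obtain ⟨l, hl⟩ := Function.ne_iff.1 hb
    exact Finset.prod_eq_zero (Finset.mem_univ l) (by simp [hl])

theorem unfold_multiModeProd_mul_transpose {A : ∀ k, Matrix (Fin (p k)) (Fin (r k)) ℝ}
    (hA : ∀ k, (A k).transpose * A k = (p k : ℝ) • 1) (k : Fin K) (F : Tensor r) :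
    unfold k (multiModeProd F A) * (unfold k (multiModeProd F A)).transpose =
      (sizeExcept p k : ℝ) • (A k * (unfold k F * (unfold k F).transpose) * (A k).transpose) := by
  have h := kroneckerExcept_transpose_mul_self hA k
  rw [unfold_multiModeProd]
  simp only [Matrix.transpose_mul, Matrix.transpose_transpose]
  rw [Matrix.mul_assoc (A k * unfold k F), ← Matrix.mul_assoc _ (kroneckerExcept A k), h]
  simp [Matrix.mul_assoc]

/-- A rank-one form is controlled by the Gram matrix of one unfolding: writing `M` for the
unfolding and `v` for the product of the other factors, `⟨x, a₁ ⊗ ⋯ ⊗ a_K⟩ = a_kᵀ M v`, and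
`‖Mᵀ a_k‖² = a_kᵀ M Mᵀ a_k ≤ ‖M Mᵀ‖_F ‖a_k‖²`. -/
theorem dotProduct_rankOne_sq_le (k : Fin K) (x : Tensor p) (a : ∀ k, Fin (p k) → ℝ) :
    (x ⬝ᵥ rankOne a) ^ 2 ≤
      matrixNorm (unfold k x * (unfold k x).transpose) * ∏ l, ∑ i, a l i ^ 2 := by
  set M := unfold k x with hM
  set v : (∀ j : {j // j ≠ k}, Fin (p j)) → ℝ := fun c => ∏ l : {l // l ≠ k}, a l (c l) with hv
  have h1 : x ⬝ᵥ rankOne a = ∑ c, (∑ i, M i c * a k i) * v c := by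
    have e : ∀ i c, unfold k (fun i => x i * rankOne a i) i c = M i c * a k i * v c := by
      intro i c
      simp only [unfold, Matrix.of_apply, rankOne, hM, hv, mul_assoc]
      rw [prod_piSplitAt_symm k a]
    rw [dotProduct, ← sum_unfold k fun i => x i * rankOne a i]
    simp only [e, Finset.sum_mul]
    exact Finset.sum_comm
  have h2 : ∑ c, v c ^ 2 = ∏ l : {l // l ≠ k}, ∑ i, a l i ^ 2 := by
    rw [Fintype.prod_sum fun (l : {l // l ≠ k}) i => a l i ^ 2]
    simp [hv, Finset.prod_pow]
  have h3 : ∑ c, (∑ i, M i c * a k i) ^ 2 ≤ matrixNorm (M * M.transpose) * ∑ i, a k i ^ 2 := by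
    have e : ∑ c, (∑ i, M i c * a k i) ^ 2 =
        ∑ q : Fin (p k) × Fin (p k), (M * M.transpose) q.1 q.2 * (a k q.1 * a k q.2) := by
      rw [Fintype.sum_prod_type]
      have e1 : ∀ c, (∑ i, M i c * a k i) ^ 2 =
          ∑ i, ∑ i', M i c * M i' c * (a k i * a k i') := by
        intro c
        rw [sq, Finset.sum_mul_sum]
        exact Finset.sum_congr rfl fun i _ => Finset.sum_congr rfl fun i _ => by ring
      simp only [e1, Matrix.mul_apply, Matrix.transpose_apply, Finset.sum_mul]
      rw [Finset.sum_comm]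
      exact Finset.sum_congr rfl fun i _ => Finset.sum_comm
    have e2 : ∑ q : Fin (p k) × Fin (p k), (a k q.1 * a k q.2) ^ 2 = (∑ i, a k i ^ 2) ^ 2 := by
      rw [sq, Finset.sum_mul_sum, Fintype.sum_prod_type]
      simp [mul_pow]
    rw [e]
    refine (le_abs_self _).trans ((abs_dotProduct_le (fun q : Fin (p k) × Fin (p k) =>
      (M * M.transpose) q.1 q.2) (fun q => a k q.1 * a k q.2)).trans_eq ?_)
    rw [e2, Real.sqrt_sq (Finset.sum_nonneg fun _ _ => sq_nonneg _), matrixNorm,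
      Fintype.sum_prod_type]
  rw [h1, Fintype.prod_eq_mul_prod_subtype_ne _ k, ← h2, ← mul_assoc]
  refine (Finset.sum_mul_sq_le_sq_mul_sq _ _ _).trans ?_
  exact mul_le_mul_of_nonneg_right h3 (Finset.sum_nonneg fun _ _ => sq_nonneg _)

end TensorAlgebra

/-! ### The Huber loss -/

section Huber

/-- The weight `H_τ'(x) / x = min {1, τ / x}` of the Huber loss. -/
noncomputable def huberWeight (τ x : ℝ) : ℝ := τ / max τ x

theorem huberWeight_pos {τ : ℝ} (hτ : 0 < τ) (x : ℝ) : 0 < huberWeight τ x :=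
  div_pos hτ (lt_max_of_lt_left hτ)

theorem huberWeight_le_one {τ : ℝ} (hτ : 0 < τ) (x : ℝ) : huberWeight τ x ≤ 1 :=
  (div_le_one (lt_max_of_lt_left hτ)).2 (le_max_left _ _)

theorem div_add_le_huberWeight {τ x y : ℝ} (hτ : 0 < τ) (hy : 0 ≤ y) (hxy : x ≤ y) :
    τ / (τ + y) ≤ huberWeight τ x :=
  div_le_div_of_nonneg_left hτ.le (lt_max_of_lt_left hτ) (max_le (by linarith) (by linarith))

theorem abs_huberWeight_sub_le {τ : ℝ} (hτ : 0 < τ) (x y : ℝ) :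
    |huberWeight τ x - huberWeight τ y| ≤ |x - y| / τ := by
  have hx : τ ≤ max τ x := le_max_left _ _
  have hy : τ ≤ max τ y := le_max_left _ _
  have hX : 0 < max τ x := hτ.trans_le hx
  have hY : 0 < max τ y := hτ.trans_le hy
  have h : huberWeight τ x - huberWeight τ y =
      τ * (max τ y - max τ x) / (max τ x * max τ y) := by
    unfold huberWeight
    field_simp
  have h2 : |max τ y - max τ x| ≤ |x - y| := by
    rw [abs_sub_comm x y]
    simpa using abs_max_sub_max_le_abs y x τ |> fun h => by simpa [max_comm] using h
  rw [h, abs_div, abs_mul, abs_of_pos hτ, abs_of_pos (mul_pos hX hY),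
    div_le_div_iff₀ (mul_pos hX hY) hτ]
  calc τ * |max τ y - max τ x| * τ ≤ τ * |x - y| * τ := by gcongr
    _ = |x - y| * (τ * τ) := by ring
    _ ≤ |x - y| * (max τ x * max τ y) := by gcongr

theorem measurable_huberWeight (τ : ℝ) : Measurable (huberWeight τ) := by
  unfold huberWeight
  fun_prop

/-- As a function of `x²` the Huber loss is concave, so it lies below its tangent at `y²`. -/
theorem huberWeight_mul_le_huber_sub {τ x y : ℝ} (hτ : 0 < τ) (hx : 0 ≤ x) (hy : 0 ≤ y) :
    huberWeight τ y / 2 * (y ^ 2 - x ^ 2) ≤ huber τ y - huber τ x := by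
  unfold huber huberWeight
  rw [abs_of_nonneg hx, abs_of_nonneg hy]
  rcases le_or_gt y τ with h | h
  · rw [max_eq_left h, div_self hτ.ne', if_pos h]
    split_ifs
    · linarith
    · nlinarith [sq_nonneg (x - τ)]
  · have hy0 : 0 < y := hτ.trans h
    rw [max_eq_right h.le, if_neg h.not_ge, div_div, div_mul_eq_mul_div,
      div_le_iff₀ (by positivity)]
    split_ifs with hxτ
    · nlinarith [mul_nonneg (sub_nonneg.2 h.le) (sub_nonneg.2 (pow_le_pow_left₀ hx hxτ 2)),
        mul_nonneg (sub_nonneg.2 h.le) (sub_nonneg.2 (mul_le_mul_of_nonneg_left h.le hτ.le)),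
        mul_pos hτ hy0]
    · nlinarith [mul_nonneg hτ.le (sq_nonneg (x - y))]

end Huber

/-! ### Perturbation of eigenvectors -/

section Eigen

variable {m : Type*} [Fintype m] {n : ℕ}

/-- The image of an eigenvector of `U₀ Λ₀ U₀ᵀ` under `U Λ Uᵀ - U₀ Λ₀ U₀ᵀ`. -/
theorem sum_sq_sub_eigen {U : Matrix m (Fin n) ℝ} (hU : U.transpose * U = 1) {u : m → ℝ}
    (hu : u ⬝ᵥ u = 1) (l : Fin n → ℝ) (l₀ : ℝ) :
    ∑ a, (∑ j, l j * (u ⬝ᵥ U.col j) * U a j - l₀ * u a) ^ 2 =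
      l₀ ^ 2 * (1 - ∑ j, (u ⬝ᵥ U.col j) ^ 2) +
        ∑ j, (u ⬝ᵥ U.col j) ^ 2 * (l j - l₀) ^ 2 := by
  set o : Fin n → ℝ := fun j => u ⬝ᵥ U.col j with ho
  have h1 : ∑ a, (∑ j, l j * o j * U a j) ^ 2 = ∑ j, (l j * o j) ^ 2 := by
    have e : ∀ i j, ∑ a, U a i * U a j = if i = j then 1 else 0 := by
      intro i j
      have := congrFun (congrFun hU i) j
      simpa [Matrix.mul_apply, Matrix.one_apply] using this
    simp only [sq, Finset.sum_mul_sum]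
    rw [Finset.sum_comm]
    refine Finset.sum_congr rfl fun i _ => ?_
    rw [Finset.sum_comm]
    have : ∀ j, ∑ a, l i * o i * U a i * (l j * o j * U a j) =
        l i * o i * (l j * o j) * if i = j then 1 else 0 := by
      intro j
      rw [← e, Finset.mul_sum]
      exact Finset.sum_congr rfl fun _ _ => by ring
    simp [this]
  have h2 : ∑ a, (∑ j, l j * o j * U a j) * u a = ∑ j, l j * o j ^ 2 := by
    simp only [Finset.sum_mul]
    rw [Finset.sum_comm]
    refine Finset.sum_congr rfl fun j _ => ?_
    have : o j = ∑ a, u a * U a j := rfl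
    rw [sq, ← mul_assoc]
    nth_rw 3 [this]
    rw [Finset.mul_sum]
    exact Finset.sum_congr rfl fun _ _ => by ring
  have h3 : ∑ a, u a ^ 2 = 1 := by
    rw [← hu]
    exact Finset.sum_congr rfl fun _ _ => sq _
  have h4 : ∀ a, (∑ j, l j * o j * U a j - l₀ * u a) ^ 2 = (∑ j, l j * o j * U a j) ^ 2 -
      2 * l₀ * ((∑ j, l j * o j * U a j) * u a) + l₀ ^ 2 * u a ^ 2 := fun a => by ring
  rw [Finset.sum_congr rfl fun a _ => h4 a, Finset.sum_add_distrib, Finset.sum_sub_distrib,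
    ← Finset.mul_sum, ← Finset.mul_sum, h1, h2, h3]
  have h5 : ∀ j, o j ^ 2 * (l j - l₀) ^ 2 =
      (l j * o j) ^ 2 - 2 * l₀ * (l j * o j ^ 2) + l₀ ^ 2 * o j ^ 2 := fun j => by ring
  rw [Finset.sum_congr rfl fun j _ => h5 j, Finset.sum_add_distrib, Finset.sum_sub_distrib,
    ← Finset.mul_sum, ← Finset.mul_sum]
  ring

/-- A quantitative Davis–Kahan bound. The `i`-th row of `O = U₀ᵀ U` has norm close to one and is
concentrated on the `j` with `l j` close to `l₀ i`; since `l` is antitone and the `l₀ i` are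
separated, such a `j` exists only if `j = i`. -/
theorem one_sub_sq_dotProduct_le {U U₀ : Matrix m (Fin n) ℝ} (hU : U.transpose * U = 1)
    (hU₀ : U₀.transpose * U₀ = 1) {l l₀ : Fin n → ℝ} (hl : Antitone l) {g ε : ℝ}
    (hg : 0 < g)
    (hl₀ : ∀ i, g ≤ l₀ i) (hgap : ∀ i j, i < j → g ≤ l₀ i - l₀ j)
    (hεg : 8 * (n + 1) * ε ^ 2 ≤ g ^ 2)
    (h : ∀ i, ∑ a, (∑ j, l j * (U₀.col i ⬝ᵥ U.col j) * U a j - l₀ i * U₀ a i) ^ 2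
      ≤ ε ^ 2) (i : Fin n) :
    1 - (U₀.col i ⬝ᵥ U.col i) ^ 2 ≤ (4 * n + 1) / g ^ 2 * ε ^ 2 := by
  set o : Fin n → Fin n → ℝ := fun i j => U₀.col i ⬝ᵥ U.col j with ho
  have hg2 : 0 < g ^ 2 := by positivity
  have hu : ∀ i, U₀.col i ⬝ᵥ U₀.col i = 1 := by
    intro i
    have h1 : (U₀.transpose * U₀) i i = 1 := by rw [hU₀, Matrix.one_apply_eq]
    exact h1
  have key : ∀ i, l₀ i ^ 2 * (1 - ∑ j, o i j ^ 2) + ∑ j, o i j ^ 2 * (l j - l₀ i) ^ 2 ≤ ε ^ 2 := by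
    intro i
    rw [← sum_sq_sub_eigen hU (hu i) l (l₀ i)]
    exact h i
  -- Bessel's inequality, from the same identity with all eigenvalues equal to one
  have bessel : ∀ i, ∑ j, o i j ^ 2 ≤ 1 := by
    intro i
    have h1 := sum_sq_sub_eigen hU (hu i) (fun _ => 1) 1
    have h2 : 0 ≤ ∑ a, (∑ j, 1 * (U₀.col i ⬝ᵥ U.col j) * U a j -
      1 * U₀.col i a) ^ 2 := Finset.sum_nonneg fun _ _ => sq_nonneg _
    rw [h1] at h2
    simp only [sub_self, ne_eq, OfNat.ofNat_ne_zero, not_false_eq_true, zero_pow, mul_zero,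
      Finset.sum_const_zero, one_pow, one_mul, add_zero] at h2
    exact sub_nonneg.1 h2
  have hrow : ∀ i, 1 - ∑ j, o i j ^ 2 ≤ ε ^ 2 / g ^ 2 := by
    intro i
    rw [le_div_iff₀ hg2]
    have h1 : 0 ≤ ∑ j, o i j ^ 2 * (l j - l₀ i) ^ 2 :=
      Finset.sum_nonneg fun _ _ => by positivity
    have h2 : g ^ 2 ≤ l₀ i ^ 2 := pow_le_pow_left₀ hg.le (hl₀ i) 2
    nlinarith [key i, mul_le_mul_of_nonneg_left h2 (sub_nonneg.2 (bessel i))]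
  have hent : ∀ i j, o i j ^ 2 * (l j - l₀ i) ^ 2 ≤ ε ^ 2 := by
    intro i j
    have h1 : o i j ^ 2 * (l j - l₀ i) ^ 2 ≤ ∑ j, o i j ^ 2 * (l j - l₀ i) ^ 2 :=
      Finset.single_le_sum (f := fun j => o i j ^ 2 * (l j - l₀ i) ^ 2)
        (fun _ _ => by positivity) (Finset.mem_univ j)
    have h2 : 0 ≤ l₀ i ^ 2 * (1 - ∑ j, o i j ^ 2) :=
      mul_nonneg (sq_nonneg _) (sub_nonneg.2 (bessel i))
    linarith [key i]
  have hn : (0 : ℝ) < n := by exact_mod_cast i.pos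
  have hε2 : ε ^ 2 / g ^ 2 ≤ 1 / 8 := by
    rw [div_le_iff₀ hg2]
    nlinarith [sq_nonneg ε]
  have hex : ∀ i, ∃ j, |l j - l₀ i| < g / 2 := by
    intro i
    obtain ⟨j, -, hj⟩ := Finset.exists_le_of_sum_le (s := Finset.univ)
      (f := fun _ : Fin n => 1 / (2 * n : ℝ)) (g := fun j => o i j ^ 2) ⟨i, Finset.mem_univ i⟩ (by
        simp only [Finset.sum_const, Finset.card_univ, Fintype.card_fin, nsmul_eq_mul]
        have : (n : ℝ) * (1 / (2 * n)) = 1 / 2 := by field_simp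
        linarith [hrow i])
    refine ⟨j, ?_⟩
    have h1 : (l j - l₀ i) ^ 2 ≤ 2 * n * ε ^ 2 := by
      have : 1 / (2 * n : ℝ) * (l j - l₀ i) ^ 2 ≤ ε ^ 2 :=
        (mul_le_mul_of_nonneg_right hj (sq_nonneg _)).trans (hent i j)
      rwa [div_mul_eq_mul_div, one_mul, div_le_iff₀ (by positivity), mul_comm] at this
    refine abs_lt_of_sq_lt_sq ?_ (by positivity)
    nlinarith [sq_nonneg ε]
  choose π hπ using hex
  have hmono : StrictMono π := by
    intro i i' hii
    by_contra hle
    have h1 := hl (not_lt.1 hle)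
    have h2 := abs_lt.1 (hπ i)
    have h3 := abs_lt.1 (hπ i')
    linarith [hgap i i' hii, h2.1, h3.2]
  have hid : ∀ i, π i = i := by
    intro i
    have hsurj : Set.range π = Set.range (id : Fin n → Fin n) := by
      rw [Set.range_id, (Finite.injective_iff_surjective.1 hmono.injective).range_eq]
    exact congrFun (StrictMono.range_inj hmono strictMono_id |>.1 hsurj) i
  have hoff : ∀ j, j ≠ i → o i j ^ 2 ≤ 4 / g ^ 2 * ε ^ 2 := by
    intro j hj
    have h1 := abs_lt.1 (hid j ▸ hπ j)
    have h2 : g / 2 ≤ |l j - l₀ i| := by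
      rcases lt_or_gt_of_ne hj with h | h
      · exact (by linarith [hgap j i h, h1.1] : g / 2 ≤ l j - l₀ i).trans (le_abs_self _)
      · exact (by linarith [hgap i j h, h1.2] : g / 2 ≤ -(l j - l₀ i)).trans (neg_le_abs _)
    have h3 : g ^ 2 / 4 ≤ (l j - l₀ i) ^ 2 := by
      rw [← sq_abs (l j - l₀ i)]
      calc g ^ 2 / 4 = (g / 2) ^ 2 := by ring
        _ ≤ _ := pow_le_pow_left₀ (by positivity) h2 2
    rw [div_mul_eq_mul_div, le_div_iff₀ hg2]
    nlinarith [hent i j, mul_le_mul_of_nonneg_left h3 (sq_nonneg (o i j))]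
  have hsum : ∑ j ∈ Finset.univ.erase i, o i j ^ 2 ≤ n * (4 / g ^ 2 * ε ^ 2) := by
    refine (Finset.sum_le_card_nsmul _ _ _ fun j hj => hoff j (Finset.ne_of_mem_erase hj)).trans ?_
    rw [nsmul_eq_mul]
    refine mul_le_mul_of_nonneg_right ?_ (by positivity)
    exact_mod_cast (Finset.card_le_univ _).trans_eq (Fintype.card_fin n)
  have h1 := hrow i
  rw [← Finset.add_sum_erase _ _ (Finset.mem_univ i)] at h1
  calc 1 - o i i ^ 2 ≤ ε ^ 2 / g ^ 2 + n * (4 / g ^ 2 * ε ^ 2) := by linarith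
    _ = _ := by ring

end Eigen

/-! ### Identification of the parameters by the common components -/

section Identification

theorem avg_mul_le {T : ℕ} (x y : Fin T → ℝ) :
    (T : ℝ)⁻¹ * ∑ t, x t * y t ≤
      √((T : ℝ)⁻¹ * ∑ t, x t ^ 2) * √((T : ℝ)⁻¹ * ∑ t, y t ^ 2) := by
  have hT : (0 : ℝ) ≤ (T : ℝ)⁻¹ := by positivity
  rw [Real.sqrt_mul hT, Real.sqrt_mul hT, mul_mul_mul_comm, Real.mul_self_sqrt hT]
  exact mul_le_mul_of_nonneg_left ((le_abs_self _).trans (abs_dotProduct_le x y)) hT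

theorem avg_le_sqrt_avg_sq {T : ℕ} (x : Fin T → ℝ) :
    (T : ℝ)⁻¹ * ∑ t, x t ≤ √((T : ℝ)⁻¹ * ∑ t, x t ^ 2) := by
  have h := avg_mul_le x fun _ => 1
  simp only [mul_one, one_pow, Finset.sum_const, Finset.card_univ, Fintype.card_fin,
    nsmul_eq_mul] at h
  refine h.trans (mul_le_of_le_one_right (Real.sqrt_nonneg _) (Real.sqrt_le_one.2 ?_))
  exact inv_mul_le_one

/-- The bound `one_sub_sq_dotProduct_le` in terms of the Frobenius distance `ε` of the two symmetric
matrices. The factor `n` comes from `‖U₀‖_F² = n`. -/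
theorem one_sub_sq_le_of_matrixNorm_sub_le {m : Type*} [Fintype m] {n : ℕ}
    {U U₀ : Matrix m (Fin n) ℝ} (hU : U.transpose * U = 1)
    (hU₀ : U₀.transpose * U₀ = 1) {l l₀ : Fin n → ℝ} (hl : Antitone l) {g ε : ℝ}
    (hg : 0 < g) (hl₀ : ∀ i, g ≤ l₀ i) (hgap : ∀ i j, i < j → g ≤ l₀ i - l₀ j)
    (hε : matrixNorm (U * Matrix.diagonal l * U.transpose -
      U₀ * Matrix.diagonal l₀ * U₀.transpose) ≤ ε)
    (hεg : 8 * (n + 1) * (n * ε ^ 2) ≤ g ^ 2) (i : Fin n) :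
    1 - ((U₀.transpose * U) i i) ^ 2 ≤ (4 * n + 1) / g ^ 2 * (n * ε ^ 2) := by
  set N := U * Matrix.diagonal l * U.transpose - U₀ * Matrix.diagonal l₀ * U₀.transpose with hN
  have hU₀n : matrixNorm U₀ ^ 2 = n := by
    rw [matrixNorm_sq, Finset.sum_comm]
    have : ∀ j, ∑ a, U₀ a j ^ 2 = 1 := by
      intro j
      have h1 : (U₀.transpose * U₀) j j = 1 := by rw [hU₀, Matrix.one_apply_eq]
      rw [← h1, Matrix.mul_apply]
      exact Finset.sum_congr rfl fun _ _ => sq _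
    simp [this]
  have hsq : (√n * ε) ^ 2 = n * ε ^ 2 := by rw [mul_pow, Real.sq_sqrt (by positivity)]
  rw [← hsq] at hεg ⊢
  refine one_sub_sq_dotProduct_le hU hU₀ hl hg hl₀ hgap hεg (fun i => ?_) i
  have h1 : N * U₀ = U * (Matrix.diagonal l * (U.transpose * U₀)) -
      U₀ * Matrix.diagonal l₀ := by
    rw [hN, Matrix.sub_mul, Matrix.mul_assoc _ U₀.transpose, hU₀, Matrix.mul_one]
    simp only [Matrix.mul_assoc]
  have h2 : ∀ a, ∑ j, l j * (U₀.col i ⬝ᵥ U.col j) * U a j - l₀ i * U₀ a i = (N * U₀) a i := by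
    intro a
    rw [h1, Matrix.sub_apply, Matrix.mul_diagonal, Matrix.mul_apply, mul_comm (l₀ i)]
    congr 1
    refine Finset.sum_congr rfl fun j _ => ?_
    rw [Matrix.diagonal_mul, Matrix.mul_apply, dotProduct_comm, mul_comm]
    rfl
  rw [Finset.sum_congr rfl fun a _ => by rw [h2 a], hsq, ← hU₀n, mul_comm, ← mul_pow]
  have h3 : matrixNorm (N * U₀) ≤ matrixNorm N * matrixNorm U₀ := by
    simp only [matrixNorm_eq_norm]
    open scoped Matrix.Norms.Frobenius in exact Matrix.frobenius_norm_mul N U₀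
  calc ∑ a, (N * U₀) a i ^ 2 ≤ matrixNorm (N * U₀) ^ 2 := by
        rw [matrixNorm_sq]
        exact Finset.sum_le_sum fun a _ => Finset.single_le_sum
          (f := fun j => (N * U₀) a j ^ 2) (fun _ _ => sq_nonneg _) (Finset.mem_univ i)
    _ ≤ (ε * matrixNorm U₀) ^ 2 := pow_le_pow_left₀ (matrixNorm_nonneg _)
        (h3.trans (mul_le_mul_of_nonneg_right hε (matrixNorm_nonneg _))) 2

theorem matrixNorm_mul_transpose_sub_le {m n : Type*} [Fintype m] [Fintype n]
    (X Y : Matrix m n ℝ) :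
    matrixNorm (X * X.transpose - Y * Y.transpose) ≤
      matrixNorm (X - Y) * (matrixNorm X + matrixNorm Y) := by
  have h : X * X.transpose - Y * Y.transpose =
      (X - Y) * X.transpose + Y * (X - Y).transpose := by
    simp [Matrix.sub_mul, Matrix.mul_sub]
  simp only [matrixNorm_eq_norm]
  open scoped Matrix.Norms.Frobenius in
  calc ‖X * X.transpose - Y * Y.transpose‖
      ≤ ‖(X - Y) * X.transpose‖ + ‖Y * (X - Y).transpose‖ := by rw [h]; exact norm_add_le _ _
    _ ≤ ‖X - Y‖ * ‖X.transpose‖ + ‖Y‖ * ‖(X - Y).transpose‖ :=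
        add_le_add (Matrix.frobenius_norm_mul _ _) (Matrix.frobenius_norm_mul _ _)
    _ = ‖X - Y‖ * (‖X‖ + ‖Y‖) := by
        rw [Matrix.frobenius_norm_transpose, Matrix.frobenius_norm_transpose]; ring

variable {K : ℕ} {p r : Fin K → ℕ} {T : ℕ} {𝒜 : ∀ k, Set (Fin (r k) → ℝ)} {𝓕 : Set (Tensor r)}
  {θ₀ θ : Param p r T}

/-- The mean squared distance `(1/T) ∑ₜ ‖Cₜ - C₀ₜ‖_F² / p` of the common components. -/
noncomputable def commonDist (θ₀ θ : Param p r T) : ℝ :=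
  (T : ℝ)⁻¹ * ∑ t, (tensorNorm (θ.common t - θ₀.common t) / √(size p)) ^ 2

theorem commonDist_nonneg (θ₀ θ : Param p r T) : 0 ≤ commonDist θ₀ θ :=
  mul_nonneg (by positivity) (Finset.sum_nonneg fun _ _ => sq_nonneg _)

theorem transpose_mul_self_of_mem (hp : ∀ k, 0 < p k) (h : θ ∈ paramSpace p r T 𝒜 𝓕) (k : Fin K) :
    (θ.loading k).transpose * θ.loading k = (p k : ℝ) • 1 := by
  have h0 : (p k : ℝ) ≠ 0 := by exact_mod_cast (hp k).ne'
  rw [← h.2.1 k, smul_smul, mul_inv_cancel₀ h0, one_smul]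

theorem size_pos (hp : ∀ k, 0 < p k) : 0 < size p := Finset.prod_pos fun k _ => hp k

theorem tensorNorm_common (hp : ∀ k, 0 < p k) (h : θ ∈ paramSpace p r T 𝒜 𝓕) (t : Fin T) :
    tensorNorm (θ.common t) = √(size p) * tensorNorm (θ.factor t) :=
  tensorNorm_multiModeProd (transpose_mul_self_of_mem hp h) _

theorem tensorNorm_common_sub_div_le {B : ℝ} (hp : ∀ k, 0 < p k)
    (hB : ∀ F ∈ 𝓕, tensorNorm F ≤ B)
    (h₀ : θ₀ ∈ paramSpace p r T 𝒜 𝓕) (h : θ ∈ paramSpace p r T 𝒜 𝓕) (t : Fin T) :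
    tensorNorm (θ.common t - θ₀.common t) / √(size p) ≤ 2 * B := by
  have hs : 0 < √(size p : ℝ) := Real.sqrt_pos.2 (by exact_mod_cast size_pos hp)
  rw [div_le_iff₀ hs]
  refine (tensorNorm_sub_le _ _).trans ?_
  rw [tensorNorm_common hp h, tensorNorm_common hp h₀]
  nlinarith [hB _ (h.2.2.1 t), hB _ (h₀.2.2.1 t)]

/-- The mode-`k` second moment matrix of the common components has the columns of `A_k` as
eigenvectors, with the eigenvalues of the mode-`k` second moment matrix of the factors. -/
theorem smul_loading_factorGram (hp : ∀ k, 0 < p k) (h : θ ∈ paramSpace p r T 𝒜 𝓕) (k : Fin K) :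
    (p k : ℝ)⁻¹ • (θ.loading k * factorGram θ.factor k * (θ.loading k).transpose) =
      (T : ℝ)⁻¹ • ∑ t, (size p : ℝ)⁻¹ •
        (unfold k (θ.common t) * (unfold k (θ.common t)).transpose) := by
  have hk : (p k : ℝ) ≠ 0 := by exact_mod_cast (hp k).ne'
  have he : (sizeExcept p k : ℝ) ≠ 0 := by
    exact_mod_cast (Finset.prod_pos fun j _ => hp j).ne'
  have e : ∀ t, (size p : ℝ)⁻¹ • (unfold k (θ.common t) * (unfold k (θ.common t)).transpose) =
      (p k : ℝ)⁻¹ • (θ.loading k * (unfold k (θ.factor t) * (unfold k (θ.factor t)).transpose) *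
        (θ.loading k).transpose) := by
    intro t
    rw [Param.common, unfold_multiModeProd_mul_transpose (transpose_mul_self_of_mem hp h),
      smul_smul, size_eq_mul_sizeExcept p k]
    congr 1
    push_cast
    field_simp
  rw [Finset.sum_congr rfl fun t _ => e t, ← Finset.smul_sum, ← Matrix.sum_mul, ← Matrix.mul_sum,
    factorGram, smul_comm]
  congr 1
  simp

theorem matrixNorm_sum_le {m n ι : Type*} [Fintype m] [Fintype n] (s : Finset ι)
    (f : ι → Matrix m n ℝ) : matrixNorm (∑ i ∈ s, f i) ≤ ∑ i ∈ s, matrixNorm (f i) := by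
  simp only [matrixNorm_eq_norm]
  open scoped Matrix.Norms.Frobenius in exact norm_sum_le _ _

theorem matrixNorm_smul {m n : Type*} [Fintype m] [Fintype n] (c : ℝ)
    (A : Matrix m n ℝ) : matrixNorm (c • A) = |c| * matrixNorm A := by
  simp only [matrixNorm_eq_norm]
  open scoped Matrix.Norms.Frobenius in exact norm_smul c A

theorem unfold_sub (k : Fin K) (x y : Tensor p) : unfold k (x - y) = unfold k x - unfold k y := rfl

/-- The mode-`k` second moment matrices of the common components are Lipschitz in the common
components. -/
theorem matrixNorm_gram_sub_le {B : ℝ} (hp : ∀ k, 0 < p k)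
    (hB : ∀ F ∈ 𝓕, tensorNorm F ≤ B)
    (h₀ : θ₀ ∈ paramSpace p r T 𝒜 𝓕) (h : θ ∈ paramSpace p r T 𝒜 𝓕) (k : Fin K) (hB0 : 0 ≤ B) :
    matrixNorm ((p k : ℝ)⁻¹ • (θ.loading k * factorGram θ.factor k * (θ.loading k).transpose) -
      (p k : ℝ)⁻¹ • (θ₀.loading k * factorGram θ₀.factor k * (θ₀.loading k).transpose)) ≤
        2 * B * √(commonDist θ₀ θ) := by
  have hs : (0 : ℝ) < size p := by exact_mod_cast size_pos hp
  have hT : (0 : ℝ) ≤ (T : ℝ)⁻¹ := by positivity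
  rw [smul_loading_factorGram hp h, smul_loading_factorGram hp h₀, ← smul_sub,
    ← Finset.sum_sub_distrib, matrixNorm_smul, abs_of_nonneg hT]
  have key : ∀ t, matrixNorm ((size p : ℝ)⁻¹ • (unfold k (θ.common t) *
      (unfold k (θ.common t)).transpose) - (size p : ℝ)⁻¹ • (unfold k (θ₀.common t) *
      (unfold k (θ₀.common t)).transpose)) ≤
      2 * B * (tensorNorm (θ.common t - θ₀.common t) / √(size p)) := by
    intro t
    rw [← smul_sub, matrixNorm_smul, abs_of_pos (inv_pos.2 hs)]
    have h1 := matrixNorm_mul_transpose_sub_le (unfold k (θ.common t)) (unfold k (θ₀.common t))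
    rw [← unfold_sub, matrixNorm_unfold, matrixNorm_unfold, matrixNorm_unfold,
      tensorNorm_common hp h, tensorNorm_common hp h₀, ← mul_add] at h1
    have h2 : tensorNorm (θ.factor t) + tensorNorm (θ₀.factor t) ≤ 2 * B := by
      linarith [hB _ (h.2.2.1 t), hB _ (h₀.2.2.1 t)]
    calc _ ≤ (size p : ℝ)⁻¹ * (tensorNorm (θ.common t - θ₀.common t) *
          (√(size p) * (2 * B))) := by
          refine mul_le_mul_of_nonneg_left (h1.trans ?_) (by positivity)
          have := tensorNorm_nonneg (θ.common t - θ₀.common t)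
          gcongr
      _ = 2 * B * (tensorNorm (θ.common t - θ₀.common t) * (√(size p) / size p)) := by ring
      _ = _ := by rw [Real.sqrt_div_self', mul_one_div]
  calc _ ≤ (T : ℝ)⁻¹ * ∑ t, 2 * B * (tensorNorm (θ.common t - θ₀.common t) / √(size p)) :=
        mul_le_mul_of_nonneg_left ((matrixNorm_sum_le _ _).trans
          (Finset.sum_le_sum fun t _ => key t)) hT
    _ = 2 * B * ((T : ℝ)⁻¹ * ∑ t, tensorNorm (θ.common t - θ₀.common t) / √(size p)) := by
        rw [← Finset.mul_sum]; ring
    _ ≤ _ := mul_le_mul_of_nonneg_left (avg_le_sqrt_avg_sq _) (by positivity)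

/-- The cosine of the angle between the `i`-th columns of the two mode-`k` loading matrices. -/
noncomputable def loadingCos (θ₀ θ : Param p r T) (k : Fin K) (i : Fin (r k)) : ℝ :=
  (p k : ℝ)⁻¹ * ((θ₀.loading k).transpose * θ.loading k) i i

theorem signAlign_eq (θ₀ θ : Param p r T) (k : Fin K) :
    signAlign θ₀ θ k = Matrix.diagonal fun i => Real.sign (loadingCos θ₀ θ k i) := rfl

theorem sum_loading_sq (hp : ∀ k, 0 < p k) (h : θ ∈ paramSpace p r T 𝒜 𝓕) (k : Fin K)
    (i : Fin (r k)) : ∑ a, θ.loading k a i ^ 2 = p k := by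
  have h1 := congrFun (congrFun (transpose_mul_self_of_mem hp h k) i) i
  simp only [Matrix.mul_apply, Matrix.transpose_apply, Matrix.smul_apply, Matrix.one_apply_eq,
    smul_eq_mul, mul_one] at h1
  rw [← h1]
  exact Finset.sum_congr rfl fun _ _ => sq _

theorem sign_mul_self_eq_abs (x : ℝ) : Real.sign x * x = |x| := by
  rcases lt_trichotomy x 0 with h | h | h
  · rw [Real.sign_of_neg h, abs_of_neg h]; ring
  · simp [h]
  · rw [Real.sign_of_pos h, abs_of_pos h]; ring

theorem sign_sq_le_one (x : ℝ) : Real.sign x ^ 2 ≤ 1 := by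
  rcases Real.sign_apply_eq x with h | h | h <;> simp [h]

/-- Up to the signs, the error of the loadings is a function of the cosines. Where the cosine
vanishes the sign is zero too. -/
theorem loadingError_eq (hp : ∀ k, 0 < p k) (h₀ : θ₀ ∈ paramSpace p r T 𝒜 𝓕)
    (h : θ ∈ paramSpace p r T 𝒜 𝓕) (k : Fin K) :
    loadingError θ₀ θ k =
      ∑ i, (1 + Real.sign (loadingCos θ₀ θ k i) ^ 2 - 2 * |loadingCos θ₀ θ k i|) := by
  have hk : (p k : ℝ) ≠ 0 := by exact_mod_cast (hp k).ne'
  rw [loadingError, matrixNorm_sq, Finset.sum_comm, Finset.mul_sum]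
  refine Finset.sum_congr rfl fun i _ => ?_
  set s := Real.sign (loadingCos θ₀ θ k i) with hs
  have h1 : ∀ a, (θ.loading k - θ₀.loading k * signAlign θ₀ θ k) a i ^ 2 =
      θ.loading k a i ^ 2 + s ^ 2 * θ₀.loading k a i ^ 2 -
        2 * s * (θ₀.loading k a i * θ.loading k a i) := by
    intro a
    rw [signAlign_eq, Matrix.sub_apply, Matrix.mul_diagonal]
    ring
  have h2 : ∑ a, θ₀.loading k a i * θ.loading k a i = p k * loadingCos θ₀ θ k i := by
    rw [loadingCos, mul_inv_cancel_left₀ hk]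
    rfl
  rw [Finset.sum_congr rfl fun a _ => h1 a, Finset.sum_sub_distrib, Finset.sum_add_distrib,
    ← Finset.mul_sum, ← Finset.mul_sum, h2, sum_loading_sq hp h, sum_loading_sq hp h₀,
    ← sign_mul_self_eq_abs, ← hs]
  field_simp

theorem loadingError_nonneg (θ₀ θ : Param p r T) (k : Fin K) : 0 ≤ loadingError θ₀ θ k := by
  unfold loadingError
  positivity

theorem loadingError_le (hp : ∀ k, 0 < p k) (h₀ : θ₀ ∈ paramSpace p r T 𝒜 𝓕)
    (h : θ ∈ paramSpace p r T 𝒜 𝓕) (k : Fin K) : loadingError θ₀ θ k ≤ 2 * r k := by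
  rw [loadingError_eq hp h₀ h]
  refine (Finset.sum_le_card_nsmul _ _ 2 fun i _ => ?_).trans_eq ?_
  · linarith [sign_sq_le_one (loadingCos θ₀ θ k i), abs_nonneg (loadingCos θ₀ θ k i)]
  · simp [mul_comm]

theorem abs_loadingCos_le_one (hp : ∀ k, 0 < p k) (h₀ : θ₀ ∈ paramSpace p r T 𝒜 𝓕)
    (h : θ ∈ paramSpace p r T 𝒜 𝓕) (k : Fin K) (i : Fin (r k)) : |loadingCos θ₀ θ k i| ≤ 1 := by
  have hk : (0 : ℝ) < p k := by exact_mod_cast hp k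
  have h1 := abs_dotProduct_le (fun a => θ₀.loading k a i) fun a => θ.loading k a i
  rw [sum_loading_sq hp h, sum_loading_sq hp h₀, Real.mul_self_sqrt hk.le] at h1
  have h2 : |((θ₀.loading k).transpose * θ.loading k) i i| ≤ p k := h1
  rw [loadingCos, abs_mul, abs_of_pos (inv_pos.2 hk)]
  exact inv_mul_le_one_of_le₀ h2 hk.le

/-- If the common components are close, then so are, up to signs, the loadings: they are the
eigenvectors of the mode-`k` second moment matrices of the common components. -/
theorem loadingError_le_commonDist {B g : ℝ} (hp : ∀ k, 0 < p k)
    (hB : ∀ F ∈ 𝓕, tensorNorm F ≤ B) (hB0 : 0 ≤ B) (hg : 0 < g)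
    (h₀ : θ₀ ∈ paramSpace p r T 𝒜 𝓕) (h : θ ∈ paramSpace p r T 𝒜 𝓕) (k : Fin K)
    (hpos : ∀ i, g ≤ factorGram θ₀.factor k i i)
    (hgap : ∀ i j, i < j → g ≤ factorGram θ₀.factor k i i - factorGram θ₀.factor k j j)
    (hD : 32 * (r k + 1) * r k * B ^ 2 * commonDist θ₀ θ ≤ g ^ 2 / (4 * (r k + 1))) :
    (∀ i, loadingCos θ₀ θ k i ≠ 0) ∧
      loadingError θ₀ θ k ≤ 2 * r k * ((4 * r k + 1) / g ^ 2 * (r k * (4 * B ^ 2)))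
        * commonDist θ₀ θ := by
  have hk : (0 : ℝ) < p k := by exact_mod_cast hp k
  have hsk : (√(p k : ℝ))⁻¹ * (√(p k : ℝ))⁻¹ = (p k : ℝ)⁻¹ := by
    rw [← mul_inv, Real.mul_self_sqrt hk.le]
  obtain ⟨σ, -, hσ, hσG⟩ := h.2.2.2 k
  obtain ⟨σ₀, -, -, hσG₀⟩ := h₀.2.2.2 k
  have hN := matrixNorm_gram_sub_le hp hB h₀ h k hB0
  set U := (√(p k : ℝ))⁻¹ • θ.loading k with hUd
  set U₀ := (√(p k : ℝ))⁻¹ • θ₀.loading k with hU₀d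
  have hcos : ∀ i, (U₀.transpose * U) i i = loadingCos θ₀ θ k i := by
    intro i
    simp only [hUd, hU₀d, Matrix.transpose_smul, Matrix.smul_mul, Matrix.mul_smul, smul_smul, hsk]
    rfl
  have hU : U.transpose * U = 1 := by
    simp only [hUd, Matrix.transpose_smul, Matrix.smul_mul, Matrix.mul_smul, smul_smul, hsk]
    exact h.2.1 k
  have hU₀ : U₀.transpose * U₀ = 1 := by
    simp only [hU₀d, Matrix.transpose_smul, Matrix.smul_mul, Matrix.mul_smul, smul_smul, hsk]
    exact h₀.2.1 k
  have hε : matrixNorm (U * Matrix.diagonal σ * U.transpose -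
      U₀ * Matrix.diagonal σ₀ * U₀.transpose) ≤ 2 * B * √(commonDist θ₀ θ) := by
    convert hN using 2
    simp only [hUd, hU₀d, Matrix.transpose_smul, Matrix.smul_mul, Matrix.mul_smul, smul_smul, hsk,
      hσG, hσG₀]
  have hsq : (2 * B * √(commonDist θ₀ θ)) ^ 2 = 4 * B ^ 2 * commonDist θ₀ θ := by
    rw [mul_pow, Real.sq_sqrt (commonDist_nonneg _ _)]
    ring
  simp only [hσG₀, Matrix.diagonal_apply_eq] at hpos hgap
  have hr : (0 : ℝ) ≤ r k := by positivity
  have hD0 := commonDist_nonneg θ₀ θ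
  have hg2 : 0 < g ^ 2 := by positivity
  have hle : g ^ 2 / (4 * (r k + 1)) ≤ g ^ 2 := div_le_self hg2.le (by linarith)
  have key : ∀ i, 1 - loadingCos θ₀ θ k i ^ 2 ≤
      (4 * r k + 1) / g ^ 2 * (r k * (4 * B ^ 2 * commonDist θ₀ θ)) := by
    intro i
    rw [← hcos, ← hsq]
    refine one_sub_sq_le_of_matrixNorm_sub_le hU hU₀ hσ hg hpos hgap hε ?_ i
    rw [hsq]
    linarith
  have hne : ∀ i, loadingCos θ₀ θ k i ≠ 0 := by
    intro i hi
    have h1 := key i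
    rw [hi, div_mul_eq_mul_div, le_div_iff₀ hg2] at h1
    rw [le_div_iff₀ (by linarith)] at hD
    have h2 : 0 ≤ r k * B ^ 2 * commonDist θ₀ θ := by positivity
    nlinarith [mul_nonneg hr h2, mul_nonneg hr (mul_nonneg hr h2)]
  refine ⟨hne, ?_⟩
  rw [loadingError_eq hp h₀ h]
  refine (Finset.sum_le_card_nsmul _ _ (2 * ((4 * r k + 1) / g ^ 2 *
    (r k * (4 * B ^ 2 * commonDist θ₀ θ)))) fun i _ => ?_).trans_eq ?_
  · have h1 := abs_loadingCos_le_one hp h₀ h k i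
    have h2 := sign_sq_le_one (loadingCos θ₀ θ k i)
    have h3 := key i
    rw [← sq_abs] at h3
    nlinarith [abs_nonneg (loadingCos θ₀ θ k i)]
  · simp
    ring

end Identification

/-! ### Expansion of the common component around the sign-aligned true parameter -/

section Expansion

variable {K : ℕ} {p r : Fin K → ℕ} {T : ℕ} {𝒜 : ∀ k, Set (Fin (r k) → ℝ)} {𝓕 : Set (Tensor r)}
  {θ₀ θ : Param p r T}

/-- A sum over subsets, split into the subsets with none, one, and at least two elements. -/
theorem sum_finset_eq {α M : Type*} [Fintype α] [DecidableEq α] [AddCommMonoid M]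
    (f : Finset α → M) :
    ∑ s, f s = f ∅ + ∑ k, f {k} + ∑ s with 2 ≤ s.card, f s := by
  have h : (Finset.univ.filter fun s : Finset α => ¬ 2 ≤ s.card) =
      insert ∅ (Finset.univ.map ⟨singleton, Finset.singleton_injective⟩) := by
    ext s
    simp only [Finset.mem_filter, Finset.mem_univ, true_and, Finset.mem_insert, Finset.mem_map,
      Function.Embedding.coeFn_mk]
    constructor
    · intro hs
      rcases Finset.eq_empty_or_nonempty s with h | h
      · exact Or.inl h
      · obtain ⟨a, ha⟩ := Finset.card_eq_one.1
          (le_antisymm (by omega) (Finset.card_pos.2 h) : s.card = 1)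
        exact Or.inr ⟨a, ha.symm⟩
    · rintro (rfl | ⟨a, rfl⟩) <;> simp
  rw [← Finset.sum_filter_not_add_sum_filter Finset.univ (fun s : Finset α => 2 ≤ s.card), h,
    Finset.sum_insert (by simp), Finset.sum_map]
  rfl

/-- One small factor makes a product of norms small. -/
theorem prod_le_of_one_small {c q : Fin K → ℝ} {δ : ℝ} (hδ : 0 ≤ δ) (hc : ∀ k, 0 ≤ c k)
    (hcq : ∀ k, c k ≤ 2 * q k) (k : Fin K) (hk : c k ≤ δ * q k) :
    ∏ l, c l ≤ 2 ^ K * δ * ∏ l, q l := by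
  have hq : ∀ l, 0 ≤ q l := fun l => by linarith [hc l, hcq l]
  rw [← Finset.mul_prod_erase _ _ (Finset.mem_univ k),
    ← Finset.mul_prod_erase _ q (Finset.mem_univ k)]
  have h1 : ∏ l ∈ Finset.univ.erase k, c l ≤ 2 ^ K * ∏ l ∈ Finset.univ.erase k, q l := by
    refine (Finset.prod_le_prod (fun l _ => hc l) fun l _ => hcq l).trans ?_
    rw [Finset.prod_mul_distrib, Finset.prod_const]
    refine mul_le_mul_of_nonneg_right (pow_le_pow_right₀ one_le_two ?_)
      (Finset.prod_nonneg fun l _ => hq l)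
    exact (Finset.card_le_univ _).trans_eq (Fintype.card_fin K)
  calc _ ≤ (δ * q k) * (2 ^ K * ∏ l ∈ Finset.univ.erase k, q l) :=
        mul_le_mul hk h1 (Finset.prod_nonneg fun l _ => hc l) (mul_nonneg hδ (hq k))
    _ = _ := by ring

/-- Two small factors make a product of norms small to second order. -/
theorem prod_le_of_two_small {c q : Fin K → ℝ} {δ : ℝ} (hδ : 0 ≤ δ) (hc : ∀ k, 0 ≤ c k)
    (hcq : ∀ k, c k ≤ 2 * q k) (k k' : Fin K) (hkk : k ≠ k') (hk : c k ≤ δ * q k)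
    (hk' : c k' ≤ δ * q k') :
    ∏ l, c l ≤ 2 ^ K * δ ^ 2 * ∏ l, q l := by
  have hq : ∀ l, 0 ≤ q l := fun l => by linarith [hc l, hcq l]
  have hm : k' ∈ Finset.univ.erase k := by simp [hkk.symm]
  rw [← Finset.mul_prod_erase _ _ (Finset.mem_univ k),
    ← Finset.mul_prod_erase _ q (Finset.mem_univ k), ← Finset.mul_prod_erase _ _ hm,
    ← Finset.mul_prod_erase _ q hm]
  set S := (Finset.univ.erase k).erase k'
  have h1 : ∏ l ∈ S, c l ≤ 2 ^ K * ∏ l ∈ S, q l := by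
    refine (Finset.prod_le_prod (fun l _ => hc l) fun l _ => hcq l).trans ?_
    rw [Finset.prod_mul_distrib, Finset.prod_const]
    refine mul_le_mul_of_nonneg_right (pow_le_pow_right₀ one_le_two ?_)
      (Finset.prod_nonneg fun l _ => hq l)
    exact (Finset.card_le_univ _).trans_eq (Fintype.card_fin K)
  calc _ ≤ (δ * q k) * ((δ * q k') * (2 ^ K * ∏ l ∈ S, q l)) := by
        refine mul_le_mul hk (mul_le_mul hk' h1 (Finset.prod_nonneg fun l _ => hc l)
          (mul_nonneg hδ (hq k'))) (mul_nonneg (hc _) (Finset.prod_nonneg fun l _ => hc l))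
          (mul_nonneg hδ (hq k))
    _ = _ := by ring

theorem prod_sqrt_eq_sqrt_size (p : Fin K → ℕ) : ∏ k, √(p k : ℝ) = √(size p : ℝ) := by
  rw [← Real.sqrt_prod _ fun k _ => by positivity, size]
  simp

/-- Hypotheses of a perturbation `a + d` of the factors of a rank-one tensor: `‖a_k‖ ≤ √p_k`,
`‖d_k‖ ≤ 2 √p_k` and `‖d_k‖ ≤ δ √p_k`. -/
structure SmallPerturbation (a d : ∀ k, Fin (p k) → ℝ) (δ : ℝ) : Prop where
  nonneg : 0 ≤ δ
  norm_le : ∀ k, √(∑ i, a k i ^ 2) ≤ √(p k : ℝ)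
  norm_le_two : ∀ k, √(∑ i, d k i ^ 2) ≤ 2 * √(p k : ℝ)
  norm_le_delta : ∀ k, √(∑ i, d k i ^ 2) ≤ δ * √(p k : ℝ)

namespace SmallPerturbation

variable {a d : ∀ k, Fin (p k) → ℝ} {δ : ℝ}

theorem norm_piecewise_le_two (h : SmallPerturbation a d δ) (s : Finset (Fin K)) (k : Fin K) :
    √(∑ i, s.piecewise d a k i ^ 2) ≤ 2 * √(p k : ℝ) := by
  by_cases hk : k ∈ s
  · simpa [hk] using h.norm_le_two k
  · simp only [hk, not_false_eq_true, Finset.piecewise_eq_of_notMem]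
    linarith [h.norm_le k, Real.sqrt_nonneg (p k : ℝ)]

theorem prod_norm_piecewise_le (h : SmallPerturbation a d δ) {s : Finset (Fin K)}
    (hs : s.Nonempty) :
    ∏ k, √(∑ i, s.piecewise d a k i ^ 2) ≤ 2 ^ K * δ * √(size p : ℝ) := by
  obtain ⟨k, hk⟩ := hs
  rw [← prod_sqrt_eq_sqrt_size]
  refine prod_le_of_one_small h.nonneg (fun _ => Real.sqrt_nonneg _)
    (h.norm_piecewise_le_two s) k ?_
  simpa [hk] using h.norm_le_delta k

theorem prod_norm_piecewise_le_sq (h : SmallPerturbation a d δ) {s : Finset (Fin K)}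
    (hs : 2 ≤ s.card) :
    ∏ k, √(∑ i, s.piecewise d a k i ^ 2) ≤ 2 ^ K * δ ^ 2 * √(size p : ℝ) := by
  obtain ⟨k, hk, k', hk', hne⟩ := Finset.one_lt_card.1 hs
  rw [← prod_sqrt_eq_sqrt_size]
  refine prod_le_of_two_small h.nonneg (fun _ => Real.sqrt_nonneg _) (h.norm_piecewise_le_two s)
    k k' hne ?_ ?_
  · simpa [hk] using h.norm_le_delta k
  · simpa [hk'] using h.norm_le_delta k'

theorem rankOne_add_sub (a d : ∀ k, Fin (p k) → ℝ) :
    rankOne (a + d) - rankOne a =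
      ∑ s ∈ Finset.univ.erase (∅ : Finset (Fin K)), rankOne (s.piecewise d a) := by
  rw [add_comm a d, rankOne_add, ← Finset.add_sum_erase _ _ (Finset.mem_univ ∅),
    Finset.piecewise_empty, add_sub_cancel_left]

theorem card_erase_le : ((Finset.univ.erase (∅ : Finset (Fin K))).card : ℝ) ≤ 2 ^ K := by
  have h := Finset.card_le_univ (Finset.univ.erase (∅ : Finset (Fin K)))
  rw [Fintype.card_finset, Fintype.card_fin] at h
  exact_mod_cast h

theorem tensorNorm_rankOne_sub_le (h : SmallPerturbation a d δ) :
    tensorNorm (rankOne (a + d) - rankOne a) ≤ 4 ^ K * δ * √(size p : ℝ) := by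
  rw [rankOne_add_sub]
  refine (tensorNorm_sum_le _ _).trans ((Finset.sum_le_card_nsmul _ _
    (2 ^ K * δ * √(size p : ℝ)) fun s hs => ?_).trans ?_)
  · rw [tensorNorm_rankOne]
    exact h.prod_norm_piecewise_le (Finset.nonempty_iff_ne_empty.2 (Finset.ne_of_mem_erase hs))
  · have h0 := h.nonneg
    rw [nsmul_eq_mul]
    calc _ ≤ (2 : ℝ) ^ K * (2 ^ K * δ * √(size p : ℝ)) :=
          mul_le_mul_of_nonneg_right card_erase_le (by positivity)
      _ = (2 * 2) ^ K * δ * √(size p : ℝ) := by rw [mul_pow]; ring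
      _ = _ := by norm_num

theorem abs_dotProduct_rankOne_le (k₀ : Fin K) (x : Tensor p) (b : ∀ k, Fin (p k) → ℝ) :
    |x ⬝ᵥ rankOne b| ≤ √(matrixNorm (unfold k₀ x * (unfold k₀ x).transpose)) *
      ∏ k, √(∑ i, b k i ^ 2) := by
  rw [← Real.sqrt_prod _ fun k _ => Finset.sum_nonneg fun _ _ => sq_nonneg _,
    ← Real.sqrt_mul (matrixNorm_nonneg _)]
  exact Real.abs_le_sqrt (dotProduct_rankOne_sq_le k₀ x b)

theorem abs_dotProduct_rankOne_sub_le (h : SmallPerturbation a d δ) (k₀ : Fin K) (x : Tensor p) :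
    |x ⬝ᵥ rankOne (a + d) - x ⬝ᵥ rankOne a| ≤
      4 ^ K * δ * (√(matrixNorm (unfold k₀ x * (unfold k₀ x).transpose)) * √(size p : ℝ)) := by
  set H := √(matrixNorm (unfold k₀ x * (unfold k₀ x).transpose))
  have hH : 0 ≤ H := Real.sqrt_nonneg _
  rw [← dotProduct_sub, rankOne_add_sub, dotProduct_sum]
  refine (Finset.abs_sum_le_sum_abs _ _).trans ((Finset.sum_le_card_nsmul _ _
    (H * (2 ^ K * δ * √(size p : ℝ))) fun s hs => ?_).trans ?_)
  · exact (abs_dotProduct_rankOne_le k₀ x _).trans (mul_le_mul_of_nonneg_left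
      (h.prod_norm_piecewise_le (Finset.nonempty_iff_ne_empty.2 (Finset.ne_of_mem_erase hs))) hH)
  · have h0 := h.nonneg
    rw [nsmul_eq_mul]
    calc _ ≤ (2 : ℝ) ^ K * (H * (2 ^ K * δ * √(size p : ℝ))) :=
          mul_le_mul_of_nonneg_right card_erase_le (by positivity)
      _ = (2 * 2) ^ K * δ * (H * √(size p : ℝ)) := by rw [mul_pow]; ring
      _ = _ := by norm_num

/-- The terms of the multilinear expansion of degree at least two are controlled by a bound for
rank-one forms. -/
theorem abs_dotProduct_rankOne_sub_sub_le (h : SmallPerturbation a d δ) (k₀ : Fin K)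
    (x : Tensor p) :
    |x ⬝ᵥ rankOne (a + d) - x ⬝ᵥ rankOne a - ∑ k, x ⬝ᵥ rankOne (Function.update a k (d k))| ≤
      4 ^ K * δ ^ 2 *
        (√(matrixNorm (unfold k₀ x * (unfold k₀ x).transpose)) * √(size p : ℝ)) := by
  set H := √(matrixNorm (unfold k₀ x * (unfold k₀ x).transpose))
  have hH : 0 ≤ H := Real.sqrt_nonneg _
  have e : x ⬝ᵥ rankOne (a + d) - x ⬝ᵥ rankOne a -
      ∑ k, x ⬝ᵥ rankOne (Function.update a k (d k)) =
      ∑ s with 2 ≤ Finset.card s, x ⬝ᵥ rankOne (s.piecewise d a) := by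
    rw [add_comm a d, rankOne_add, dotProduct_sum, sum_finset_eq]
    simp only [Finset.piecewise_empty, Finset.piecewise_singleton]
    ring
  rw [e]
  refine (Finset.abs_sum_le_sum_abs _ _).trans ((Finset.sum_le_card_nsmul _ _
    (H * (2 ^ K * δ ^ 2 * √(size p : ℝ))) fun s hs => ?_).trans ?_)
  · exact (abs_dotProduct_rankOne_le k₀ x _).trans (mul_le_mul_of_nonneg_left
      (h.prod_norm_piecewise_le_sq (Finset.mem_filter.1 hs).2) hH)
  · have h0 := h.nonneg
    have hc : ((Finset.univ.filter fun s : Finset (Fin K) => 2 ≤ s.card).card : ℝ) ≤ 2 ^ K := by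
      have h := Finset.card_le_univ (Finset.univ.filter fun s : Finset (Fin K) => 2 ≤ s.card)
      rw [Fintype.card_finset, Fintype.card_fin] at h
      exact_mod_cast h
    rw [nsmul_eq_mul]
    calc _ ≤ (2 : ℝ) ^ K * (H * (2 ^ K * δ ^ 2 * √(size p : ℝ))) :=
          mul_le_mul_of_nonneg_right hc (by positivity)
      _ = (2 * 2) ^ K * δ ^ 2 * (H * √(size p : ℝ)) := by rw [mul_pow]; ring
      _ = _ := by norm_num

end SmallPerturbation

theorem rankOne_smul (s : Fin K → ℝ) (a : ∀ k, Fin (p k) → ℝ) :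
    rankOne (fun k => s k • a k) = (∏ k, s k) • rankOne a := by
  ext i
  simp [rankOne, Finset.prod_mul_distrib]

/-- The sign by which the `i`-th column of the mode-`k` loading matrix is multiplied. -/
noncomputable def alignSign (θ₀ θ : Param p r T) (k : Fin K) (i : Fin (r k)) : ℝ :=
  Real.sign (loadingCos θ₀ θ k i)

/-- The true parameter with the signs of the columns aligned with those of `θ`. -/
noncomputable def aligned (θ₀ θ : Param p r T) : Param p r T where
  loading k := θ₀.loading k * signAlign θ₀ θ k
  factor t := multiModeProd (θ₀.factor t) (signAlign θ₀ θ)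

theorem aligned_factor_apply (θ₀ θ : Param p r T) (t : Fin T) (j : ∀ k, Fin (r k)) :
    (aligned θ₀ θ).factor t j = θ₀.factor t j * ∏ k, alignSign θ₀ θ k (j k) := by
  simp only [aligned, multiModeProd]
  rw [Finset.sum_eq_single j]
  · simp [signAlign_eq, alignSign]
  · intro j' _ hj
    obtain ⟨k, hk⟩ := Function.ne_iff.1 hj
    rw [Finset.prod_eq_zero (Finset.mem_univ k), mul_zero]
    rw [signAlign_eq, Matrix.diagonal_apply_ne' _ hk]
  · simp

theorem aligned_loading_apply (θ₀ θ : Param p r T) (k : Fin K) (a : Fin (p k)) (i : Fin (r k)) :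
    (aligned θ₀ θ).loading k a i = θ₀.loading k a i * alignSign θ₀ θ k i := by
  simp only [aligned, signAlign_eq, Matrix.mul_diagonal, alignSign]

theorem cols_aligned (θ₀ θ : Param p r T) (j : ∀ k, Fin (r k)) :
    cols (aligned θ₀ θ).loading j = fun k => alignSign θ₀ θ k (j k) • cols θ₀.loading j k := by
  ext k a
  simp [cols, aligned_loading_apply, mul_comm]

theorem alignSign_sq (h : ∀ k i, loadingCos θ₀ θ k i ≠ 0) (k : Fin K) (i : Fin (r k)) :
    alignSign θ₀ θ k i ^ 2 = 1 := by
  rcases Real.sign_apply_eq_of_ne_zero _ (h k i) with h | h <;> simp [alignSign, h]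

theorem prod_alignSign_mul_self (h : ∀ k i, loadingCos θ₀ θ k i ≠ 0) (j : ∀ k, Fin (r k)) :
    (∏ k, alignSign θ₀ θ k (j k)) * ∏ k, alignSign θ₀ θ k (j k) = 1 := by
  rw [← Finset.prod_mul_distrib]
  exact Finset.prod_eq_one fun k _ => by rw [← sq, alignSign_sq h]

/-- The signs of the loadings and of the factors cancel. -/
theorem aligned_common (h : ∀ k i, loadingCos θ₀ θ k i ≠ 0) (t : Fin T) :
    (aligned θ₀ θ).common t = θ₀.common t := by
  rw [Param.common, Param.common, multiModeProd_eq_sum, multiModeProd_eq_sum]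
  refine Finset.sum_congr rfl fun j _ => ?_
  rw [aligned_factor_apply, cols_aligned, rankOne_smul, smul_smul, mul_assoc,
    prod_alignSign_mul_self h, mul_one]

theorem tensorNorm_aligned_factor_le (θ₀ θ : Param p r T) (t : Fin T) :
    tensorNorm ((aligned θ₀ θ).factor t) ≤ tensorNorm (θ₀.factor t) := by
  refine Real.sqrt_le_sqrt (Finset.sum_le_sum fun j _ => ?_)
  rw [aligned_factor_apply, mul_pow, ← Finset.prod_pow]
  refine mul_le_of_le_one_right (sq_nonneg _) (Finset.prod_le_one (fun _ _ => sq_nonneg _) ?_)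
  exact fun k _ => sign_sq_le_one _

theorem factorError_eq (θ₀ θ : Param p r T) :
    factorError θ₀ θ =
      (T : ℝ)⁻¹ * ∑ t, tensorNorm (θ.factor t - (aligned θ₀ θ).factor t) ^ 2 := rfl

/-- The total error `(∑ₖ ‖A_k - A_{0k} S_k‖_F² / p_k)^{1/2}` of the loadings. -/
noncomputable def totalLoadingError (θ₀ θ : Param p r T) : ℝ := √(∑ k, loadingError θ₀ θ k)

theorem loadingError_le_total_sq (θ₀ θ : Param p r T) (k : Fin K) :
    loadingError θ₀ θ k ≤ totalLoadingError θ₀ θ ^ 2 := by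
  rw [totalLoadingError, Real.sq_sqrt (Finset.sum_nonneg fun k _ => loadingError_nonneg _ _ k)]
  exact Finset.single_le_sum (fun k _ => loadingError_nonneg θ₀ θ k) (Finset.mem_univ k)

theorem smallPerturbation_cols (hp : ∀ k, 0 < p k) (h₀ : θ₀ ∈ paramSpace p r T 𝒜 𝓕)
    (h : θ ∈ paramSpace p r T 𝒜 𝓕) (j : ∀ k, Fin (r k)) :
    SmallPerturbation (cols (aligned θ₀ θ).loading j)
      (cols θ.loading j - cols (aligned θ₀ θ).loading j) (totalLoadingError θ₀ θ) := by
  have hk : ∀ k, (0 : ℝ) < p k := fun k => by exact_mod_cast hp k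
  have h1 : ∀ k, √(∑ i, cols (aligned θ₀ θ).loading j k i ^ 2) ≤ √(p k : ℝ) := by
    intro k
    rw [← sum_loading_sq hp h₀ k (j k)]
    refine Real.sqrt_le_sqrt (Finset.sum_le_sum fun a _ => ?_)
    rw [cols, aligned_loading_apply, mul_pow]
    exact mul_le_of_le_one_right (sq_nonneg _) (sign_sq_le_one _)
  refine ⟨Real.sqrt_nonneg _, h1, fun k => ?_, fun k => ?_⟩
  · have h2 : √(∑ i, cols θ.loading j k i ^ 2) = √(p k : ℝ) := by
      rw [← sum_loading_sq hp h k (j k)]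
      rfl
    have h3 := norm_sub_le (WithLp.toLp 2 (cols θ.loading j k))
      (WithLp.toLp 2 (cols (aligned θ₀ θ).loading j k))
    simp only [EuclideanSpace.norm_eq, Real.norm_eq_abs, sq_abs, PiLp.sub_apply] at h3
    rw [h2] at h3
    refine le_trans h3 ?_
    linarith [h1 k]
  · have hδ : 0 ≤ totalLoadingError θ₀ θ := Real.sqrt_nonneg _
    rw [← Real.sqrt_sq hδ, ← Real.sqrt_mul (sq_nonneg _)]
    refine Real.sqrt_le_sqrt ?_
    have h2 : ∑ i, (cols θ.loading j - cols (aligned θ₀ θ).loading j) k i ^ 2 ≤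
        matrixNorm (θ.loading k - θ₀.loading k * signAlign θ₀ θ k) ^ 2 := by
      rw [matrixNorm_sq]
      exact Finset.sum_le_sum fun a _ => Finset.single_le_sum
        (f := fun i => (θ.loading k - θ₀.loading k * signAlign θ₀ θ k) a i ^ 2)
        (fun _ _ => sq_nonneg _) (Finset.mem_univ (j k))
    have h3 := loadingError_le_total_sq θ₀ θ k
    rw [loadingError, inv_mul_le_iff₀ (hk k)] at h3
    linarith

theorem cols_eq_add (θ₀ θ : Param p r T) (j : ∀ k, Fin (r k)) :
    cols θ.loading j = cols (aligned θ₀ θ).loading j +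
      (cols θ.loading j - cols (aligned θ₀ θ).loading j) := by abel

/-- The factors are recovered from the common components and the loadings. -/
theorem factorError_le_commonDist {B : ℝ} (hp : ∀ k, 0 < p k)
    (hB : ∀ F ∈ 𝓕, tensorNorm F ≤ B) (h₀ : θ₀ ∈ paramSpace p r T 𝒜 𝓕)
    (h : θ ∈ paramSpace p r T 𝒜 𝓕) (hne : ∀ k i, loadingCos θ₀ θ k i ≠ 0) :
    factorError θ₀ θ ≤ 2 * commonDist θ₀ θ +
      2 * ((∏ k, r k) * B * 4 ^ K) ^ 2 * totalLoadingError θ₀ θ ^ 2 := by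
  have hs : (0 : ℝ) < √(size p) := Real.sqrt_pos.2 (by exact_mod_cast size_pos hp)
  set δ := totalLoadingError θ₀ θ
  have hδ : 0 ≤ δ := Real.sqrt_nonneg _
  have key : ∀ t, tensorNorm (θ.factor t - (aligned θ₀ θ).factor t) ≤
      tensorNorm (θ.common t - θ₀.common t) / √(size p) + (∏ k, r k) * B * 4 ^ K * δ := by
    intro t
    have hB0 : 0 ≤ B := (tensorNorm_nonneg _).trans (hB _ (h.2.2.1 t))
    set F₁ := (aligned θ₀ θ).factor t
    have h1 : multiModeProd (θ.factor t - F₁) θ.loading = (θ.common t - θ₀.common t) -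
        ∑ j, F₁ j • (rankOne (cols θ.loading j) - rankOne (cols (aligned θ₀ θ).loading j)) := by
      rw [← aligned_common hne t, multiModeProd_sub]
      simp only [smul_sub, Finset.sum_sub_distrib, ← multiModeProd_eq_sum]
      rw [Param.common, Param.common]
      abel
    have h2 : tensorNorm (∑ j, F₁ j • (rankOne (cols θ.loading j) -
        rankOne (cols (aligned θ₀ θ).loading j))) ≤
        (∏ k, r k) * B * 4 ^ K * δ * √(size p) := by
      refine (tensorNorm_sum_le _ _).trans ((Finset.sum_le_card_nsmul _ _
        (B * (4 ^ K * δ * √(size p))) fun j _ => ?_).trans_eq ?_)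
      · rw [tensorNorm_smul]
        refine mul_le_mul ?_ ?_ (tensorNorm_nonneg _) hB0
        · exact (abs_le_tensorNorm _ j).trans ((tensorNorm_aligned_factor_le θ₀ θ t).trans
            (hB _ (h₀.2.2.1 t)))
        · conv_lhs => rw [cols_eq_add θ₀ θ j]
          exact (smallPerturbation_cols hp h₀ h j).tensorNorm_rankOne_sub_le
      · rw [nsmul_eq_mul, Finset.card_univ, Fintype.card_pi]
        simp only [Fintype.card_fin]
        push_cast
        ring
    have h3 := tensorNorm_multiModeProd (transpose_mul_self_of_mem hp h) (θ.factor t - F₁)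
    rw [h1] at h3
    rw [← sub_le_iff_le_add, le_div_iff₀ hs]
    nlinarith [tensorNorm_sub_le (θ.common t - θ₀.common t) (∑ j, F₁ j •
      (rankOne (cols θ.loading j) - rankOne (cols (aligned θ₀ θ).loading j)))]
  have hsq : ∀ t, tensorNorm (θ.factor t - (aligned θ₀ θ).factor t) ^ 2 ≤
      2 * (tensorNorm (θ.common t - θ₀.common t) / √(size p)) ^ 2 +
        2 * ((∏ k, r k) * B * 4 ^ K * δ) ^ 2 := by
    intro t
    refine (pow_le_pow_left₀ (tensorNorm_nonneg _) (key t) 2).trans ?_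
    nlinarith [sq_nonneg (tensorNorm (θ.common t - θ₀.common t) / √(size p) -
      (∏ k, r k) * B * 4 ^ K * δ)]
  rw [factorError_eq, commonDist]
  refine (mul_le_mul_of_nonneg_left (Finset.sum_le_sum fun t _ => hsq t) (by positivity)).trans ?_
  rw [Finset.sum_add_distrib, ← Finset.mul_sum, mul_add, Finset.sum_const, Finset.card_univ,
    Fintype.card_fin, nsmul_eq_mul, ← mul_assoc (T : ℝ)⁻¹ T]
  have h4 : (T : ℝ)⁻¹ * T ≤ 1 := inv_mul_le_one
  have h5 := mul_le_mul_of_nonneg_right h4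
    (by positivity : 0 ≤ 2 * ((∏ k, r k) * B * 4 ^ K * δ) ^ 2)
  have h6 : ((∏ k, r k) * B * 4 ^ K * δ) ^ 2 = ((∏ k, r k) * B * 4 ^ K) ^ 2 * δ ^ 2 := by ring
  rw [h6] at h5 ⊢
  linarith

end Expansion

/-! ### The inequality of losses -/

section Deterministic

variable {K : ℕ} {p r : Fin K → ℕ} {T : ℕ} {𝒜 : ∀ k, Set (Fin (r k) → ℝ)} {𝓕 : Set (Tensor r)}
  {θ₀ θ : Param p r T}

/-- `‖M Mᵀ‖_F` for the mode-`k` unfolding `M` of `x`, an upper bound for the squared operator norm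
of `M`. -/
noncomputable def unfoldGramNorm (k : Fin K) (x : Tensor p) : ℝ :=
  matrixNorm (unfold k x * (unfold k x).transpose)

theorem unfoldGramNorm_nonneg (k : Fin K) (x : Tensor p) : 0 ≤ unfoldGramNorm k x :=
  matrixNorm_nonneg _

/-- The rank-one tensor `b₁ ⊗ ⋯ ⊗ e_a ⊗ ⋯ ⊗ b_K` with the `k`-th factor replaced by the `a`-th basis
vector. -/
noncomputable def probe (b : ∀ k, Fin (p k) → ℝ) (k : Fin K) (a : Fin (p k)) : Tensor p :=
  rankOne (Function.update b k (Pi.single a 1))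

/-- The functional `v ↦ ⟨x, b₁ ⊗ ⋯ ⊗ v ⊗ ⋯ ⊗ b_K⟩` in coordinates. -/
theorem dotProduct_rankOne_update (x : Tensor p) (b : ∀ k, Fin (p k) → ℝ) (k : Fin K)
    (v : Fin (p k) → ℝ) :
    x ⬝ᵥ rankOne (Function.update b k v) = ∑ a, v a * (x ⬝ᵥ probe b k a) := by
  have h : rankOne (Function.update b k v) = ∑ a, v a • probe b k a := by
    ext i
    have e : ∀ w : Fin (p k) → ℝ, rankOne (Function.update b k w) i =
        w (i k) * ∏ l ∈ Finset.univ.erase k, b l (i l) := by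
      intro w
      rw [rankOne, ← Finset.mul_prod_erase _ _ (Finset.mem_univ k), Function.update_self]
      congr 1
      exact Finset.prod_congr rfl fun l hl => by
        rw [Function.update_of_ne (Finset.ne_of_mem_erase hl)]
    rw [e, Finset.sum_apply]
    simp only [Pi.smul_apply, probe, e, smul_eq_mul]
    rw [Finset.sum_eq_single (i k)]
    · simp
    · intro a _ ha
      simp [ha.symm]
    · simp
  simp only [h, dotProduct_sum, dotProduct_smul, smul_eq_mul]

/-- The Huber weight of a residual tensor `x`, from its normalised norm `‖x‖_F / √p`. -/
noncomputable def residualWeight (τ : ℝ) (x : Tensor p) : ℝ :=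
  huberWeight τ (tensorNorm x / √(size p))

/-- Bounds on the realised noise `E` on which the rate of convergence rests; `ρ` is the squared
rate, `κ` is small and `M` is a constant. `m t ≤ s²` is the mean of `‖E_t‖²/p`, about which it
concentrates; `gram` bounds the noise uniformly over rank-one directions; the three scores are the
forms in the noise that multiply the errors of the factors and of the loadings to first order. -/
structure NoiseBounds (θ₀ : Param p r T) (E : Fin T → Tensor p) (k₀ : Fin K) (τ s κ M ρ : ℝ)
    (m : Fin T → ℝ) : Prop where
  mean_le : ∀ t, m t ≤ s ^ 2
  concentration : (T : ℝ)⁻¹ * ∑ t, (tensorNorm (E t) ^ 2 / size p - m t) ^ 2 ≤ M * ρ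
  gram : √((T : ℝ)⁻¹ * ∑ t, unfoldGramNorm k₀ (E t) / size p) ≤ κ
  score_factor : (T : ℝ)⁻¹ * ∑ t, ∑ j, (E t ⬝ᵥ rankOne (cols θ₀.loading j)) ^ 2 / size p ≤ M
  score_loading : ∀ k j, (T : ℝ)⁻¹ * ∑ t, ∑ a,
    (E t ⬝ᵥ probe (cols θ₀.loading j) k a) ^ 2 / size p ≤ M
  weighted_score : ∀ k j, ∑ a, ((T : ℝ)⁻¹ * ∑ t, residualWeight τ (E t) * θ₀.factor t j *
    (E t ⬝ᵥ probe (cols θ₀.loading j) k a)) ^ 2 * (p k / (size p : ℝ) ^ 2) ≤ M * ρ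

/-- The inequality of losses between the minimiser and the true parameter. -/
theorem sum_residualWeight_le {τ : ℝ} (hτ : 0 < τ) (hp : ∀ k, 0 < p k) {E X : Fin T → Tensor p}
    (hX : ∀ t, X t = θ₀.common t + E t) (h₀ : θ₀ ∈ paramSpace p r T 𝒜 𝓕)
    (h : IsHuberEstimator τ 𝒜 𝓕 X θ) :
    (T : ℝ)⁻¹ * ∑ t, residualWeight τ (X t - θ.common t) *
        (tensorNorm (θ.common t - θ₀.common t) / √(size p)) ^ 2 ≤
      2 * ((T : ℝ)⁻¹ * ∑ t, residualWeight τ (X t - θ.common t) *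
        (E t ⬝ᵥ (θ.common t - θ₀.common t) / size p)) := by
  have hs : (0 : ℝ) < size p := by exact_mod_cast size_pos hp
  have hmin : huberLoss τ X θ ≤ huberLoss τ X θ₀ := h.2 h₀
  have key : ∀ t, residualWeight τ (X t - θ.common t) / 2 *
      ((tensorNorm (θ.common t - θ₀.common t) / √(size p)) ^ 2 -
        2 * (E t ⬝ᵥ (θ.common t - θ₀.common t) / size p)) ≤
      huber τ (tensorNorm (X t - θ.common t) / √(size p)) -
        huber τ (tensorNorm (X t - θ₀.common t) / √(size p)) := by
    intro t
    have e1 : X t - θ₀.common t = E t := by rw [hX, add_sub_cancel_left]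
    have e2 : X t - θ.common t = E t + -(θ.common t - θ₀.common t) := by rw [hX]; abel
    have e3 : tensorNorm (-(θ.common t - θ₀.common t)) = tensorNorm (θ.common t - θ₀.common t) := by
      rw [← neg_one_smul ℝ, tensorNorm_smul]
      simp
    have h1 := huberWeight_mul_le_huber_sub hτ
      (x := tensorNorm (E t) / √(size p)) (y := tensorNorm (X t - θ.common t) / √(size p))
      (div_nonneg (tensorNorm_nonneg _) (Real.sqrt_nonneg _))
      (div_nonneg (tensorNorm_nonneg _) (Real.sqrt_nonneg _))
    rw [e1]
    refine le_trans (le_of_eq ?_) h1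
    rw [residualWeight]
    congr 1
    rw [div_pow, div_pow, div_pow, Real.sq_sqrt hs.le, e2, tensorNorm_sq_add, e3, dotProduct_neg]
    ring
  have hsum := Finset.sum_le_sum fun t (_ : t ∈ Finset.univ) => key t
  rw [Finset.sum_sub_distrib] at hsum
  have h2 := mul_le_mul_of_nonneg_left hsum (by positivity : (0 : ℝ) ≤ (T : ℝ)⁻¹)
  rw [mul_sub] at h2
  have h3 : (T : ℝ)⁻¹ * ∑ t, residualWeight τ (X t - θ.common t) / 2 *
      ((tensorNorm (θ.common t - θ₀.common t) / √(size p)) ^ 2 -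
        2 * (E t ⬝ᵥ (θ.common t - θ₀.common t) / size p)) ≤ 0 :=
    h2.trans (sub_nonpos.2 hmin)
  have e : ∀ t, residualWeight τ (X t - θ.common t) / 2 *
      ((tensorNorm (θ.common t - θ₀.common t) / √(size p)) ^ 2 -
        2 * (E t ⬝ᵥ (θ.common t - θ₀.common t) / size p)) =
      (1 / 2) * (residualWeight τ (X t - θ.common t) *
        (tensorNorm (θ.common t - θ₀.common t) / √(size p)) ^ 2) -
      residualWeight τ (X t - θ.common t) *
        (E t ⬝ᵥ (θ.common t - θ₀.common t) / size p) := fun t => by ring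
  rw [Finset.sum_congr rfl fun t _ => e t, Finset.sum_sub_distrib, ← Finset.mul_sum] at h3
  linarith

/-- A lower bound for the weight at the times `t` at which `‖E_t‖²/p ≤ s² + 1`, valid when the
factors have norm at most `B`: the residual then has normalised norm at most `√(s² + 1) + 2 B`. -/
noncomputable def minWeight (τ s B : ℝ) : ℝ := τ / (τ + (√(s ^ 2 + 1) + 2 * B))

theorem minWeight_pos {τ s B : ℝ} (hτ : 0 < τ) (hB : 0 ≤ B) : 0 < minWeight τ s B := by
  unfold minWeight
  positivity

/-- The weights are bounded below, except at times that are rare by concentration of `‖E_t‖²`. -/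
theorem minWeight_mul_commonDist_le {τ s B V : ℝ} (hτ : 0 < τ) (hB0 : 0 ≤ B)
    (hp : ∀ k, 0 < p k) (hB : ∀ F ∈ 𝓕, tensorNorm F ≤ B) {E X : Fin T → Tensor p}
    (hX : ∀ t, X t = θ₀.common t + E t) (h₀ : θ₀ ∈ paramSpace p r T 𝒜 𝓕)
    (h : θ ∈ paramSpace p r T 𝒜 𝓕) {m : Fin T → ℝ} (hm : ∀ t, m t ≤ s ^ 2)
    (hV : (T : ℝ)⁻¹ * ∑ t, (tensorNorm (E t) ^ 2 / size p - m t) ^ 2 ≤ V) :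
    minWeight τ s B * commonDist θ₀ θ ≤
      (T : ℝ)⁻¹ * ∑ t, residualWeight τ (X t - θ.common t) *
        (tensorNorm (θ.common t - θ₀.common t) / √(size p)) ^ 2 + 4 * B ^ 2 * V := by
  have hs : (0 : ℝ) < size p := by exact_mod_cast size_pos hp
  have key : ∀ t, minWeight τ s B * (tensorNorm (θ.common t - θ₀.common t) / √(size p)) ^ 2 ≤
      residualWeight τ (X t - θ.common t) *
        (tensorNorm (θ.common t - θ₀.common t) / √(size p)) ^ 2 +
      4 * B ^ 2 * (tensorNorm (E t) ^ 2 / size p - m t) ^ 2 := by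
    intro t
    set e := tensorNorm (θ.common t - θ₀.common t) / √(size p) with he
    have he0 : 0 ≤ e := div_nonneg (tensorNorm_nonneg _) (Real.sqrt_nonneg _)
    have he2 : e ≤ 2 * B := tensorNorm_common_sub_div_le hp hB h₀ h t
    set v := tensorNorm (E t) ^ 2 / size p with hv
    have hw0 : 0 < residualWeight τ (X t - θ.common t) := huberWeight_pos hτ _
    rcases le_or_gt v (s ^ 2 + 1) with hgood | hbad
    · have h1 : tensorNorm (X t - θ.common t) / √(size p) ≤ √(s ^ 2 + 1) + 2 * B := by
        have e2 : X t - θ.common t = E t - (θ.common t - θ₀.common t) := by rw [hX]; abel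
        have h2 : tensorNorm (E t) / √(size p) ≤ √(s ^ 2 + 1) := by
          refine Real.le_sqrt_of_sq_le ?_
          rwa [div_pow, Real.sq_sqrt hs.le]
        calc _ ≤ (tensorNorm (E t) + tensorNorm (θ.common t - θ₀.common t)) / √(size p) := by
              rw [e2]
              exact div_le_div_of_nonneg_right (tensorNorm_sub_le _ _) (Real.sqrt_nonneg _)
          _ = tensorNorm (E t) / √(size p) + e := add_div _ _ _
          _ ≤ _ := add_le_add h2 he2
      have h3 : minWeight τ s B ≤ residualWeight τ (X t - θ.common t) :=
        div_add_le_huberWeight hτ (by positivity) h1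
      have h4 := mul_le_mul_of_nonneg_right h3 (sq_nonneg e)
      have h5 : 0 ≤ 4 * B ^ 2 * (v - m t) ^ 2 := by positivity
      linarith
    · have h1 : 1 ≤ (v - m t) ^ 2 := by
        have : 1 ≤ v - m t := by linarith [hm t]
        nlinarith
      have h2 : minWeight τ s B ≤ 1 := by
        unfold minWeight
        refine (div_le_one (by positivity)).2 ?_
        have := Real.sqrt_nonneg (s ^ 2 + 1)
        linarith
      have h3 : e ^ 2 ≤ 4 * B ^ 2 := by nlinarith
      have h4 : 0 ≤ residualWeight τ (X t - θ.common t) * e ^ 2 := by positivity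
      have h5 := mul_le_mul_of_nonneg_right h2 (sq_nonneg e)
      nlinarith [mul_le_mul_of_nonneg_left h1 (by positivity : 0 ≤ 4 * B ^ 2)]
  have hT : (0 : ℝ) ≤ (T : ℝ)⁻¹ := by positivity
  have hsum := mul_le_mul_of_nonneg_left
    (Finset.sum_le_sum fun t (_ : t ∈ Finset.univ) => key t) hT
  rw [← Finset.mul_sum, Finset.sum_add_distrib, mul_add, ← Finset.mul_sum] at hsum
  rw [commonDist]
  have hV2 := mul_le_mul_of_nonneg_left hV (by positivity : 0 ≤ 4 * B ^ 2)
  linarith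

theorem card_factor_index (r : Fin K → ℕ) :
    (Fintype.card (∀ k, Fin (r k)) : ℝ) = ∏ k, (r k : ℝ) := by
  rw [Fintype.card_pi]
  simp

/-- A crude bound, uniform over the parameter space, which gives consistency. -/
theorem abs_dotProduct_common_sub_le {B : ℝ} (hp : ∀ k, 0 < p k) (hB0 : 0 ≤ B)
    (hB : ∀ F ∈ 𝓕, tensorNorm F ≤ B) (h₀ : θ₀ ∈ paramSpace p r T 𝒜 𝓕)
    (h : θ ∈ paramSpace p r T 𝒜 𝓕) (k₀ : Fin K) (t : Fin T) (x : Tensor p) :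
    |x ⬝ᵥ (θ.common t - θ₀.common t) / size p| ≤
      2 * (∏ k, r k) * B * √(unfoldGramNorm k₀ x / size p) := by
  have hs : (0 : ℝ) < size p := by exact_mod_cast size_pos hp
  have one : ∀ θ' : Param p r T, θ' ∈ paramSpace p r T 𝒜 𝓕 → |x ⬝ᵥ θ'.common t| ≤
      (∏ k, r k) * B * (√(unfoldGramNorm k₀ x) * √(size p)) := by
    intro θ' h'
    rw [Param.common, dotProduct_multiModeProd]
    refine (Finset.abs_sum_le_sum_abs _ _).trans ((Finset.sum_le_card_nsmul _ _
      (B * (√(unfoldGramNorm k₀ x) * √(size p))) fun j _ => ?_).trans_eq ?_)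
    · rw [abs_mul]
      refine mul_le_mul ((abs_le_tensorNorm _ j).trans (hB _ (h'.2.2.1 t))) ?_ (abs_nonneg _) hB0
      refine (SmallPerturbation.abs_dotProduct_rankOne_le k₀ x _).trans_eq ?_
      rw [← prod_sqrt_eq_sqrt_size, unfoldGramNorm]
      congr 1
      refine Finset.prod_congr rfl fun k _ => ?_
      rw [← sum_loading_sq hp h' k (j k)]
      rfl
    · rw [nsmul_eq_mul, Finset.card_univ, card_factor_index]
      push_cast
      ring
  rw [abs_div, abs_of_pos hs, div_le_iff₀ hs, dotProduct_sub, Real.sqrt_div' _ hs.le]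
  have h1 : √(unfoldGramNorm k₀ x) / √(size p) * size p =
      √(unfoldGramNorm k₀ x) * √(size p) := by
    nth_rw 2 [← Real.mul_self_sqrt hs.le]
    field_simp
  calc _ ≤ |x ⬝ᵥ θ.common t| + |x ⬝ᵥ θ₀.common t| := abs_sub _ _
    _ ≤ 2 * (∏ k, r k) * B * (√(unfoldGramNorm k₀ x) * √(size p)) := by
        linarith [one θ h, one θ₀ h₀]
    _ = _ := by rw [← h1]; ring

theorem avg_sqrt_gram_le (k₀ : Fin K) (E : Fin T → Tensor p) :
    (T : ℝ)⁻¹ * ∑ t, √(unfoldGramNorm k₀ (E t) / size p) ≤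
      √((T : ℝ)⁻¹ * ∑ t, unfoldGramNorm k₀ (E t) / size p) := by
  refine (avg_le_sqrt_avg_sq _).trans_eq ?_
  congr 2
  refine Finset.sum_congr rfl fun t _ => Real.sq_sqrt ?_
  exact div_nonneg (unfoldGramNorm_nonneg _ _) (by positivity)

end Deterministic

/-! ### The noise term in the inequality of losses -/

section NoiseTerm

variable {K : ℕ} {p r : Fin K → ℕ} {T : ℕ} {𝒜 : ∀ k, Set (Fin (r k) → ℝ)} {𝓕 : Set (Tensor r)}
  {θ₀ θ : Param p r T}

theorem abs_tensorNorm_sub_le (x y : Tensor p) :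
    |tensorNorm (x - y) - tensorNorm x| ≤ tensorNorm y := by
  simp only [tensorNorm_eq_norm]
  refine (abs_norm_sub_norm_le (WithLp.toLp 2 (x - y)) (WithLp.toLp 2 x)).trans_eq ?_
  rw [← WithLp.toLp_sub, ← norm_neg, ← WithLp.toLp_neg]
  congr 2
  abel

theorem abs_residualWeight_sub_le {τ : ℝ} (hτ : 0 < τ) (x y : Tensor p) :
    |residualWeight τ (x - y) - residualWeight τ x| ≤ tensorNorm y / √(size p) / τ := by
  refine (abs_huberWeight_sub_le hτ _ _).trans (div_le_div_of_nonneg_right ?_ hτ.le)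
  rw [← sub_div, abs_div, abs_of_nonneg (Real.sqrt_nonneg _)]
  exact div_le_div_of_nonneg_right (abs_tensorNorm_sub_le x y) (Real.sqrt_nonneg _)

/-- The signs cancel in the first-order terms, except for the one that multiplies the
perturbation. -/
theorem aligned_factor_mul_dotProduct (h : ∀ k i, loadingCos θ₀ θ k i ≠ 0) (t : Fin T)
    (j : ∀ k, Fin (r k)) (k : Fin K) (x : Tensor p) (d : Fin (p k) → ℝ) :
    (aligned θ₀ θ).factor t j *
      (x ⬝ᵥ rankOne (Function.update (cols (aligned θ₀ θ).loading j) k d)) =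
    θ₀.factor t j * ∑ a, (alignSign θ₀ θ k (j k) • d) a * (x ⬝ᵥ probe (cols θ₀.loading j) k a) := by
  have e : Function.update (cols (aligned θ₀ θ).loading j) k d =
      fun l => alignSign θ₀ θ l (j l) •
        Function.update (cols θ₀.loading j) k (alignSign θ₀ θ k (j k) • d) l := by
    funext l
    by_cases hl : l = k
    · subst hl
      rw [Function.update_self, Function.update_self, smul_smul, ← sq, alignSign_sq h, one_smul]
    · rw [Function.update_of_ne hl, Function.update_of_ne hl, cols_aligned]
  rw [e, rankOne_smul, dotProduct_smul, smul_eq_mul, aligned_factor_apply,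
    dotProduct_rankOne_update]
  have h1 := prod_alignSign_mul_self h j
  linear_combination (θ₀.factor t j * ∑ a, (alignSign θ₀ θ k (j k) • d) a *
    (x ⬝ᵥ probe (cols θ₀.loading j) k a)) * h1

/-- The terms that are linear in the error of the mode-`k` loadings. With the weights frozen at the
noise this is a score; the change of the weights costs a factor `‖C_t - C_{0t}‖/√p`. -/
theorem avg_linear_loading_le {τ s κ M ρ B : ℝ} (hτ : 0 < τ) (hB0 : 0 ≤ B) (hp : ∀ k, 0 < p k)
    (hB : ∀ F ∈ 𝓕, tensorNorm F ≤ B) {E : Fin T → Tensor p} (hκ0 : 0 ≤ κ)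
    (hκ : ∀ k, √(p k / size p) ≤ κ) (h₀ : θ₀ ∈ paramSpace p r T 𝒜 𝓕)
    (h : θ ∈ paramSpace p r T 𝒜 𝓕)
    (hne : ∀ k i, loadingCos θ₀ θ k i ≠ 0) {k₀ : Fin K} {m : Fin T → ℝ}
    (hN : NoiseBounds θ₀ E k₀ τ s κ M ρ m) (j : ∀ k, Fin (r k)) (k : Fin K) {v : Fin T → ℝ}
    (hv : ∀ t, |v t - residualWeight τ (E t)| ≤
      tensorNorm (θ.common t - θ₀.common t) / √(size p) / τ) :
    (T : ℝ)⁻¹ * ∑ t, v t * ((aligned θ₀ θ).factor t j *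
      (E t ⬝ᵥ rankOne (Function.update (cols (aligned θ₀ θ).loading j) k
        ((cols θ.loading j - cols (aligned θ₀ θ).loading j) k))) / size p) ≤
    totalLoadingError θ₀ θ * (√(M * ρ) + B / τ * κ * √M * √(commonDist θ₀ θ)) := by
  have hs : (0 : ℝ) < size p := by exact_mod_cast size_pos hp
  have hT : (0 : ℝ) ≤ (T : ℝ)⁻¹ := by positivity
  set δ := totalLoadingError θ₀ θ with hδ
  have hδ0 : 0 ≤ δ := Real.sqrt_nonneg _
  set d := alignSign θ₀ θ k (j k) • (cols θ.loading j - cols (aligned θ₀ θ).loading j) k with hd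
  set Q : Fin T → Fin (p k) → ℝ := fun t a => E t ⬝ᵥ probe (cols θ₀.loading j) k a with hQ
  have hdn : √(∑ a, d a ^ 2) ≤ δ * √(p k : ℝ) := by
    refine le_trans (le_of_eq ?_) ((smallPerturbation_cols hp h₀ h j).norm_le_delta k)
    congr 1
    refine Finset.sum_congr rfl fun a _ => ?_
    rw [hd, Pi.smul_apply, smul_eq_mul, mul_pow, alignSign_sq hne, one_mul]
  have e1 : ∀ t, v t * ((aligned θ₀ θ).factor t j *
      (E t ⬝ᵥ rankOne (Function.update (cols (aligned θ₀ θ).loading j) k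
        ((cols θ.loading j - cols (aligned θ₀ θ).loading j) k))) / size p) =
      ∑ a, d a * (residualWeight τ (E t) * θ₀.factor t j * Q t a) / size p +
      (v t - residualWeight τ (E t)) * θ₀.factor t j * (d ⬝ᵥ Q t) / size p := by
    intro t
    rw [aligned_factor_mul_dotProduct hne]
    have e2 : ∑ a, d a * (residualWeight τ (E t) * θ₀.factor t j * Q t a) / size p =
        residualWeight τ (E t) * θ₀.factor t j * (d ⬝ᵥ Q t) / size p := by
      rw [← Finset.sum_div, dotProduct, Finset.mul_sum]
      congr 1
      exact Finset.sum_congr rfl fun _ _ => by ring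
    rw [e2]
    change v t * (θ₀.factor t j * (d ⬝ᵥ Q t) / size p) = _
    ring
  rw [Finset.sum_congr rfl fun t _ => e1 t, Finset.sum_add_distrib, mul_add, mul_add]
  refine add_le_add ?_ ?_
  · -- the score of the loadings
    set Z : Fin (p k) → ℝ := fun a =>
      (T : ℝ)⁻¹ * ∑ t, residualWeight τ (E t) * θ₀.factor t j * Q t a with hZ
    have e3 : (T : ℝ)⁻¹ * ∑ t, ∑ a, d a * (residualWeight τ (E t) * θ₀.factor t j * Q t a) /
        size p = (d ⬝ᵥ Z) / size p := by
      rw [Finset.sum_comm, dotProduct, Finset.mul_sum, Finset.sum_div]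
      refine Finset.sum_congr rfl fun a _ => ?_
      rw [hZ, ← Finset.sum_div, ← Finset.mul_sum]
      ring
    have h3 := hN.weighted_score k j
    rw [← Finset.sum_mul] at h3
    have h4 : √(p k : ℝ) * √(∑ a, Z a ^ 2) / size p ≤ √(M * ρ) := by
      refine Real.le_sqrt_of_sq_le ((le_of_eq ?_).trans h3)
      rw [div_pow, mul_pow, Real.sq_sqrt (by positivity),
        Real.sq_sqrt (Finset.sum_nonneg fun _ _ => sq_nonneg _)]
      ring
    rw [e3]
    calc (d ⬝ᵥ Z) / size p ≤ (δ * √(p k : ℝ)) * √(∑ a, Z a ^ 2) / size p := by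
          refine div_le_div_of_nonneg_right ?_ hs.le
          exact (le_abs_self _).trans ((abs_dotProduct_le d Z).trans
            (mul_le_mul_of_nonneg_right hdn (Real.sqrt_nonneg _)))
      _ = δ * (√(p k : ℝ) * √(∑ a, Z a ^ 2) / size p) := by ring
      _ ≤ _ := mul_le_mul_of_nonneg_left h4 hδ0
  · have h5 : ∀ t, (v t - residualWeight τ (E t)) * θ₀.factor t j * (d ⬝ᵥ Q t) / size p ≤
        (B / τ * δ * κ) * ((tensorNorm (θ.common t - θ₀.common t) / √(size p)) *
          √(∑ a, Q t a ^ 2 / size p)) := by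
      intro t
      set e := tensorNorm (θ.common t - θ₀.common t) / √(size p) with he
      have he0 : 0 ≤ e := div_nonneg (tensorNorm_nonneg _) (Real.sqrt_nonneg _)
      have h6 : |(v t - residualWeight τ (E t)) * θ₀.factor t j * (d ⬝ᵥ Q t)| ≤
          e / τ * B * ((δ * √(p k : ℝ)) * √(∑ a, Q t a ^ 2)) := by
        rw [abs_mul, abs_mul]
        refine mul_le_mul (mul_le_mul (hv t) ((abs_le_tensorNorm _ j).trans (hB _ (h₀.2.2.1 t)))
          (abs_nonneg _) (by positivity)) ?_ (abs_nonneg _) (by positivity)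
        exact (abs_dotProduct_le d (Q t)).trans
          (mul_le_mul_of_nonneg_right hdn (Real.sqrt_nonneg _))
      have h7 : √(∑ a, Q t a ^ 2 / size p) = √(∑ a, Q t a ^ 2) / √(size p) := by
        rw [← Finset.sum_div, Real.sqrt_div' _ hs.le]
      have h8 : √(p k / size p : ℝ) = √(p k : ℝ) / √(size p) := Real.sqrt_div' _ hs.le
      calc _ ≤ e / τ * B * ((δ * √(p k : ℝ)) * √(∑ a, Q t a ^ 2)) / size p :=
            div_le_div_of_nonneg_right ((le_abs_self _).trans h6) hs.le
        _ = (B / τ * δ * √(p k / size p : ℝ)) * (e * √(∑ a, Q t a ^ 2 / size p)) := by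
            rw [h7, h8]
            nth_rw 1 [← Real.mul_self_sqrt hs.le]
            field_simp
        _ ≤ _ := by
            refine mul_le_mul_of_nonneg_right ?_ (by positivity)
            exact mul_le_mul_of_nonneg_left (hκ k) (by positivity)
    have h9 := avg_mul_le (fun t => tensorNorm (θ.common t - θ₀.common t) / √(size p))
      fun t => √(∑ a, Q t a ^ 2 / size p)
    have h10 : (T : ℝ)⁻¹ * ∑ t, √(∑ a, Q t a ^ 2 / size p) ^ 2 ≤ M := by
      refine le_trans (le_of_eq ?_) (hN.score_loading k j)
      congr 1
      exact Finset.sum_congr rfl fun t _ => Real.sq_sqrt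
        (Finset.sum_nonneg fun _ _ => by positivity)
    have h11 := mul_le_mul_of_nonneg_left (Real.sqrt_le_sqrt h10) (Real.sqrt_nonneg
      ((T : ℝ)⁻¹ * ∑ t, (tensorNorm (θ.common t - θ₀.common t) / √(size p)) ^ 2))
    calc _ ≤ (T : ℝ)⁻¹ * ∑ t, (B / τ * δ * κ) * ((tensorNorm (θ.common t - θ₀.common t) /
          √(size p)) * √(∑ a, Q t a ^ 2 / size p)) :=
          mul_le_mul_of_nonneg_left (Finset.sum_le_sum fun t _ => h5 t) hT
      _ = (B / τ * δ * κ) * ((T : ℝ)⁻¹ * ∑ t, ((tensorNorm (θ.common t - θ₀.common t) /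
          √(size p)) * √(∑ a, Q t a ^ 2 / size p))) := by rw [← Finset.mul_sum]; ring
      _ ≤ (B / τ * δ * κ) * (√(commonDist θ₀ θ) * √M) :=
          mul_le_mul_of_nonneg_left (h9.trans h11) (by positivity)
      _ = _ := by ring

/-- The weighted noise term: linear in the errors at the parametric scale, plus quadratic terms
with a small factor. -/
theorem avg_noise_le {τ s κ M ρ B : ℝ} (hτ : 0 < τ) (hB0 : 0 ≤ B) (hp : ∀ k, 0 < p k)
    (hB : ∀ F ∈ 𝓕, tensorNorm F ≤ B) {E X : Fin T → Tensor p}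
    (hX : ∀ t, X t = θ₀.common t + E t) (hκ0 : 0 ≤ κ)
    (hκ : ∀ k, √(p k / size p) ≤ κ) (hρ : 1 / (size p : ℝ) ≤ ρ) (h₀ : θ₀ ∈ paramSpace p r T 𝒜 𝓕)
    (h : θ ∈ paramSpace p r T 𝒜 𝓕)
    (hne : ∀ k i, loadingCos θ₀ θ k i ≠ 0) {k₀ : Fin K} {m : Fin T → ℝ}
    (hN : NoiseBounds θ₀ E k₀ τ s κ M ρ m) :
    (T : ℝ)⁻¹ * ∑ t, residualWeight τ (X t - θ.common t) *
        (E t ⬝ᵥ (θ.common t - θ₀.common t) / size p) ≤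
      √ρ * (√(factorError θ₀ θ) * √M) +
      (∏ k, r k) * 4 ^ K * κ * totalLoadingError θ₀ θ *
        (√(factorError θ₀ θ) + B * totalLoadingError θ₀ θ) +
      (∏ k, r k) * K * (totalLoadingError θ₀ θ *
        (√(M * ρ) + B / τ * κ * √M * √(commonDist θ₀ θ))) := by
  have hs : (0 : ℝ) < size p := by exact_mod_cast size_pos hp
  have hs2 : 0 < √(size p : ℝ) := Real.sqrt_pos.2 hs
  have hT : (0 : ℝ) ≤ (T : ℝ)⁻¹ := by positivity
  set δ := totalLoadingError θ₀ θ with hδ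
  have hδ0 : 0 ≤ δ := Real.sqrt_nonneg _
  set v : Fin T → ℝ := fun t => residualWeight τ (X t - θ.common t) with hv
  have hv0 : ∀ t, 0 ≤ v t := fun t => (huberWeight_pos hτ _).le
  have hv1 : ∀ t, v t ≤ 1 := fun t => huberWeight_le_one hτ _
  set F₁ := (aligned θ₀ θ).factor with hF₁
  set b : (∀ k, Fin (r k)) → ∀ k, Fin (p k) → ℝ := fun j => cols (aligned θ₀ θ).loading j with hb
  set d : (∀ k, Fin (r k)) → ∀ k, Fin (p k) → ℝ := fun j => cols θ.loading j - b j with hd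
  set G : Fin T → Tensor r := fun t => θ.factor t - F₁ t with hG
  set η : Fin T → ℝ := fun t => √(unfoldGramNorm k₀ (E t) / size p) with hη
  have hη0 : ∀ t, 0 ≤ η t := fun t => Real.sqrt_nonneg _
  have hbd : ∀ j, cols θ.loading j = b j + d j := fun j => cols_eq_add θ₀ θ j
  have hηs : ∀ t, √(unfoldGramNorm k₀ (E t)) * √(size p) / size p = η t := by
    intro t
    rw [hη]
    simp only
    rw [Real.sqrt_div' _ hs.le, mul_div_assoc, Real.sqrt_div_self', mul_one_div]
  set L₁ : Fin T → ℝ := fun t => ∑ j, G t j * (E t ⬝ᵥ rankOne (b j)) with hL₁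
  set L₂ : Fin T → ℝ := fun t => ∑ j, ∑ k, F₁ t j *
    (E t ⬝ᵥ rankOne (Function.update (b j) k (d j k))) with hL₂
  set Rem : Fin T → ℝ := fun t => ∑ j, (G t j * (E t ⬝ᵥ rankOne (b j + d j) -
    E t ⬝ᵥ rankOne (b j)) + F₁ t j * (E t ⬝ᵥ rankOne (b j + d j) - E t ⬝ᵥ rankOne (b j) -
      ∑ k, E t ⬝ᵥ rankOne (Function.update (b j) k (d j k)))) with hRem
  have hdec : ∀ t, E t ⬝ᵥ (θ.common t - θ₀.common t) = L₁ t + Rem t + L₂ t := by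
    intro t
    rw [← aligned_common hne t, dotProduct_sub, Param.common, Param.common,
      dotProduct_multiModeProd, dotProduct_multiModeProd, ← Finset.sum_sub_distrib, hL₁, hL₂, hRem]
    simp only
    rw [← Finset.sum_add_distrib, ← Finset.sum_add_distrib]
    refine Finset.sum_congr rfl fun j _ => ?_
    rw [hbd j, ← Finset.mul_sum]
    simp only [hG, Pi.sub_apply]
    ring
  -- the part that is linear in the factors
  have hI : (T : ℝ)⁻¹ * ∑ t, v t * (L₁ t / size p) ≤ √ρ * (√(factorError θ₀ θ) * √M) := by
    have h1 : ∀ t, v t * (L₁ t / size p) ≤ (1 / √(size p)) * (tensorNorm (G t) *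
        √(∑ j, (E t ⬝ᵥ rankOne (cols θ₀.loading j)) ^ 2 / size p)) := by
      intro t
      have h2 : |L₁ t| ≤ tensorNorm (G t) *
          √(∑ j, (E t ⬝ᵥ rankOne (cols θ₀.loading j)) ^ 2) := by
        refine (abs_dotProduct_le (G t) fun j => E t ⬝ᵥ rankOne (b j)).trans_eq ?_
        congr 2
        refine Finset.sum_congr rfl fun j _ => ?_
        rw [hb]
        simp only
        rw [cols_aligned, rankOne_smul, dotProduct_smul, smul_eq_mul, mul_pow, sq,
          prod_alignSign_mul_self hne, one_mul]
      calc v t * (L₁ t / size p) ≤ v t * (|L₁ t| / size p) :=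
            mul_le_mul_of_nonneg_left (div_le_div_of_nonneg_right (le_abs_self _) hs.le) (hv0 t)
        _ ≤ |L₁ t| / size p := mul_le_of_le_one_left (by positivity) (hv1 t)
        _ ≤ tensorNorm (G t) * √(∑ j, (E t ⬝ᵥ rankOne (cols θ₀.loading j)) ^ 2) / size p := by
            exact div_le_div_of_nonneg_right h2 hs.le
        _ = _ := by
            rw [← Finset.sum_div, Real.sqrt_div' _ hs.le]
            nth_rw 1 [← Real.mul_self_sqrt hs.le]
            field_simp
    have h3 := avg_mul_le (fun t => tensorNorm (G t))
      fun t => √(∑ j, (E t ⬝ᵥ rankOne (cols θ₀.loading j)) ^ 2 / size p)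
    have h4 : (T : ℝ)⁻¹ * ∑ t, √(∑ j, (E t ⬝ᵥ rankOne (cols θ₀.loading j)) ^ 2 / size p) ^ 2 ≤
        M := by
      refine le_trans (le_of_eq ?_) hN.score_factor
      congr 1
      exact Finset.sum_congr rfl fun t _ => Real.sq_sqrt
        (Finset.sum_nonneg fun _ _ => by positivity)
    have h5 : 1 / √(size p : ℝ) ≤ √ρ := by
      refine Real.le_sqrt_of_sq_le ?_
      rwa [div_pow, one_pow, Real.sq_sqrt hs.le]
    calc _ ≤ (T : ℝ)⁻¹ * ∑ t, (1 / √(size p)) * (tensorNorm (G t) *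
          √(∑ j, (E t ⬝ᵥ rankOne (cols θ₀.loading j)) ^ 2 / size p)) :=
          mul_le_mul_of_nonneg_left (Finset.sum_le_sum fun t _ => h1 t) hT
      _ = (1 / √(size p)) * ((T : ℝ)⁻¹ * ∑ t, (tensorNorm (G t) *
          √(∑ j, (E t ⬝ᵥ rankOne (cols θ₀.loading j)) ^ 2 / size p))) := by
          rw [← Finset.mul_sum]; ring
      _ ≤ √ρ * (√(factorError θ₀ θ) * √M) := by
          refine mul_le_mul h5 (h3.trans ?_) ?_ (Real.sqrt_nonneg _)
          · exact mul_le_mul_of_nonneg_left (Real.sqrt_le_sqrt h4) (Real.sqrt_nonneg _)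
          · exact mul_nonneg hT (Finset.sum_nonneg fun t _ =>
              mul_nonneg (tensorNorm_nonneg _) (Real.sqrt_nonneg _))
  -- the terms of second order
  have hII : (T : ℝ)⁻¹ * ∑ t, v t * (Rem t / size p) ≤
      (∏ k, r k) * 4 ^ K * κ * δ * (√(factorError θ₀ θ) + B * δ) := by
    have h1 : ∀ t, v t * (Rem t / size p) ≤
        ((∏ k, r k) * 4 ^ K * δ) * (tensorNorm (G t) * η t) +
          ((∏ k, r k) * 4 ^ K * δ * (B * δ)) * η t := by
      intro t
      have h2 : |Rem t| ≤ (∏ k, r k) * ((tensorNorm (G t) * (4 ^ K * δ) + B * (4 ^ K * δ ^ 2)) *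
          (√(unfoldGramNorm k₀ (E t)) * √(size p))) := by
        refine (Finset.abs_sum_le_sum_abs _ _).trans ((Finset.sum_le_card_nsmul _ _
          ((tensorNorm (G t) * (4 ^ K * δ) + B * (4 ^ K * δ ^ 2)) *
            (√(unfoldGramNorm k₀ (E t)) * √(size p))) fun j _ => ?_).trans_eq ?_)
        · have hsm := smallPerturbation_cols hp h₀ h j
          refine (abs_add_le _ _).trans ?_
          rw [abs_mul, abs_mul, add_mul, mul_assoc (tensorNorm (G t)), mul_assoc B]
          refine add_le_add (mul_le_mul (abs_le_tensorNorm _ j)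
            (hsm.abs_dotProduct_rankOne_sub_le k₀ (E t)) (abs_nonneg _) (tensorNorm_nonneg _))
            (mul_le_mul ?_ (hsm.abs_dotProduct_rankOne_sub_sub_le k₀ (E t)) (abs_nonneg _) hB0)
          exact (abs_le_tensorNorm _ j).trans ((tensorNorm_aligned_factor_le θ₀ θ t).trans
            (hB _ (h₀.2.2.1 t)))
        · rw [nsmul_eq_mul, Finset.card_univ, card_factor_index]
          push_cast
          ring
      calc v t * (Rem t / size p) ≤ v t * (|Rem t| / size p) :=
            mul_le_mul_of_nonneg_left (div_le_div_of_nonneg_right (le_abs_self _) hs.le) (hv0 t)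
        _ ≤ |Rem t| / size p := mul_le_of_le_one_left (by positivity) (hv1 t)
        _ ≤ (∏ k, r k) * ((tensorNorm (G t) * (4 ^ K * δ) + B * (4 ^ K * δ ^ 2)) *
          (√(unfoldGramNorm k₀ (E t)) * √(size p))) / size p :=
            div_le_div_of_nonneg_right h2 hs.le
        _ = _ := by
            rw [← hηs t]
            ring
    have h3 := avg_mul_le (fun t => tensorNorm (G t)) η
    have h4 : (T : ℝ)⁻¹ * ∑ t, η t ≤ κ := (avg_sqrt_gram_le k₀ E).trans hN.gram
    have h5 : √((T : ℝ)⁻¹ * ∑ t, η t ^ 2) ≤ κ := by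
      refine le_trans (le_of_eq ?_) hN.gram
      congr 2
      exact Finset.sum_congr rfl fun t _ => Real.sq_sqrt
        (div_nonneg (unfoldGramNorm_nonneg _ _) hs.le)
    have h6 : (T : ℝ)⁻¹ * ∑ t, tensorNorm (G t) * η t ≤ √(factorError θ₀ θ) * κ :=
      h3.trans (mul_le_mul_of_nonneg_left h5 (Real.sqrt_nonneg _))
    have hr0 : (0 : ℝ) ≤ (∏ k, r k : ℕ) * 4 ^ K * δ := by positivity
    calc _ ≤ (T : ℝ)⁻¹ * ∑ t, (((∏ k, r k) * 4 ^ K * δ) * (tensorNorm (G t) * η t) +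
          ((∏ k, r k) * 4 ^ K * δ * (B * δ)) * η t) :=
          mul_le_mul_of_nonneg_left (Finset.sum_le_sum fun t _ => h1 t) hT
      _ = ((∏ k, r k) * 4 ^ K * δ) * ((T : ℝ)⁻¹ * ∑ t, (tensorNorm (G t) * η t)) +
          ((∏ k, r k) * 4 ^ K * δ * (B * δ)) * ((T : ℝ)⁻¹ * ∑ t, η t) := by
          rw [Finset.sum_add_distrib, ← Finset.mul_sum, ← Finset.mul_sum]; ring
      _ ≤ ((∏ k, r k) * 4 ^ K * δ) * (√(factorError θ₀ θ) * κ) +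
          ((∏ k, r k) * 4 ^ K * δ * (B * δ)) * κ :=
          add_le_add (mul_le_mul_of_nonneg_left h6 hr0) (mul_le_mul_of_nonneg_left h4
            (mul_nonneg hr0 (by positivity)))
      _ = _ := by ring
  -- the part that is linear in the loadings
  have hIII : (T : ℝ)⁻¹ * ∑ t, v t * (L₂ t / size p) ≤
      (∏ k, r k) * K * (δ * (√(M * ρ) + B / τ * κ * √M * √(commonDist θ₀ θ))) := by
    have hvE : ∀ t, |v t - residualWeight τ (E t)| ≤
        tensorNorm (θ.common t - θ₀.common t) / √(size p) / τ := by
      intro t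
      have e2 : X t - θ.common t = E t - (θ.common t - θ₀.common t) := by rw [hX]; abel
      simp only [hv, e2]
      exact abs_residualWeight_sub_le hτ _ _
    have e1 : (T : ℝ)⁻¹ * ∑ t, v t * (L₂ t / size p) = ∑ j, ∑ k, (T : ℝ)⁻¹ * ∑ t, v t *
        (F₁ t j * (E t ⬝ᵥ rankOne (Function.update (b j) k (d j k))) / size p) := by
      simp only [hL₂, Finset.sum_div, Finset.mul_sum]
      rw [Finset.sum_comm]
      exact Finset.sum_congr rfl fun j _ => Finset.sum_comm
    rw [e1]
    refine (Finset.sum_le_card_nsmul _ _ (K * (δ * (√(M * ρ) + B / τ * κ * √M *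
      √(commonDist θ₀ θ)))) fun j _ => ?_).trans_eq ?_
    · refine (Finset.sum_le_card_nsmul _ _ (δ * (√(M * ρ) + B / τ * κ * √M *
        √(commonDist θ₀ θ))) fun k _ => ?_).trans_eq ?_
      · exact avg_linear_loading_le hτ hB0 hp hB hκ0 hκ h₀ h hne hN j k hvE
      · rw [nsmul_eq_mul, Finset.card_univ, Fintype.card_fin]
    · rw [nsmul_eq_mul, Finset.card_univ, card_factor_index]
      push_cast
      ring
  have e0 : (T : ℝ)⁻¹ * ∑ t, v t * (E t ⬝ᵥ (θ.common t - θ₀.common t) / size p) =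
      (T : ℝ)⁻¹ * ∑ t, v t * (L₁ t / size p) + (T : ℝ)⁻¹ * ∑ t, v t * (Rem t / size p) +
        (T : ℝ)⁻¹ * ∑ t, v t * (L₂ t / size p) := by
    rw [← mul_add, ← mul_add, ← Finset.sum_add_distrib, ← Finset.sum_add_distrib]
    congr 1
    refine Finset.sum_congr rfl fun t _ => ?_
    rw [hdec]
    ring
  rw [e0]
  exact add_le_add (add_le_add hI hII) hIII

end NoiseTerm

/-! ### The rate for given bounds on the noise -/

section DeterministicRate

/-- A quadratic inequality for `D`, solved by completing the square: the term linear in `D` is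
absorbed at the cost of a constant, the small quadratic term directly. -/
theorem sq_le_of_quadratic_bound {c₀ a b e D q ρ : ℝ} (hc₀ : 0 < c₀) (hq : q ^ 2 = ρ)
    (he : e ≤ c₀ / 4) (h : c₀ * D ^ 2 ≤ 2 * (b * q * D + e * D ^ 2) + a * ρ) :
    D ^ 2 ≤ 4 / c₀ * (a + 4 * b ^ 2 / c₀) * ρ := by
  have h1 : 2 * (b * q * D) ≤ c₀ / 4 * D ^ 2 + 4 * b ^ 2 / c₀ * ρ := by
    have h2 := sq_nonneg (c₀ * D - 4 * (b * q))
    have h3 : 2 * (b * q * D) * c₀ ≤ c₀ ^ 2 / 4 * D ^ 2 + 4 * b ^ 2 * q ^ 2 := by linarith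
    rw [← hq]
    refine le_of_mul_le_mul_right (h3.trans_eq ?_) hc₀
    field_simp
  have h4 := mul_le_mul_of_nonneg_right he (sq_nonneg D)
  have h5 : c₀ / 4 * D ^ 2 ≤ (a + 4 * b ^ 2 / c₀) * ρ := by linarith
  calc D ^ 2 = 4 / c₀ * (c₀ / 4 * D ^ 2) := by field_simp
    _ ≤ 4 / c₀ * ((a + 4 * b ^ 2 / c₀) * ρ) := mul_le_mul_of_nonneg_left h5 (by positivity)
    _ = _ := by ring

/-- The squared rate `ρ` is attained as soon as the noise satisfies `NoiseBounds` with a small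
enough `κ`: the crude bound gives consistency, hence identification of the parameters; then the
terms of second order are absorbed on the left-hand side. -/
theorem exists_errors_le_of_noiseBounds {K : ℕ} (r : Fin K → ℕ) {B g τ s M : ℝ} (hB0 : 0 ≤ B)
    (hg : 0 < g) (hτ : 0 < τ) (hM : 0 ≤ M) :
    ∃ κ : ℝ, 0 < κ ∧ ∃ C : ℝ, 0 < C ∧ ∀ (p : Fin K → ℕ) (T : ℕ) (𝒜 : ∀ k, Set (Fin (r k) → ℝ))
      (𝓕 : Set (Tensor r)) (θ₀ θ : Param p r T) (E X : Fin T → Tensor p) (k₀ : Fin K)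
      (m : Fin T → ℝ) (ρ : ℝ), (∀ k, 0 < p k) → (∀ F ∈ 𝓕, tensorNorm F ≤ B) →
      (∀ t, X t = θ₀.common t + E t) → (∀ k, √(p k / size p) ≤ κ) → 1 / (size p : ℝ) ≤ ρ →
      ρ ≤ κ → θ₀ ∈ paramSpace p r T 𝒜 𝓕 → (∀ k i, g ≤ factorGram θ₀.factor k i i) →
      (∀ k i j, i < j → g ≤ factorGram θ₀.factor k i i - factorGram θ₀.factor k j j) →
      NoiseBounds θ₀ E k₀ τ s κ M ρ m → IsHuberEstimator τ 𝒜 𝓕 X θ →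
      (∀ k, loadingError θ₀ θ k ≤ C * ρ) ∧ factorError θ₀ θ ≤ C * ρ := by
  -- Consistency: the squared distance of the common components is at most `a₁ κ`.
  -- Identification: the squared errors of the loadings and of the factors are at most `C₁` and `C₂`
  -- times this squared distance, provided that `κ ≤ κ₁`.
  -- Rate: the noise term is at most `b √ρ D + c κ D²`, and `c κ ≤ c₀ / 4` if `κ ≤ κ₂`.
  obtain ⟨c₀, hc₀⟩ : ∃ x : ℝ, x = minWeight τ s B := ⟨_, rfl⟩
  have hc₀pos : 0 < c₀ := hc₀ ▸ minWeight_pos hτ hB0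
  obtain ⟨J, hJ⟩ : ∃ x : ℝ, x = ((∏ k, r k : ℕ) : ℝ) := ⟨_, rfl⟩
  have hJ0 : 0 ≤ J := by rw [hJ]; positivity
  obtain ⟨R, hR⟩ : ∃ x : ℝ, x = ∑ k, (r k : ℝ) := ⟨_, rfl⟩
  have hR0 : 0 ≤ R := by rw [hR]; positivity
  have hrR : ∀ k, (r k : ℝ) ≤ R := fun k => hR ▸
    Finset.single_le_sum (f := fun k => (r k : ℝ)) (fun _ _ => by positivity) (Finset.mem_univ k)
  obtain ⟨a₁, ha₁⟩ : ∃ x : ℝ, x = (4 * B ^ 2 * M + 4 * J * B) / c₀ := ⟨_, rfl⟩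
  have ha₁0 : 0 ≤ a₁ := by rw [ha₁]; positivity
  obtain ⟨C₁, hC₁⟩ : ∃ x : ℝ,
      x = ∑ k, 2 * (r k : ℝ) * ((4 * r k + 1) / g ^ 2 * (r k * (4 * B ^ 2))) := ⟨_, rfl⟩
  have hC₁0 : 0 ≤ C₁ := by rw [hC₁]; positivity
  obtain ⟨C₂, hC₂⟩ : ∃ x : ℝ, x = 2 + 2 * (J * B * 4 ^ K) ^ 2 * C₁ := ⟨_, rfl⟩
  have hC₂0 : 0 ≤ C₂ := by rw [hC₂]; positivity
  obtain ⟨b, hb⟩ : ∃ x : ℝ, x = √C₂ * √M + J * K * (√C₁ * √M) := ⟨_, rfl⟩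
  have hb0 : 0 ≤ b := by rw [hb]; positivity
  obtain ⟨c, hc⟩ : ∃ x : ℝ,
      x = J * 4 ^ K * √C₁ * (√C₂ + B * √C₁) + J * K * (√C₁ * (B / τ * √M)) := ⟨_, rfl⟩
  have hc0 : 0 ≤ c := by rw [hc]; positivity
  obtain ⟨C₃, hC₃⟩ : ∃ x : ℝ, x = 4 / c₀ * (4 * B ^ 2 * M + 4 * b ^ 2 / c₀) := ⟨_, rfl⟩
  have hC₃0 : 0 ≤ C₃ := by rw [hC₃]; positivity
  obtain ⟨κ₁, hκ₁⟩ : ∃ x : ℝ,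
      x = g ^ 2 / (4 * (R + 1)) / (32 * (R + 1) * R * B ^ 2 * a₁ + 1) := ⟨_, rfl⟩
  obtain ⟨κ₂, hκ₂⟩ : ∃ x : ℝ, x = c₀ / (4 * (c + 1)) := ⟨_, rfl⟩
  have hκ₁0 : 0 < κ₁ := by rw [hκ₁]; positivity
  have hκ₂0 : 0 < κ₂ := by rw [hκ₂]; positivity
  refine ⟨min κ₁ κ₂, lt_min hκ₁0 hκ₂0, (C₁ + C₂) * C₃ + 1, by positivity, ?_⟩
  intro p T 𝒜 𝓕 θ₀ θ E X k₀ m ρ hp hB hX hκ hρ hρκ h₀ hpos hgap hN hθ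
  obtain ⟨κ, hκd⟩ : ∃ x : ℝ, x = min κ₁ κ₂ := ⟨_, rfl⟩
  rw [← hκd] at hκ hρκ hN
  have hκ0 : 0 < κ := hκd ▸ lt_min hκ₁0 hκ₂0
  have hκκ₁ : κ ≤ κ₁ := hκd ▸ min_le_left _ _
  have hκκ₂ : κ ≤ κ₂ := hκd ▸ min_le_right _ _
  have hs : (0 : ℝ) < size p := by exact_mod_cast size_pos hp
  have hρ0 : 0 < ρ := (by positivity : 0 < 1 / (size p : ℝ)).trans_le hρ
  have h := hθ.1
  have hT : (0 : ℝ) ≤ (T : ℝ)⁻¹ := by positivity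
  obtain ⟨D, hD⟩ : ∃ x : ℝ, x = √(commonDist θ₀ θ) := ⟨_, rfl⟩
  have hD0 : 0 ≤ D := hD ▸ Real.sqrt_nonneg _
  have hD2 : D ^ 2 = commonDist θ₀ θ := hD ▸ Real.sq_sqrt (commonDist_nonneg _ _)
  have hlow := minWeight_mul_commonDist_le hτ hB0 hp hB hX h₀ h hN.mean_le hN.concentration
  have hup := sum_residualWeight_le hτ hp hX h₀ hθ
  rw [← hc₀, ← hD2] at hlow
  -- consistency
  have hcons : D ^ 2 ≤ a₁ * κ := by
    have h1 : (T : ℝ)⁻¹ * ∑ t, residualWeight τ (X t - θ.common t) *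
        (E t ⬝ᵥ (θ.common t - θ₀.common t) / size p) ≤ 2 * J * B * κ := by
      calc _ ≤ (T : ℝ)⁻¹ * ∑ t, 2 * J * B * √(unfoldGramNorm k₀ (E t) / size p) := by
            refine mul_le_mul_of_nonneg_left (Finset.sum_le_sum fun t _ => ?_) hT
            have h2 := abs_dotProduct_common_sub_le hp hB0 hB h₀ h k₀ t (E t)
            rw [← hJ] at h2
            calc _ ≤ residualWeight τ (X t - θ.common t) *
                  |E t ⬝ᵥ (θ.common t - θ₀.common t) / size p| :=
                  mul_le_mul_of_nonneg_left (le_abs_self _) (huberWeight_pos hτ _).le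
              _ ≤ 1 * |E t ⬝ᵥ (θ.common t - θ₀.common t) / size p| :=
                  mul_le_mul_of_nonneg_right (huberWeight_le_one hτ _) (abs_nonneg _)
              _ ≤ _ := by rwa [one_mul]
        _ = 2 * J * B * ((T : ℝ)⁻¹ * ∑ t, √(unfoldGramNorm k₀ (E t) / size p)) := by
            rw [← Finset.mul_sum]; ring
        _ ≤ _ := mul_le_mul_of_nonneg_left ((avg_sqrt_gram_le k₀ E).trans hN.gram) (by positivity)
    rw [ha₁, div_mul_eq_mul_div, le_div_iff₀ hc₀pos]
    have h3 : 4 * B ^ 2 * (M * ρ) ≤ 4 * B ^ 2 * M * κ := by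
      rw [← mul_assoc]
      exact mul_le_mul_of_nonneg_left hρκ (by positivity)
    linarith
  have hident : ∀ k, 32 * (r k + 1) * r k * B ^ 2 * commonDist θ₀ θ ≤
      g ^ 2 / (4 * (r k + 1)) := by
    intro k
    have h1 : g ^ 2 / (4 * (R + 1)) ≤ g ^ 2 / (4 * (r k + 1)) := by
      have := hrR k
      gcongr
    have h2 : 32 * (r k + 1) * r k * B ^ 2 * commonDist θ₀ θ ≤
        32 * (R + 1) * R * B ^ 2 * (a₁ * κ₁) := by
      rw [← hD2]
      have := hrR k
      have h3 : D ^ 2 ≤ a₁ * κ₁ :=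
        hcons.trans (mul_le_mul_of_nonneg_left hκκ₁ ha₁0)
      gcongr
    refine (h2.trans ?_).trans h1
    have h4 : (32 * (R + 1) * R * B ^ 2 * a₁ + 1) * κ₁ = g ^ 2 / (4 * (R + 1)) := by
      rw [hκ₁]
      exact mul_div_cancel₀ _ (by positivity)
    linarith only [h4, hκ₁0]
  have hid := fun k => loadingError_le_commonDist hp hB hB0 hg h₀ h k (hpos k) (hgap k) (hident k)
  have hne : ∀ k i, loadingCos θ₀ θ k i ≠ 0 := fun k => (hid k).1
  obtain ⟨δ, hδ⟩ : ∃ x : ℝ, x = totalLoadingError θ₀ θ := ⟨_, rfl⟩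
  have hδ0 : 0 ≤ δ := hδ ▸ Real.sqrt_nonneg _
  have hδ2 : δ ^ 2 ≤ C₁ * D ^ 2 := by
    rw [hδ, totalLoadingError,
      Real.sq_sqrt (Finset.sum_nonneg fun k _ => loadingError_nonneg _ _ k),
      hC₁, Finset.sum_mul, hD2]
    exact Finset.sum_le_sum fun k _ => (hid k).2
  have hφ2 : factorError θ₀ θ ≤ C₂ * D ^ 2 := by
    have h1 := factorError_le_commonDist hp hB h₀ h hne
    rw [← hD2, ← hJ, ← hδ] at h1
    have h2 := mul_le_mul_of_nonneg_left hδ2 (by positivity : 0 ≤ 2 * (J * B * 4 ^ K) ^ 2)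
    rw [hC₂]
    linarith
  have hδD : δ ≤ √C₁ * D := by
    rw [← Real.sqrt_sq hδ0, ← Real.sqrt_sq hD0, ← Real.sqrt_mul hC₁0]
    exact Real.sqrt_le_sqrt hδ2
  have hφD : √(factorError θ₀ θ) ≤ √C₂ * D := by
    rw [← Real.sqrt_sq hD0, ← Real.sqrt_mul hC₂0]
    exact Real.sqrt_le_sqrt hφ2
  obtain ⟨φ, hφ⟩ : ∃ x : ℝ, x = √(factorError θ₀ θ) := ⟨_, rfl⟩
  rw [← hφ] at hφD
  have hφ0 : 0 ≤ φ := hφ ▸ Real.sqrt_nonneg _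
  have hnoise := avg_noise_le hτ hB0 hp hB hX hκ0.le hκ hρ h₀ h hne hN
  rw [Real.sqrt_mul hM, ← hJ, ← hδ, ← hφ, ← hD] at hnoise
  have hnoise2 : √ρ * (φ * √M) + J * 4 ^ K * κ * δ * (φ + B * δ) +
      J * K * (δ * (√M * √ρ + B / τ * κ * √M * D)) ≤ b * √ρ * D + c * κ * D ^ 2 := by
    calc _ ≤ √ρ * (√C₂ * D * √M) + J * 4 ^ K * κ * (√C₁ * D) * (√C₂ * D + B * (√C₁ * D)) +
          J * K * (√C₁ * D * (√M * √ρ + B / τ * κ * √M * D)) := by gcongr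
      _ = _ := by rw [hb, hc]; ring
  have hmain : c₀ * D ^ 2 ≤ 2 * (b * √ρ * D + c * κ * D ^ 2) + 4 * B ^ 2 * (M * ρ) := by
    linarith
  have hcκ : c * κ ≤ c₀ / 4 := by
    calc c * κ ≤ (c + 1) * κ₂ := mul_le_mul (by linarith) hκκ₂ hκ0.le (by linarith)
      _ = c₀ / 4 := by rw [hκ₂]; field_simp
  have hρs : √ρ ^ 2 = ρ := Real.sq_sqrt hρ0.le
  have hDρ : D ^ 2 ≤ C₃ * ρ := by
    rw [hC₃]
    refine sq_le_of_quadratic_bound hc₀pos hρs hcκ ?_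
    linarith
  have h₁ : C₁ * D ^ 2 ≤ C₁ * (C₃ * ρ) := mul_le_mul_of_nonneg_left hDρ hC₁0
  have h₂ : C₂ * D ^ 2 ≤ C₂ * (C₃ * ρ) := mul_le_mul_of_nonneg_left hDρ hC₂0
  have h₃ : 0 ≤ C₁ * (C₃ * ρ) := by positivity
  have h₄ : 0 ≤ C₂ * (C₃ * ρ) := by positivity
  refine ⟨fun k => ?_, by linarith only [hφ2, h₂, h₃, hρ0]⟩
  have h₅ : loadingError θ₀ θ k ≤ δ ^ 2 := hδ ▸ loadingError_le_total_sq θ₀ θ k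
  linarith only [h₅, hδ2, h₁, h₄, hρ0]

end DeterministicRate

/-! ### Moments of independent variables -/

section Moments

variable {Ω : Type*} [MeasurableSpace Ω] {μ : Measure Ω}

/-- `f` is integrable, with integral at most `c`. -/
def IntegralLE (μ : Measure Ω) (f : Ω → ℝ) (c : ℝ) : Prop := Integrable f μ ∧ ∫ ω, f ω ∂μ ≤ c

namespace IntegralLE

theorem mono {f : Ω → ℝ} {c c' : ℝ} (h : IntegralLE μ f c) (hc : c ≤ c') : IntegralLE μ f c' :=
  ⟨h.1, h.2.trans hc⟩

theorem add {f g : Ω → ℝ} {c c' : ℝ} (hf : IntegralLE μ f c) (hg : IntegralLE μ g c') :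
    IntegralLE μ (fun ω => f ω + g ω) (c + c') :=
  ⟨hf.1.add hg.1, by rw [integral_add hf.1 hg.1]; exact add_le_add hf.2 hg.2⟩

theorem sum {ι : Type*} {s : Finset ι} {f : ι → Ω → ℝ} {c : ι → ℝ}
    (h : ∀ i ∈ s, IntegralLE μ (f i) (c i)) :
    IntegralLE μ (fun ω => ∑ i ∈ s, f i ω) (∑ i ∈ s, c i) :=
  ⟨integrable_finsetSum _ fun i hi => (h i hi).1, by
    rw [integral_finsetSum _ fun i hi => (h i hi).1]
    exact Finset.sum_le_sum fun i hi => (h i hi).2⟩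

theorem const_mul {f : Ω → ℝ} {c a : ℝ} (h : IntegralLE μ f c) (ha : 0 ≤ a) :
    IntegralLE μ (fun ω => a * f ω) (a * c) :=
  ⟨h.1.const_mul a, by rw [integral_const_mul]; exact mul_le_mul_of_nonneg_left h.2 ha⟩

theorem mul_const {f : Ω → ℝ} {c a : ℝ} (h : IntegralLE μ f c) (ha : 0 ≤ a) :
    IntegralLE μ (fun ω => f ω * a) (c * a) := by
  simpa only [mul_comm _ a] using h.const_mul ha

theorem div_const {f : Ω → ℝ} {c a : ℝ} (h : IntegralLE μ f c) (ha : 0 ≤ a) :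
    IntegralLE μ (fun ω => f ω / a) (c / a) := by
  simpa only [div_eq_mul_inv] using h.mul_const (inv_nonneg.2 ha)

theorem avg {T : ℕ} {f : Fin T → Ω → ℝ} {c : ℝ} (hc : 0 ≤ c) (h : ∀ t, IntegralLE μ (f t) c) :
    IntegralLE μ (fun ω => (T : ℝ)⁻¹ * ∑ t, f t ω) c := by
  refine ((sum fun t _ => h t).const_mul (by positivity : (0 : ℝ) ≤ (T : ℝ)⁻¹)).mono ?_
  rw [Finset.sum_const, Finset.card_univ, Fintype.card_fin, nsmul_eq_mul, ← mul_assoc]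
  exact mul_le_of_le_one_left hc inv_mul_le_one

/-- Markov's inequality. -/
theorem measure_lt_le [IsFiniteMeasure μ] {f : Ω → ℝ} {c M : ℝ} (h : IntegralLE μ f c)
    (hf : ∀ ω, 0 ≤ f ω) (hM : 0 < M) : μ {ω | M < f ω} ≤ ENNReal.ofReal (c / M) := by
  have h1 := mul_meas_ge_le_integral_of_nonneg (ae_of_all μ hf) h.1 M
  have h2 : μ.real {ω | M ≤ f ω} ≤ c / M := by
    rw [le_div_iff₀ hM, mul_comm]
    exact h1.trans h.2
  calc μ {ω | M < f ω} ≤ μ {ω | M ≤ f ω} :=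
        measure_mono (Set.ofPred_subset_ofPred.2 fun _ => le_of_lt)
    _ = ENNReal.ofReal (μ.real {ω | M ≤ f ω}) := (ofReal_measureReal).symm
    _ ≤ _ := ENNReal.ofReal_le_ofReal h2

end IntegralLE

/-- The second moment of a sum of pairwise independent variables. -/
theorem integral_sum_sq_le [IsProbabilityMeasure μ] {ι : Type*} [Fintype ι] {X : ι → Ω → ℝ}
    (hX : ∀ i, MemLp (X i) 2 μ) (hind : Pairwise fun i j => IndepFun (X i) (X j) μ) {v b : ℝ}
    (hv : ∀ i, ∫ ω, X i ω ^ 2 ∂μ ≤ v) (hb : ∀ i, |∫ ω, X i ω ∂μ| ≤ b) :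
    IntegralLE μ (fun ω => (∑ i, X i ω) ^ 2) (Fintype.card ι * v + (Fintype.card ι * b) ^ 2) := by
  have hsum : MemLp (∑ i, X i) 2 μ := memLp_finsetSum' _ fun i _ => hX i
  have e : ∀ ω, (∑ i, X i) ω = ∑ i, X i ω := fun ω => Finset.sum_apply _ _ _
  have hint : Integrable (fun ω => (∑ i, X i ω) ^ 2) μ := by
    simpa only [e] using hsum.integrable_sq
  refine ⟨hint, ?_⟩
  have h1 := variance_eq_sub hsum
  rw [IndepFun.variance_sum (fun i _ => hX i) fun i _ j _ hij => hind hij] at h1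
  have h2 : ∑ i, Var[X i; μ] ≤ Fintype.card ι * v := by
    refine (Finset.sum_le_card_nsmul _ _ v fun i _ => ?_).trans_eq ?_
    · exact (variance_le_expectation_sq (hX i).aestronglyMeasurable).trans (hv i)
    · rw [nsmul_eq_mul, Finset.card_univ]
  have h3 : ∫ ω, (∑ i, X i) ω ∂μ = ∑ i, ∫ ω, X i ω ∂μ := by
    simp only [e]
    exact integral_finsetSum _ fun i _ => (hX i).integrable one_le_two
  have h4 : |∑ i, ∫ ω, X i ω ∂μ| ≤ Fintype.card ι * b := by
    refine (Finset.abs_sum_le_sum_abs _ _).trans ((Finset.sum_le_card_nsmul _ _ b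
      fun i _ => hb i).trans_eq ?_)
    rw [nsmul_eq_mul, Finset.card_univ]
  have h5 : (∑ i, ∫ ω, X i ω ∂μ) ^ 2 ≤ (Fintype.card ι * b) ^ 2 := by
    rw [← sq_abs]
    exact pow_le_pow_left₀ (abs_nonneg _) h4 2
  have h6 : ∫ ω, ((∑ i, X i) ^ 2) ω ∂μ = ∫ ω, (∑ i, X i ω) ^ 2 ∂μ := by
    simp only [Pi.pow_apply, e]
  rw [h6, h3] at h1
  linarith

/-- The variance of a sum of pairwise independent variables. -/
theorem integral_sum_sub_sq_le [IsProbabilityMeasure μ] {ι : Type*} [Fintype ι] {X : ι → Ω → ℝ}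
    (hX : ∀ i, MemLp (X i) 2 μ) (hind : Pairwise fun i j => IndepFun (X i) (X j) μ) {v : ℝ}
    (hv : ∀ i, ∫ ω, X i ω ^ 2 ∂μ ≤ v) :
    IntegralLE μ (fun ω => (∑ i, X i ω - ∑ i, ∫ ω, X i ω ∂μ) ^ 2) (Fintype.card ι * v) := by
  have hsum : MemLp (∑ i, X i) 2 μ := memLp_finsetSum' _ fun i _ => hX i
  have e : ∀ ω, (∑ i, X i) ω = ∑ i, X i ω := fun ω => Finset.sum_apply _ _ _
  have h3 : ∫ ω, (∑ i, X i) ω ∂μ = ∑ i, ∫ ω, X i ω ∂μ := by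
    simp only [e]
    exact integral_finsetSum _ fun i _ => (hX i).integrable one_le_two
  refine ⟨?_, ?_⟩
  · have := (hsum.sub (memLp_const (∑ i, ∫ ω, X i ω ∂μ))).integrable_sq
    simpa only [Pi.sub_apply, e] using this
  · have h1 := IndepFun.variance_sum (s := Finset.univ) (fun i _ => hX i)
      fun i _ j _ hij => hind hij
    rw [variance_eq_integral hsum.aestronglyMeasurable.aemeasurable, h3] at h1
    simp only [e] at h1
    rw [h1]
    refine (Finset.sum_le_card_nsmul _ _ v fun i _ => ?_).trans_eq ?_
    · exact (variance_le_expectation_sq (hX i).aestronglyMeasurable).trans (hv i)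
    · rw [nsmul_eq_mul, Finset.card_univ]

/-- Independent centred random variables with `E e² ≤ v` and `E e⁴ ≤ 3 v²`, as for Gaussian
variables of variance `v`. -/
structure NoiseFamily {ι : Type*} (μ : Measure Ω) (v : ℝ) (e : ι → Ω → ℝ) : Prop where
  meas : ∀ i, Measurable (e i)
  indep : iIndepFun e μ
  integrable : ∀ i, Integrable (e i) μ
  mean_zero : ∀ i, ∫ ω, e i ω ∂μ = 0
  sq : ∀ i, IntegralLE μ (fun ω => e i ω ^ 2) v
  fourth : ∀ i, IntegralLE μ (fun ω => e i ω ^ 4) (3 * v ^ 2)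

namespace NoiseFamily

variable {ι : Type*} {v : ℝ} {e : ι → Ω → ℝ}

theorem precomp {κ : Type*} {f : κ → ι} (h : NoiseFamily μ v e) (hf : f.Injective) :
    NoiseFamily μ v fun k => e (f k) :=
  ⟨fun _ => h.meas _, h.indep.precomp hf, fun _ => h.integrable _, fun _ => h.mean_zero _,
    fun _ => h.sq _, fun _ => h.fourth _⟩

theorem memLp (h : NoiseFamily μ v e) (i : ι) : MemLp (e i) 2 μ :=
  (memLp_two_iff_integrable_sq (h.meas i).aestronglyMeasurable).2 (h.sq i).1

theorem memLp_sq (h : NoiseFamily μ v e) (i : ι) : MemLp (fun ω => e i ω ^ 2) 2 μ := by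
  refine (memLp_two_iff_integrable_sq ((h.meas i).pow_const 2).aestronglyMeasurable).2 ?_
  simpa only [← pow_mul] using (h.fourth i).1

theorem nonneg (h : NoiseFamily μ v e) (i : ι) : 0 ≤ v :=
  (integral_nonneg fun _ => sq_nonneg _).trans (h.sq i).2

/-- The second moment of a linear form. -/
theorem integral_linear_sq_le [Fintype ι] [IsProbabilityMeasure μ] (h : NoiseFamily μ v e)
    (c : ι → ℝ) : IntegralLE μ (fun ω => (∑ i, e i ω * c i) ^ 2) (v * ∑ i, c i ^ 2) := by
  have hX : ∀ i, MemLp (fun ω => e i ω * c i) 2 μ := fun i => by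
    simpa only [mul_comm] using (h.memLp i).const_mul (c i)
  have hind : Pairwise fun i j => IndepFun (fun ω => e i ω * c i) (fun ω => e j ω * c j) μ :=
    fun i j hij => (h.indep.indepFun hij).comp (measurable_id.mul_const (c i))
      (measurable_id.mul_const (c j))
  have hsum : MemLp (∑ i, fun ω => e i ω * c i) 2 μ := memLp_finsetSum' _ fun i _ => hX i
  have e1 : ∀ ω, (∑ i, fun ω => e i ω * c i) ω = ∑ i, e i ω * c i :=
    fun ω => Finset.sum_apply _ _ _
  have hmean : ∀ i, ∫ ω, e i ω * c i ∂μ = 0 := fun i => by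
    rw [integral_mul_const, h.mean_zero, zero_mul]
  have h0 : ∫ ω, (∑ i, fun ω => e i ω * c i) ω ∂μ = 0 := by
    simp only [e1]
    rw [integral_finsetSum _ fun i _ => (hX i).integrable one_le_two]
    exact Finset.sum_eq_zero fun i _ => hmean i
  refine ⟨by simpa only [e1] using hsum.integrable_sq, ?_⟩
  have h1 := IndepFun.variance_sum (s := Finset.univ) (fun i _ => hX i)
    fun i _ j _ hij => hind hij
  rw [variance_of_integral_eq_zero hsum.aestronglyMeasurable.aemeasurable h0] at h1
  simp only [e1] at h1
  rw [h1, Finset.mul_sum]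
  refine Finset.sum_le_sum fun i _ => ?_
  rw [variance_of_integral_eq_zero (hX i).aestronglyMeasurable.aemeasurable (hmean i)]
  simp only [mul_pow]
  rw [integral_mul_const]
  exact mul_le_mul_of_nonneg_right (h.sq i).2 (sq_nonneg _)

/-- The sum of the squares concentrates about its mean. -/
theorem integral_sum_sq_sub_sq_le [Fintype ι] [IsProbabilityMeasure μ] (h : NoiseFamily μ v e) :
    IntegralLE μ (fun ω => (∑ i, e i ω ^ 2 - ∑ i, ∫ ω, e i ω ^ 2 ∂μ) ^ 2)
      (Fintype.card ι * (3 * v ^ 2)) := by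
  refine integral_sum_sub_sq_le h.memLp_sq (fun i j hij => ?_) fun i => ?_
  · exact (h.indep.indepFun hij).comp (measurable_id.pow_const 2) (measurable_id.pow_const 2)
  · simpa only [← pow_mul] using (h.fourth i).2

/-- The fourth moment computation behind the bound for the operator norm of a noise matrix. -/
theorem integral_gram_entry_sq_le {m n : Type*} [DecidableEq m] [Fintype n]
    [IsProbabilityMeasure μ]
    {e : m × n → Ω → ℝ} (h : NoiseFamily μ v e) (a a' : m) :
    IntegralLE μ (fun ω => (∑ c, e (a, c) ω * e (a', c) ω) ^ 2)
      (Fintype.card n * v ^ 2 + if a = a' then 3 * (Fintype.card n * v) ^ 2 else 0) := by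
  by_cases haa : a = a'
  · subst haa
    rw [if_pos rfl]
    have hsum : IntegralLE μ (fun ω => (Fintype.card n : ℝ) * ∑ c, e (a, c) ω ^ 4)
        (Fintype.card n * ∑ _c : n, 3 * v ^ 2) :=
      (IntegralLE.sum fun c _ => h.fourth (a, c)).const_mul (by positivity)
    have hle : ∀ ω, (∑ c, e (a, c) ω * e (a, c) ω) ^ 2 ≤
        (Fintype.card n : ℝ) * ∑ c, e (a, c) ω ^ 4 := by
      intro ω
      refine (sq_sum_le_card_mul_sum_sq (s := Finset.univ)
        (f := fun c => e (a, c) ω * e (a, c) ω)).trans_eq ?_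
      rw [Finset.card_univ]
      congr 1
      exact Finset.sum_congr rfl fun c _ => by ring
    have hint : Integrable (fun ω => (∑ c, e (a, c) ω * e (a, c) ω) ^ 2) μ := by
      refine hsum.1.mono' ?_ (ae_of_all _ fun ω => ?_)
      · exact (Measurable.pow_const (Finset.measurable_fun_sum _ fun c _ =>
          (h.meas _).mul (h.meas _)) 2).aestronglyMeasurable
      · rw [Real.norm_of_nonneg (sq_nonneg _)]
        exact hle ω
    refine ⟨hint, (integral_mono hint hsum.1 hle).trans (hsum.2.trans ?_)⟩
    rw [Finset.sum_const, Finset.card_univ, nsmul_eq_mul]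
    have : (0 : ℝ) ≤ Fintype.card n * v ^ 2 := by positivity
    nlinarith
  · rw [if_neg haa]
    have hne : ∀ c, ((a, c) : m × n) ≠ (a', c) := fun c hc => haa (congrArg Prod.fst hc)
    have hi : ∀ c, IndepFun (e (a, c)) (e (a', c)) μ := fun c => h.indep.indepFun (hne c)
    have hi2 : ∀ c, IndepFun (fun ω => e (a, c) ω ^ 2) (fun ω => e (a', c) ω ^ 2) μ := fun c =>
      (hi c).comp (measurable_id.pow_const 2) (measurable_id.pow_const 2)
    have hsq : ∀ c, IntegralLE μ (fun ω => (e (a, c) ω * e (a', c) ω) ^ 2) (v ^ 2) := by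
      intro c
      simp only [mul_pow]
      refine ⟨(hi2 c).integrable_mul (h.sq _).1 (h.sq _).1, ?_⟩
      rw [(hi2 c).integral_fun_mul_eq_mul_integral (h.sq _).1.aestronglyMeasurable
        (h.sq _).1.aestronglyMeasurable, pow_two v]
      exact mul_le_mul (h.sq _).2 (h.sq _).2 (integral_nonneg fun ω => sq_nonneg _)
        (h.nonneg (a, c))
    have hX : ∀ c, MemLp (fun ω => e (a, c) ω * e (a', c) ω) 2 μ := fun c =>
      (memLp_two_iff_integrable_sq ((h.meas _).mul (h.meas _)).aestronglyMeasurable).2 (hsq c).1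
    have hind : Pairwise fun c c' => IndepFun (fun ω => e (a, c) ω * e (a', c) ω)
        (fun ω => e (a, c') ω * e (a', c') ω) μ := by
      intro c c' hc
      have h1 := h.indep.indepFun_prodMk_prodMk h.meas (a, c) (a', c) (a, c') (a', c')
        (fun h => hc (congrArg Prod.snd h)) (fun h => hc (congrArg Prod.snd h))
        (fun h => hc (congrArg Prod.snd h)) (fun h => hc (congrArg Prod.snd h))
      exact h1.comp (φ := fun q : ℝ × ℝ => q.1 * q.2) (ψ := fun q : ℝ × ℝ => q.1 * q.2)
        (by fun_prop) (by fun_prop)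
    have h2 := integral_sum_sq_le hX hind (fun c => (hsq c).2) (b := 0) fun c => by
      rw [(hi c).integral_fun_mul_eq_mul_integral (h.integrable _).aestronglyMeasurable
        (h.integrable _).aestronglyMeasurable, h.mean_zero]
      simp
    simpa using h2

end NoiseFamily

end Moments

/-! ### Noise tensors -/

section NoiseTensors

variable {K : ℕ} {p r : Fin K → ℕ} {T : ℕ} {Ω : Type*} [MeasurableSpace Ω] {μ : Measure Ω}
  {E : Fin T → Ω → Tensor p} {v : ℝ}

/-- The entries of the error tensors form a `NoiseFamily`; only their second and fourth moments
matter. -/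
theorem noiseFamily_of_subGaussian {ν : ℝ} (h₂ : IndepErrors μ E) (h₃ : SubGaussianErrors μ ν E) :
    NoiseFamily μ (ν ^ 2) fun (s : Fin T × (∀ k, Fin (p k))) ω => E s.1 ω s.2 := by
  refine ⟨fun s => h₂.measurable _ _, h₂.indep, fun s => (h₃.mean_zero _ _).1,
    fun s => (h₃.mean_zero _ _).2, fun s => ?_, fun s => ?_⟩
  · have h := h₃.moment s.1 s.2 1 le_rfl
    simp only [mul_one, sq_abs] at h
    refine ⟨h.1, h.2.trans_eq ?_⟩
    norm_num [Nat.factorial]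
  · have h := h₃.moment s.1 s.2 2 one_le_two
    have e : ∀ ω, |E s.1 ω s.2| ^ (2 * 2) = E s.1 ω s.2 ^ 4 := fun ω => by
      rw [show 2 * 2 = 4 by norm_num, (by decide : Even 4).pow_abs]
    simp only [e] at h
    refine ⟨h.1, h.2.trans_eq ?_⟩
    norm_num [Nat.factorial]
    ring

/-- The noise at a single time. -/
theorem NoiseFamily.slice
    (h : NoiseFamily μ v fun (s : Fin T × (∀ k, Fin (p k))) ω => E s.1 ω s.2) (t : Fin T) :
    NoiseFamily μ v fun i ω => E t ω i :=
  h.precomp (f := fun i => (t, i)) fun _ _ hij => congrArg Prod.snd hij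

theorem measurable_tensorNorm : Measurable (tensorNorm : Tensor p → ℝ) := by
  unfold tensorNorm
  fun_prop

theorem measurable_residualWeight (τ : ℝ) :
    Measurable (residualWeight τ : Tensor p → ℝ) := by
  unfold residualWeight
  exact (measurable_huberWeight τ).comp (measurable_tensorNorm.div_const _)

theorem card_index (p : Fin K → ℕ) : Fintype.card (∀ k, Fin (p k)) = size p := by
  rw [Fintype.card_pi, size]
  simp

theorem card_index_except (p : Fin K → ℕ) (k : Fin K) :
    Fintype.card (∀ j : {j // j ≠ k}, Fin (p j)) = sizeExcept p k := by
  rw [Fintype.card_pi, sizeExcept_eq]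
  simp

/-- The normalised squared norm of a noise tensor concentrates about its mean. -/
theorem integral_tensorNorm_sq_sub_sq_le [IsProbabilityMeasure μ]
    (hp : ∀ k, 0 < p k) {E : Ω → Tensor p}
    (h : NoiseFamily μ v fun i ω => E ω i) :
    IntegralLE μ (fun ω => (tensorNorm (E ω) ^ 2 / size p -
      (∑ i, ∫ ω, E ω i ^ 2 ∂μ) / size p) ^ 2) (3 * v ^ 2 * (1 / size p)) := by
  have hs : (0 : ℝ) < size p := by exact_mod_cast size_pos hp
  have h1 := (h.integral_sum_sq_sub_sq_le.div_const (by positivity : (0 : ℝ) ≤ (size p : ℝ) ^ 2))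
  simp only [← sub_div, div_pow, tensorNorm_sq]
  refine h1.mono (le_of_eq ?_)
  rw [card_index]
  field_simp

theorem mean_tensorNorm_sq_le (hp : ∀ k, 0 < p k) {E : Ω → Tensor p}
    (h : NoiseFamily μ v fun i ω => E ω i) : (∑ i, ∫ ω, E ω i ^ 2 ∂μ) / size p ≤ v := by
  have hs : (0 : ℝ) < size p := by exact_mod_cast size_pos hp
  rw [div_le_iff₀ hs]
  refine (Finset.sum_le_card_nsmul _ _ v fun i _ => (h.sq i).2).trans_eq ?_
  rw [nsmul_eq_mul, Finset.card_univ, card_index, mul_comm]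

/-- The unfoldings of a noise tensor have a squared operator norm of smaller order than `p`. -/
theorem integral_unfoldGramNorm_sq_le [IsProbabilityMeasure μ]
    (hp : ∀ k, 0 < p k) {E : Ω → Tensor p}
    (h : NoiseFamily μ v fun i ω => E ω i) (k : Fin K) :
    IntegralLE μ (fun ω => (unfoldGramNorm k (E ω) / size p) ^ 2)
      (v ^ 2 * (1 / sizeExcept p k + 3 / p k)) := by
  have hk : (0 : ℝ) < p k := by exact_mod_cast hp k
  have he : (0 : ℝ) < sizeExcept p k := by exact_mod_cast Finset.prod_pos fun j _ => hp j
  have h1 : NoiseFamily μ v fun (q : Fin (p k) × (∀ j : {j // j ≠ k}, Fin (p j))) ω =>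
      unfold k (E ω) q.1 q.2 :=
    h.precomp (f := (Equiv.piSplitAt k fun j => Fin (p j)).symm) (Equiv.injective _)
  have h2 := (IntegralLE.sum fun a (_ : a ∈ Finset.univ) =>
    IntegralLE.sum fun a' (_ : a' ∈ Finset.univ) => h1.integral_gram_entry_sq_le a a').div_const
      (by positivity : (0 : ℝ) ≤ (size p : ℝ) ^ 2)
  have e : ∀ ω, (unfoldGramNorm k (E ω) / size p) ^ 2 = (∑ a, ∑ a', (∑ c,
      unfold k (E ω) a c * unfold k (E ω) a' c) ^ 2) / (size p : ℝ) ^ 2 := by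
    intro ω
    rw [div_pow, unfoldGramNorm, matrixNorm_sq]
    rfl
  simp only [e]
  refine h2.mono (le_of_eq ?_)
  simp only [Finset.sum_add_distrib, Finset.sum_ite_eq, Finset.mem_univ, if_true, Finset.sum_const,
    Finset.card_univ, Fintype.card_fin, nsmul_eq_mul, card_index_except]
  rw [size_eq_mul_sizeExcept p k]
  push_cast
  field_simp

theorem integral_dotProduct_sq_le [IsProbabilityMeasure μ]
    {E : Ω → Tensor p} (h : NoiseFamily μ v fun i ω => E ω i)
    (V : Tensor p) : IntegralLE μ (fun ω => (E ω ⬝ᵥ V) ^ 2) (v * tensorNorm V ^ 2) := by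
  rw [tensorNorm_sq]
  exact h.integral_linear_sq_le V

/-- The weight depends on each single entry of the noise only slightly, so that a weighted entry is
nearly centred: compare with the weight computed from the other entries, which is independent. -/
theorem abs_integral_residualWeight_mul_entry_le {τ : ℝ} (hτ : 0 < τ) {E : Ω → Tensor p}
    (h : NoiseFamily μ v fun i ω => E ω i) (i : ∀ k, Fin (p k)) :
    |∫ ω, residualWeight τ (E ω) * E ω i ∂μ| ≤ v / (√(size p) * τ) := by
  have hE : Measurable E := measurable_pi_lambda _ h.meas
  have hE' : Measurable fun ω => Function.update (E ω) i 0 := by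
    refine measurable_pi_lambda _ fun i' => ?_
    by_cases hi : i' = i
    · subst hi
      simp
    · simpa [Function.update_of_ne hi] using h.meas i'
  have hbound : ∀ x : Tensor p, ‖residualWeight τ x‖ ≤ 1 := fun x => by
    rw [residualWeight, Real.norm_of_nonneg (huberWeight_pos hτ _).le]
    exact huberWeight_le_one hτ _
  have hi1 : Integrable (fun ω => residualWeight τ (E ω) * E ω i) μ :=
    (h.integrable i).bdd_mul ((measurable_residualWeight τ).comp hE).aestronglyMeasurable
      (ae_of_all _ fun ω => hbound _)
  have hi2 : Integrable (fun ω => residualWeight τ (Function.update (E ω) i 0) * E ω i) μ :=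
    (h.integrable i).bdd_mul ((measurable_residualWeight τ).comp hE').aestronglyMeasurable
      (ae_of_all _ fun ω => hbound _)
  have hind : IndepFun (fun ω => residualWeight τ (Function.update (E ω) i 0))
      (fun ω => E ω i) μ := by
    have h1 := h.indep.indepFun_finset (Finset.univ.erase i) {i} (by simp) h.meas
    let S : Finset (∀ k, Fin (p k)) := Finset.univ.erase i
    let φ : (S → ℝ) → ℝ := fun z =>
      residualWeight τ fun i' => if hi : i' ∈ S then z ⟨i', hi⟩ else 0
    let ψ : (({i} : Finset (∀ k, Fin (p k))) → ℝ) → ℝ := fun z => z ⟨i, Finset.mem_singleton_self i⟩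
    have hφ : Measurable φ := by
      refine (measurable_residualWeight τ).comp (measurable_pi_lambda _ fun i' => ?_)
      by_cases hi : i' ∈ S
      · simpa only [hi, dif_pos] using measurable_pi_apply _
      · simp only [hi, dif_neg, not_false_eq_true, measurable_const]
    have hψ : Measurable ψ := measurable_pi_apply _
    have h2 := h1.comp hφ hψ
    have e1 : (φ ∘ fun ω (i' : S) => E ω i') =
        fun ω => residualWeight τ (Function.update (E ω) i 0) := by
      funext ω
      simp only [φ, Function.comp_apply]
      congr 1
      funext i'
      by_cases hi : i' = i
      · subst hi
        simp [S]
      · simp [S, hi]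
    rwa [e1] at h2
  have hzero : ∫ ω, residualWeight τ (Function.update (E ω) i 0) * E ω i ∂μ = 0 := by
    rw [hind.integral_fun_mul_eq_mul_integral
      ((measurable_residualWeight τ).comp hE').aestronglyMeasurable
      (h.meas i).aestronglyMeasurable, h.mean_zero, mul_zero]
  rw [← sub_zero (∫ ω, residualWeight τ (E ω) * E ω i ∂μ), ← hzero, ← integral_sub hi1 hi2]
  refine abs_integral_le_integral_abs.trans ?_
  have h2 := (h.sq i).div_const (by positivity : 0 ≤ √(size p : ℝ) * τ)
  refine le_trans (integral_mono (hi1.sub hi2).abs h2.1 fun ω => ?_) h2.2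
  have e : Function.update (E ω) i 0 = E ω - Pi.single i (E ω i) := by
    ext i'
    by_cases hi : i' = i
    · subst hi
      simp
    · simp [hi]
  have hn : tensorNorm (Pi.single i (E ω i)) = |E ω i| := by
    rw [tensorNorm, Finset.sum_eq_single i]
    · simp [Real.sqrt_sq_eq_abs]
    · intro b _ hb
      simp [hb]
    · simp
  have h3 := abs_residualWeight_sub_le hτ (E ω) (Pi.single i (E ω i))
  rw [← e, hn, abs_sub_comm] at h3
  simp only
  rw [← sub_mul, abs_mul]
  refine (mul_le_mul_of_nonneg_right h3 (abs_nonneg _)).trans_eq ?_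
  rw [div_div, div_mul_eq_mul_div, ← sq, sq_abs]

/-- The score of a linear functional, weighted and averaged over time. Independence across time
gives the variance, of order `1 / T`; the mean, which need not vanish because the weights depend
on the noise, is bounded by `abs_integral_residualWeight_mul_entry_le`. -/
theorem integral_weighted_score_sq_le [IsProbabilityMeasure μ]
    {τ : ℝ} (hτ : 0 < τ) (hT : 0 < T) (hp : ∀ k, 0 < p k)
    (h : NoiseFamily μ v fun (s : Fin T × (∀ k, Fin (p k))) ω => E s.1 ω s.2)
    (V : Fin T → Tensor p) {S₁ S₂ : ℝ} (hS₂ : ∀ t, tensorNorm (V t) ^ 2 ≤ S₂)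
    (hS₁ : ∀ t, ∑ i, |V t i| ≤ S₁) (hv : 0 ≤ v) :
    IntegralLE μ (fun ω => ((T : ℝ)⁻¹ * ∑ t, residualWeight τ (E t ω) * (E t ω ⬝ᵥ V t)) ^ 2)
      (v * S₂ / T + v ^ 2 / τ ^ 2 * S₁ ^ 2 / size p) := by
  have hs : (0 : ℝ) < size p := by exact_mod_cast size_pos hp
  have hT' : (0 : ℝ) < T := by exact_mod_cast hT
  have hE : ∀ t, Measurable (E t) := fun t => measurable_pi_lambda _ (h.slice t).meas
  have hdot : ∀ W : Tensor p, Measurable fun x : Tensor p => x ⬝ᵥ W := by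
    intro W
    unfold dotProduct
    fun_prop
  set Y : Fin T → Ω → ℝ := fun t ω => residualWeight τ (E t ω) * (E t ω ⬝ᵥ V t) with hY
  have hYm : ∀ t, Measurable (Y t) := fun t =>
    ((measurable_residualWeight τ).comp (hE t)).mul ((hdot _).comp (hE t))
  have hlin : ∀ t, IntegralLE μ (fun ω => (E t ω ⬝ᵥ V t) ^ 2) (v * S₂) := fun t =>
    (integral_dotProduct_sq_le (h.slice t) (V t)).mono (mul_le_mul_of_nonneg_left (hS₂ t) hv)
  have hYle : ∀ t ω, Y t ω ^ 2 ≤ (E t ω ⬝ᵥ V t) ^ 2 := by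
    intro t ω
    rw [hY]
    simp only [mul_pow]
    refine mul_le_of_le_one_left (sq_nonneg _) (pow_le_one₀ (huberWeight_pos hτ _).le ?_)
    exact huberWeight_le_one hτ _
  have hYi : ∀ t, Integrable (fun ω => Y t ω ^ 2) μ := fun t =>
    (hlin t).1.mono' ((hYm t).pow_const 2).aestronglyMeasurable (ae_of_all _ fun ω => by
      rw [Real.norm_of_nonneg (sq_nonneg _)]
      exact hYle t ω)
  have hY2 : ∀ t, MemLp (Y t) 2 μ := fun t =>
    (memLp_two_iff_integrable_sq (hYm t).aestronglyMeasurable).2 (hYi t)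
  have hYsq : ∀ t, ∫ ω, Y t ω ^ 2 ∂μ ≤ v * S₂ := fun t =>
    (integral_mono (hYi t) (hlin t).1 (hYle t)).trans (hlin t).2
  have hmean : ∀ t, |∫ ω, Y t ω ∂μ| ≤ v / (√(size p) * τ) * S₁ := by
    intro t
    have e : ∀ ω, Y t ω = ∑ i, residualWeight τ (E t ω) * E t ω i * V t i := by
      intro ω
      simp only [hY, dotProduct, Finset.mul_sum, mul_assoc]
    have hint : ∀ i, Integrable (fun ω => residualWeight τ (E t ω) * E t ω i * V t i) μ := by
      intro i
      refine Integrable.mul_const (((h.slice t).integrable i).bdd_mul (c := 1)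
        ((measurable_residualWeight τ).comp (hE t)).aestronglyMeasurable
        (ae_of_all _ fun ω => ?_)) _
      simp only [residualWeight, Function.comp_apply]
      rw [Real.norm_of_nonneg (huberWeight_pos hτ _).le]
      exact huberWeight_le_one hτ _
    simp only [e]
    rw [integral_finsetSum _ fun i _ => hint i]
    refine (Finset.abs_sum_le_sum_abs _ _).trans ?_
    have hc : 0 ≤ v / (√(size p) * τ) := by positivity
    refine le_trans (Finset.sum_le_sum fun i _ => ?_)
      ((Finset.mul_sum _ _ _).symm.le.trans (mul_le_mul_of_nonneg_left (hS₁ t) hc))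
    rw [integral_mul_const, abs_mul]
    exact mul_le_mul_of_nonneg_right
      (abs_integral_residualWeight_mul_entry_le hτ (h.slice t) i) (abs_nonneg _)
  have hind : Pairwise fun t t' => IndepFun (Y t) (Y t') μ := by
    intro t t' htt
    have h1 := h.indep.indepFun_finset (Finset.univ.filter fun s => s.1 = t)
      (Finset.univ.filter fun s => s.1 = t') (by
        rw [Finset.disjoint_filter]
        rintro s - rfl
        exact htt) h.meas
    let S : Fin T → Finset (Fin T × (∀ k, Fin (p k))) := fun t₀ =>
      Finset.univ.filter fun s => s.1 = t₀
    have hS : ∀ t₀ i, (t₀, i) ∈ S t₀ := fun t₀ i => by simp [S]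
    let φ : ∀ t₀ : Fin T, (S t₀ → ℝ) → ℝ := fun t₀ z =>
      residualWeight τ (fun i => z ⟨(t₀, i), hS t₀ i⟩) *
        ((fun i => z ⟨(t₀, i), hS t₀ i⟩) ⬝ᵥ V t₀)
    have hφ : ∀ t₀, Measurable (φ t₀) := by
      intro t₀
      have hz : Measurable fun (z : S t₀ → ℝ) (i : ∀ k, Fin (p k)) =>
          z ⟨(t₀, i), hS t₀ i⟩ :=
        measurable_pi_lambda _ fun i => measurable_pi_apply _
      exact ((measurable_residualWeight τ).comp hz).mul ((hdot _).comp hz)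
    exact h1.comp (hφ t) (hφ t')
  have h1 := (integral_sum_sq_le hY2 hind hYsq hmean).const_mul
    (by positivity : (0 : ℝ) ≤ (T : ℝ)⁻¹ ^ 2)
  simp only [mul_pow _ (∑ t, _)] at h1 ⊢
  refine h1.mono (le_of_eq ?_)
  have hsq : √(size p : ℝ) ^ 2 = size p := Real.sq_sqrt hs.le
  rw [Fintype.card_fin, mul_pow, mul_pow, div_pow, mul_pow, hsq]
  field_simp

end NoiseTensors

/-! ### The mean of the noise statistics -/

section NoiseTotal

variable {K : ℕ} {p r : Fin K → ℕ} {T : ℕ} {𝒜 : ∀ k, Set (Fin (r k) → ℝ)} {𝓕 : Set (Tensor r)}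
  {θ₀ : Param p r T}

theorem prod_sum_update_single (b : ∀ k, Fin (p k) → ℝ) (k : Fin K) (a : Fin (p k)) (f : ℝ → ℝ)
    (h0 : f 0 = 0) (h1 : f 1 = 1) :
    ∏ l, ∑ i, f (Function.update b k (Pi.single a 1) l i) =
      ∏ l ∈ Finset.univ.erase k, ∑ i, f (b l i) := by
  rw [← Finset.mul_prod_erase _ _ (Finset.mem_univ k), Function.update_self,
    Finset.sum_eq_single a, Pi.single_eq_same, h1, one_mul]
  · exact Finset.prod_congr rfl fun l hl => by
      rw [Function.update_of_ne (Finset.ne_of_mem_erase hl)]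
  · intro i _ hi
    rw [Pi.single_eq_of_ne hi, h0]
  · simp

theorem tensorNorm_probe_sq (hp : ∀ k, 0 < p k) (h₀ : θ₀ ∈ paramSpace p r T 𝒜 𝓕)
    (j : ∀ k, Fin (r k)) (k : Fin K) (a : Fin (p k)) :
    tensorNorm (probe (cols θ₀.loading j) k a) ^ 2 = sizeExcept p k := by
  have h1 : tensorNorm (probe (cols θ₀.loading j) k a) ^ 2 =
      ∏ l, ∑ i, Function.update (cols θ₀.loading j) k (Pi.single a 1) l i ^ 2 := by
    rw [probe, tensorNorm_sq, ← sum_prod_apply fun l i =>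
      Function.update (cols θ₀.loading j) k (Pi.single a 1) l i ^ 2]
    simp only [rankOne, Finset.prod_pow]
  rw [h1, prod_sum_update_single _ k a (fun x => x ^ 2) (by norm_num) (by norm_num), sizeExcept]
  push_cast
  exact Finset.prod_congr rfl fun l _ => sum_loading_sq hp h₀ l (j l)

theorem sum_abs_probe_le (hp : ∀ k, 0 < p k) (h₀ : θ₀ ∈ paramSpace p r T 𝒜 𝓕)
    (j : ∀ k, Fin (r k)) (k : Fin K) (a : Fin (p k)) :
    ∑ i, |probe (cols θ₀.loading j) k a i| ≤ sizeExcept p k := by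
  simp only [probe, rankOne, Finset.abs_prod]
  rw [sum_prod_apply fun l i => |Function.update (cols θ₀.loading j) k (Pi.single a 1) l i|,
    prod_sum_update_single _ k a (fun x => |x|) (by norm_num) (by norm_num), sizeExcept]
  push_cast
  refine Finset.prod_le_prod (fun l _ => Finset.sum_nonneg fun _ _ => abs_nonneg _) fun l _ => ?_
  have hl : (0 : ℝ) ≤ p l := by positivity
  refine abs_le_of_sq_le_sq' ?_ hl |>.2
  refine (sq_sum_le_card_mul_sum_sq (s := Finset.univ)
    (f := fun i => |cols θ₀.loading j l i|)).trans_eq ?_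
  have := sum_loading_sq hp h₀ l (j l)
  simp only [sq_abs, Finset.card_univ, Fintype.card_fin]
  rw [sq]
  congr 1

/-- The sum of the statistics of the noise that `NoiseBounds` bounds at the scale of the rate: the
concentration of `‖E_t‖²/p`, the score of the factors, that of the loadings at single times, and the
weighted score of the loadings. One application of Markov's inequality bounds them all. -/
noncomputable def noiseTotal (θ₀ : Param p r T) (E : Fin T → Tensor p) (τ ρ : ℝ)
    (m : Fin T → ℝ) : ℝ :=
  (T : ℝ)⁻¹ * ∑ t, (tensorNorm (E t) ^ 2 / size p - m t) ^ 2 / ρ +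
  (T : ℝ)⁻¹ * ∑ t, ∑ j, (E t ⬝ᵥ rankOne (cols θ₀.loading j)) ^ 2 / size p +
  ∑ k, ∑ j, (T : ℝ)⁻¹ * ∑ t, ∑ a, (E t ⬝ᵥ probe (cols θ₀.loading j) k a) ^ 2 / size p +
  ∑ k, ∑ j, ∑ a, ((T : ℝ)⁻¹ * ∑ t, residualWeight τ (E t) * (E t ⬝ᵥ
    (θ₀.factor t j • probe (cols θ₀.loading j) k a))) ^ 2 * (p k / (size p : ℝ) ^ 2) / ρ

theorem noiseTotal_nonneg (θ₀ : Param p r T) (E : Fin T → Tensor p) (τ : ℝ) {ρ : ℝ}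
    (hρ : 0 < ρ) (m : Fin T → ℝ) : 0 ≤ noiseTotal θ₀ E τ ρ m := by
  unfold noiseTotal
  positivity

theorem le_sum_sum {α β : Type*} [Fintype α] [Fintype β] {f : α → β → ℝ}
    (h : ∀ a b, 0 ≤ f a b) (a : α) (b : β) : f a b ≤ ∑ a, ∑ b, f a b :=
  (Finset.single_le_sum (fun b _ => h a b) (Finset.mem_univ b)).trans
    (Finset.single_le_sum (f := fun a => ∑ b, f a b)
      (fun a _ => Finset.sum_nonneg fun b _ => h a b) (Finset.mem_univ a))

theorem noiseBounds_of_noiseTotal_le {E : Fin T → Tensor p} {k₀ : Fin K} {τ s κ M ρ : ℝ}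
    {m : Fin T → ℝ} (hρ : 0 < ρ) (hκ : 0 ≤ κ) (hm : ∀ t, m t ≤ s ^ 2)
    (hM : noiseTotal θ₀ E τ ρ m ≤ M)
    (hgram : (T : ℝ)⁻¹ * ∑ t, (unfoldGramNorm k₀ (E t) / size p) ^ 2 ≤ κ ^ 4) :
    NoiseBounds θ₀ E k₀ τ s κ M ρ m := by
  unfold noiseTotal at hM
  have h1 : 0 ≤ (T : ℝ)⁻¹ * ∑ t, (tensorNorm (E t) ^ 2 / size p - m t) ^ 2 / ρ := by positivity
  have h2 : 0 ≤ (T : ℝ)⁻¹ * ∑ t, ∑ j, (E t ⬝ᵥ rankOne (cols θ₀.loading j)) ^ 2 / size p := by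
    positivity
  have h3 : ∀ k j, 0 ≤ (T : ℝ)⁻¹ * ∑ t, ∑ a,
      (E t ⬝ᵥ probe (cols θ₀.loading j) k a) ^ 2 / size p := fun k j => by positivity
  have h4 : ∀ k j, 0 ≤ ∑ a, ((T : ℝ)⁻¹ * ∑ t, residualWeight τ (E t) * (E t ⬝ᵥ
      (θ₀.factor t j • probe (cols θ₀.loading j) k a))) ^ 2 * (p k / (size p : ℝ) ^ 2) / ρ :=
    fun k j => by positivity
  have h3' := Finset.sum_nonneg fun k (_ : k ∈ Finset.univ) =>
    Finset.sum_nonneg fun j (_ : j ∈ Finset.univ) => h3 k j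
  have h4' := Finset.sum_nonneg fun k (_ : k ∈ Finset.univ) =>
    Finset.sum_nonneg fun j (_ : j ∈ Finset.univ) => h4 k j
  refine ⟨hm, ?_, ?_, by linarith, fun k j => ?_, fun k j => ?_⟩
  · have h5 : (T : ℝ)⁻¹ * ∑ t, (tensorNorm (E t) ^ 2 / size p - m t) ^ 2 / ρ ≤ M := by linarith
    rwa [← Finset.sum_div, ← mul_div_assoc, div_le_iff₀ hρ] at h5
  · refine Real.sqrt_le_iff.2 ⟨hκ, (avg_le_sqrt_avg_sq _).trans ?_⟩
    refine Real.sqrt_le_iff.2 ⟨sq_nonneg κ, hgram.trans_eq (by ring)⟩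
  · have h5 := le_sum_sum h3 k j
    linarith
  · have h5 := le_sum_sum h4 k j
    have h7 : ∑ a, ((T : ℝ)⁻¹ * ∑ t, residualWeight τ (E t) * (E t ⬝ᵥ
      (θ₀.factor t j • probe (cols θ₀.loading j) k a))) ^ 2 * (p k / (size p : ℝ) ^ 2) / ρ ≤ M := by
      linarith
    rw [← Finset.sum_div, div_le_iff₀ hρ] at h7
    simpa only [dotProduct_smul, smul_eq_mul, mul_assoc] using h7

/-- A bound for the mean of `noiseTotal`, uniform in the dimensions. -/
noncomputable def noiseConst (r : Fin K → ℕ) (ν τ B : ℝ) : ℝ :=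
  3 * (ν ^ 2) ^ 2 + (∏ k, r k : ℕ) * ν ^ 2 + K * ((∏ k, r k : ℕ) * ν ^ 2) +
    K * ((∏ k, r k : ℕ) * (ν ^ 2 * B ^ 2 + (ν ^ 2) ^ 2 / τ ^ 2 * B ^ 2))

theorem noiseConst_nonneg (r : Fin K → ℕ) (ν τ B : ℝ) : 0 ≤ noiseConst r ν τ B := by
  unfold noiseConst
  positivity

/-- The rate enters here: `1 / p` comes from concentration and from the bias of the weighted
score, and `1 / (T p_{-k})` from its variance. -/
theorem integral_noiseTotal_le {Ω : Type*} [MeasurableSpace Ω] {μ : Measure Ω}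
    [IsProbabilityMeasure μ] {E : Fin T → Ω → Tensor p} {ν τ B ρ : ℝ} (hτ : 0 < τ)
    (hT : 0 < T) (hp : ∀ k, 0 < p k) (hB : ∀ F ∈ 𝓕, tensorNorm F ≤ B)
    (h₀ : θ₀ ∈ paramSpace p r T 𝒜 𝓕)
    (h : NoiseFamily μ (ν ^ 2) fun (s : Fin T × (∀ k, Fin (p k))) ω => E s.1 ω s.2)
    (hρ : 1 / (size p : ℝ) ≤ ρ) (hρ' : ∀ k, 1 / ((T : ℝ) * sizeExcept p k) ≤ ρ) :
    IntegralLE μ (fun ω => noiseTotal θ₀ (fun t => E t ω) τ ρ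
      fun t => (∑ i, ∫ ω, E t ω i ^ 2 ∂μ) / size p) (noiseConst r ν τ B) := by
  have hs : (0 : ℝ) < size p := by exact_mod_cast size_pos hp
  have hρ0 : 0 < ρ := (by positivity : 0 < 1 / (size p : ℝ)).trans_le hρ
  have hT' : (0 : ℝ) < T := by exact_mod_cast hT
  have hcard : ∀ c : ℝ, ∑ _j : ∀ k, Fin (r k), c = (∏ k, r k : ℕ) * c := by
    intro c
    rw [Finset.sum_const, Finset.card_univ, nsmul_eq_mul, card_index, size]
  have hcardK : ∀ c : ℝ, ∑ _k : Fin K, c = K * c := by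
    intro c
    rw [Finset.sum_const, Finset.card_univ, Fintype.card_fin, nsmul_eq_mul]
  have hcardp : ∀ (k : Fin K) (c : ℝ), ∑ _a : Fin (p k), c = p k * c := by
    intro k c
    rw [Finset.sum_const, Finset.card_univ, Fintype.card_fin, nsmul_eq_mul]
  unfold noiseTotal noiseConst
  refine IntegralLE.add (IntegralLE.add (IntegralLE.add ?_ ?_) ?_) ?_
  · refine IntegralLE.avg (by positivity) fun t => ?_
    refine ((integral_tensorNorm_sq_sub_sq_le hp (h.slice t)).div_const hρ0.le).mono ?_
    rw [div_le_iff₀ hρ0]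
    exact mul_le_mul_of_nonneg_left hρ (by positivity)
  · refine IntegralLE.avg (by positivity) fun t => ?_
    rw [← hcard]
    refine IntegralLE.sum fun j _ => ?_
    refine ((integral_dotProduct_sq_le (h.slice t) _).div_const hs.le).mono (le_of_eq ?_)
    have e : tensorNorm (rankOne (cols θ₀.loading j)) = √(size p) := by
      rw [tensorNorm_rankOne, ← prod_sqrt_eq_sqrt_size]
      refine Finset.prod_congr rfl fun k _ => ?_
      rw [← sum_loading_sq hp h₀ k (j k)]
      rfl
    rw [e, Real.sq_sqrt hs.le, mul_div_cancel_right₀ _ hs.ne']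
  · rw [← hcardK]
    refine IntegralLE.sum fun k _ => ?_
    rw [← hcard]
    refine IntegralLE.sum fun j _ => ?_
    refine IntegralLE.avg (by positivity) fun t => ?_
    have h1 := IntegralLE.sum fun a (_ : a ∈ (Finset.univ : Finset (Fin (p k)))) =>
      (integral_dotProduct_sq_le (h.slice t) (probe (cols θ₀.loading j) k a)).div_const hs.le
    refine h1.mono (le_of_eq ?_)
    simp only [tensorNorm_probe_sq hp h₀]
    have hk : (0 : ℝ) < p k := by exact_mod_cast hp k
    have he : (0 : ℝ) < sizeExcept p k := by exact_mod_cast Finset.prod_pos fun j _ => hp j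
    rw [hcardp, size_eq_mul_sizeExcept p k]
    push_cast
    field_simp
  · rw [← hcardK]
    refine IntegralLE.sum fun k _ => ?_
    rw [← hcard]
    refine IntegralLE.sum fun j _ => ?_
    have hk : (0 : ℝ) < p k := by exact_mod_cast hp k
    have he : (0 : ℝ) < sizeExcept p k := by exact_mod_cast Finset.prod_pos fun j _ => hp j
    have hF : ∀ t, |θ₀.factor t j| ≤ B := fun t =>
      (abs_le_tensorNorm _ j).trans (hB _ (h₀.2.2.1 t))
    have h1 := IntegralLE.sum fun a (_ : a ∈ (Finset.univ : Finset (Fin (p k)))) =>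
      ((integral_weighted_score_sq_le hτ hT hp h
        (fun t => θ₀.factor t j • probe (cols θ₀.loading j) k a)
        (S₁ := B * sizeExcept p k) (S₂ := B ^ 2 * sizeExcept p k) (fun t => ?_) (fun t => ?_)
        (sq_nonneg ν)).mul_const
        (by positivity : 0 ≤ (p k : ℝ) / (size p : ℝ) ^ 2)).div_const hρ0.le
    · refine h1.mono ?_
      rw [hcardp]
      have e : (p k : ℝ) * ((ν ^ 2 * (B ^ 2 * sizeExcept p k) / T +
          (ν ^ 2) ^ 2 / τ ^ 2 * (B * sizeExcept p k) ^ 2 / size p) *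
          (p k / (size p : ℝ) ^ 2) / ρ) = (ν ^ 2 * B ^ 2 * (1 / (T * sizeExcept p k)) +
          (ν ^ 2) ^ 2 / τ ^ 2 * B ^ 2 * (1 / size p)) / ρ := by
        rw [size_eq_mul_sizeExcept p k]
        push_cast
        field_simp
      rw [e, div_le_iff₀ hρ0, add_mul]
      exact add_le_add (mul_le_mul_of_nonneg_left (hρ' k) (by positivity))
        (mul_le_mul_of_nonneg_left hρ (by positivity))
    · rw [tensorNorm_smul, mul_pow, tensorNorm_probe_sq hp h₀]
      exact mul_le_mul_of_nonneg_right (pow_le_pow_left₀ (abs_nonneg _) (hF t) 2) he.le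
    · simp only [Pi.smul_apply, smul_eq_mul, abs_mul]
      rw [← Finset.mul_sum]
      exact mul_le_mul (hF t) (sum_abs_probe_le hp h₀ j k a)
        (Finset.sum_nonneg fun _ _ => abs_nonneg _) ((abs_nonneg _).trans (hF t))

end NoiseTotal

/-! ### Asymptotics -/

section Asymptotics

variable {K : ℕ} {r : Fin K → ℕ} {p : ℕ → Fin K → ℕ} {T : ℕ → ℕ}

theorem Lstar_le_size (p : Fin K → ℕ) (T : ℕ) : Lstar p T ≤ size p := min_le_left _ _

theorem Lstar_le_sizeExcept_sq (p : Fin K → ℕ) (T : ℕ) (k : Fin K) :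
    Lstar p T ≤ sizeExcept p k ^ 2 :=
  (min_le_right _ _).trans ((min_le_left _ _).trans (ciInf_le (OrderBot.bddBelow _) k))

theorem Lstar_le_mul_sizeExcept (p : Fin K → ℕ) (T : ℕ) (k : Fin K) :
    Lstar p T ≤ T * sizeExcept p k :=
  (min_le_right _ _).trans ((min_le_right _ _).trans (ciInf_le (OrderBot.bddBelow _) k))

theorem Lstar_pos (hK : 1 ≤ K) {p : Fin K → ℕ} {T : ℕ} (hp : ∀ k, 0 < p k) (hT : 0 < T) :
    0 < Lstar p T := by
  have : Nonempty (Fin K) := ⟨⟨0, hK⟩⟩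
  have he : ∀ k, 0 < sizeExcept p k := fun k => Finset.prod_pos fun j _ => hp j
  refine lt_min (size_pos hp) (lt_min ?_ ?_)
  · exact Nat.lt_of_succ_le (le_ciInf fun k => Nat.succ_le_of_lt (pow_pos (he k) 2))
  · exact Nat.lt_of_succ_le (le_ciInf fun k => Nat.succ_le_of_lt (Nat.mul_pos hT (he k)))

theorem eventually_pos (hp : ∀ k, Tendsto (fun n => p n k) atTop atTop) :
    ∀ᶠ n in atTop, ∀ k, 0 < p n k :=
  eventually_all.2 fun k => (hp k).eventually_gt_atTop 0

theorem tendsto_sizeExcept (hK : 2 ≤ K) (hp : ∀ k, Tendsto (fun n => p n k) atTop atTop)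
    (k : Fin K) : Tendsto (fun n => sizeExcept (p n) k) atTop atTop := by
  have : Nontrivial (Fin K) := Fin.nontrivial_iff_two_le.2 hK
  obtain ⟨l, hl⟩ := exists_ne k
  refine tendsto_atTop_mono' _ ?_ (hp l)
  filter_upwards [eventually_pos hp] with n hn
  exact Finset.single_le_prod' (f := p n) (fun j _ => hn j) (by simp [hl])

theorem tendsto_Lstar (hK : 2 ≤ K) (hp : ∀ k, Tendsto (fun n => p n k) atTop atTop)
    (hT : Tendsto T atTop atTop) : Tendsto (fun n => Lstar (p n) (T n)) atTop atTop := by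
  have : Nonempty (Fin K) := ⟨⟨0, by omega⟩⟩
  refine tendsto_atTop.2 fun N => ?_
  have h1 : ∀ᶠ n in atTop, ∀ k, N ≤ sizeExcept (p n) k :=
    eventually_all.2 fun k => (tendsto_sizeExcept hK hp k).eventually_ge_atTop N
  filter_upwards [h1, eventually_pos hp, hT.eventually_gt_atTop 0] with n hn hpn hTn
  refine le_min ?_ (le_min (le_ciInf fun k => ?_) (le_ciInf fun k => ?_))
  · have k : Fin K := ⟨0, by omega⟩
    rw [size_eq_mul_sizeExcept _ k]
    exact (hn k).trans (Nat.le_mul_of_pos_left _ (hpn k))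
  · exact (hn k).trans (Nat.le_self_pow two_ne_zero _)
  · exact (hn k).trans (Nat.le_mul_of_pos_left _ hTn)

theorem exists_pos_forall_le {ι : Type*} [Finite ι] {f : ι → ℝ} (hf : ∀ i, 0 < f i) :
    ∃ g : ℝ, 0 < g ∧ ∀ i, g ≤ f i := by
  rcases isEmpty_or_nonempty ι with h | h
  · exact ⟨1, one_pos, fun i => (h.false i).elim⟩
  · obtain ⟨i, hi⟩ := Finite.exists_min f
    exact ⟨f i, hf i, hi⟩

/-- Along the sequence the eigenvalues of the second moment matrices of the factors are eventually
bounded below and separated. -/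
theorem exists_eventually_gap {𝒜 : ∀ k, Set (Fin (r k) → ℝ)} {𝓕 : Set (Tensor r)}
    {θ₀ : ∀ n, Param (p n) r (T n)} (h : ParamAssumption r p T 𝒜 𝓕 θ₀) :
    ∃ g : ℝ, 0 < g ∧ ∀ᶠ n in atTop, (∀ k i, g ≤ factorGram (θ₀ n).factor k i i) ∧
      ∀ k i j, i < j →
        g ≤ factorGram (θ₀ n).factor k i i - factorGram (θ₀ n).factor k j j := by
  choose σ hσ hanti hlim using h.gram_limit
  have hent : ∀ k i, Tendsto (fun n => factorGram (θ₀ n).factor k i i) atTop (𝓝 (σ k i)) := by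
    intro k i
    have h1 := tendsto_pi_nhds.1 (tendsto_pi_nhds.1 (hlim k) i) i
    rwa [Matrix.diagonal_apply_eq] at h1
  obtain ⟨g₁, hg₁, hle₁⟩ := exists_pos_forall_le
    (f := fun q : (k : Fin K) × Fin (r k) => σ q.1 q.2 / 2) fun q => half_pos (hσ _ _)
  obtain ⟨g₂, hg₂, hle₂⟩ := exists_pos_forall_le
    (f := fun q : (k : Fin K) × {ij : Fin (r k) × Fin (r k) // ij.1 < ij.2} =>
      (σ q.1 q.2.1.1 - σ q.1 q.2.1.2) / 2)
    fun q => half_pos (sub_pos.2 (hanti _ q.2.2))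
  refine ⟨min g₁ g₂, lt_min hg₁ hg₂, ?_⟩
  have e₁ : ∀ᶠ n in atTop, ∀ k i, min g₁ g₂ ≤ factorGram (θ₀ n).factor k i i := by
    refine eventually_all.2 fun k => eventually_all.2 fun i => ?_
    have h1 : min g₁ g₂ < σ k i :=
      ((min_le_left _ _).trans (hle₁ ⟨k, i⟩)).trans_lt (half_lt_self (hσ k i))
    exact ((hent k i).eventually_const_lt h1).mono fun n hn => hn.le
  have e₂ : ∀ᶠ n in atTop, ∀ k i j, i < j →
      min g₁ g₂ ≤ factorGram (θ₀ n).factor k i i - factorGram (θ₀ n).factor k j j := by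
    refine eventually_all.2 fun k => eventually_all.2 fun i => eventually_all.2 fun j => ?_
    by_cases hij : i < j
    · have h1 : min g₁ g₂ < σ k i - σ k j :=
        ((min_le_right _ _).trans (hle₂ ⟨k, ⟨(i, j), hij⟩⟩)).trans_lt
          (half_lt_self (sub_pos.2 (hanti k hij)))
      exact (((hent k i).sub (hent k j)).eventually_const_lt h1).mono fun n hn _ => hn.le
    · exact Eventually.of_forall fun n h => (hij h).elim
  exact e₁.and e₂

theorem exists_bound_of_compact {𝓕 : Set (Tensor r)} (h : IsCompact 𝓕) :
    ∃ B : ℝ, 0 ≤ B ∧ ∀ F ∈ 𝓕, tensorNorm F ≤ B := by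
  have hc : Continuous (tensorNorm : Tensor r → ℝ) := by
    unfold tensorNorm
    fun_prop
  obtain ⟨B, hB⟩ := h.exists_bound_of_continuousOn hc.continuousOn
  refine ⟨max B 0, le_max_right _ _, fun F hF => ?_⟩
  exact ((le_abs_self _).trans (hB F hF)).trans (le_max_left _ _)

theorem factorError_le {p : Fin K → ℕ} {T : ℕ} {𝒜 : ∀ k, Set (Fin (r k) → ℝ)}
    {𝓕 : Set (Tensor r)} {θ₀ θ : Param p r T} {B : ℝ} (hB : ∀ F ∈ 𝓕, tensorNorm F ≤ B)
    (h₀ : θ₀ ∈ paramSpace p r T 𝒜 𝓕) (h : θ ∈ paramSpace p r T 𝒜 𝓕) :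
    factorError θ₀ θ ≤ (2 * B) ^ 2 := by
  rw [factorError_eq]
  have key : ∀ t, tensorNorm (θ.factor t - (aligned θ₀ θ).factor t) ^ 2 ≤ (2 * B) ^ 2 := by
    intro t
    refine pow_le_pow_left₀ (tensorNorm_nonneg _) ((tensorNorm_sub_le _ _).trans ?_) 2
    linarith [hB _ (h.2.2.1 t), hB _ (h₀.2.2.1 t), tensorNorm_aligned_factor_le θ₀ θ t]
  refine (mul_le_mul_of_nonneg_left (Finset.sum_le_sum fun t _ => key t) (by positivity)).trans ?_
  rw [Finset.sum_const, Finset.card_univ, Fintype.card_fin, nsmul_eq_mul, ← mul_assoc]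
  exact mul_le_of_le_one_left (sq_nonneg _) inv_mul_le_one

theorem factorError_nonneg {p : Fin K → ℕ} {T : ℕ} (θ₀ θ : Param p r T) :
    0 ≤ factorError θ₀ θ := by
  unfold factorError
  positivity

end Asymptotics

section Rate

variable {K : ℕ} {r : Fin K → ℕ} {p : ℕ → Fin K → ℕ} {T : ℕ → ℕ}
  {Ω : ℕ → Type*} [∀ n, MeasurableSpace (Ω n)] {μ : ∀ n, Measure (Ω n)}
  {𝒜 : ∀ k, Set (Fin (r k) → ℝ)} {𝓕 : Set (Tensor r)} {θ₀ : ∀ n, Param (p n) r (T n)}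
  {E X : ∀ n, Fin (T n) → Ω n → Tensor (p n)} {τ : ℝ} {θH : ∀ n, Ω n → Param (p n) r (T n)}

theorem eventually_measure_le {f : ℕ → ENNReal} (hf : Tendsto f atTop (𝓝 0)) {ε : ℝ}
    (hε : 0 < ε) : ∀ᶠ n in atTop, f n ≤ ENNReal.ofReal ε :=
  (hf.eventually_lt_const (ENNReal.ofReal_pos.2 hε)).mono fun _ h => h.le

/-- In order one `p_{-1}` is an empty product, so `L* = 1`, and the errors are bounded. -/
theorem eventually_errors_le_of_order_one (hK : K = 1)
    (hp : ∀ k, Tendsto (fun n => p n k) atTop atTop) (hT : Tendsto T atTop atTop)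
    (h₁ : ParamAssumption r p T 𝒜 𝓕 θ₀)
    (hθH : Tendsto (fun n => μ n {ω | ¬ IsHuberEstimator τ 𝒜 𝓕
      (fun t => X n t ω) (θH n ω)}) atTop (𝓝 0)) {ε : ℝ} (hε : 0 < ε) :
    ∃ C : ℝ, 0 < C ∧ ∀ᶠ n in atTop, μ n {ω |
      ¬ ((∀ k, loadingError (θ₀ n) (θH n ω) k ≤ C * (1 / (Lstar (p n) (T n) : ℝ))) ∧
        factorError (θ₀ n) (θH n ω) ≤ C * (1 / (Lstar (p n) (T n) : ℝ)))} ≤ ENNReal.ofReal ε := by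
  obtain ⟨B, hB0, hB⟩ := exists_bound_of_compact h₁.compact_factor
  set R : ℝ := ∑ k, (r k : ℝ) with hR
  have hrR : ∀ k, (r k : ℝ) ≤ R := fun k =>
    Finset.single_le_sum (f := fun k => (r k : ℝ)) (fun _ _ => by positivity) (Finset.mem_univ k)
  have hR0 : 0 ≤ R := by positivity
  refine ⟨2 * R + (2 * B) ^ 2 + 1, by positivity, ?_⟩
  filter_upwards [eventually_pos hp, hT.eventually_gt_atTop 0, eventually_measure_le hθH hε]
    with n hpn hTn hμ
  refine le_trans (measure_mono ?_) hμ
  intro ω hω hest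
  refine hω ?_
  have hL : (1 : ℝ) ≤ 1 / (Lstar (p n) (T n) : ℝ) := by
    have h1 := Lstar_pos hK.ge hpn hTn
    have h2 : Lstar (p n) (T n) ≤ 1 := by
      have h3 := Lstar_le_sizeExcept_sq (p n) (T n) ⟨0, hK.ge⟩
      have : Subsingleton (Fin K) := by subst hK; infer_instance
      have h4 : (Finset.univ.erase (⟨0, hK.ge⟩ : Fin K)) = ∅ :=
        Finset.eq_empty_of_forall_notMem fun k hk =>
          Finset.ne_of_mem_erase hk (Subsingleton.elim _ _)
      rwa [sizeExcept, h4, Finset.prod_empty, one_pow] at h3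
    rw [le_antisymm h2 h1]
    norm_num
  have hC : (2 * R + (2 * B) ^ 2 + 1) ≤
      (2 * R + (2 * B) ^ 2 + 1) * (1 / (Lstar (p n) (T n) : ℝ)) :=
    le_mul_of_one_le_right (by positivity) hL
  refine ⟨fun k => le_trans ?_ hC, le_trans ?_ hC⟩
  · have h1 := loadingError_le hpn (h₁.mem n) hest.1 k
    linarith [hrR k, sq_nonneg (2 * B)]
  · linarith [factorError_le hB (h₁.mem n) hest.1]

/-- In higher order all `p_{-k}` diverge, and the deterministic bound applies with a probability
close to one. -/
theorem eventually_errors_le_of_two_le [∀ n, IsProbabilityMeasure (μ n)] (hK : 2 ≤ K)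
    (hp : ∀ k, Tendsto (fun n => p n k) atTop atTop) (hT : Tendsto T atTop atTop)
    (hX : ∀ n t ω, X n t ω = (θ₀ n).common t + E n t ω)
    (h₁ : ParamAssumption r p T 𝒜 𝓕 θ₀) (h₂ : ∀ n, IndepErrors (μ n) (E n)) {ν : ℝ}
    (h₃ : ∀ n, SubGaussianErrors (μ n) ν (E n)) (hτ : 0 < τ)
    (hθH : Tendsto (fun n => μ n {ω | ¬ IsHuberEstimator τ 𝒜 𝓕
      (fun t => X n t ω) (θH n ω)}) atTop (𝓝 0)) {ε : ℝ} (hε : 0 < ε) :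
    ∃ C : ℝ, 0 < C ∧ ∀ᶠ n in atTop, μ n {ω |
      ¬ ((∀ k, loadingError (θ₀ n) (θH n ω) k ≤ C * (1 / (Lstar (p n) (T n) : ℝ))) ∧
        factorError (θ₀ n) (θH n ω) ≤ C * (1 / (Lstar (p n) (T n) : ℝ)))} ≤ ENNReal.ofReal ε := by
  obtain ⟨B, hB0, hB⟩ := exists_bound_of_compact h₁.compact_factor
  obtain ⟨g, hg, hgap⟩ := exists_eventually_gap h₁
  set c := noiseConst r ν τ B with hc
  have hc0 : 0 ≤ c := noiseConst_nonneg r ν τ B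
  -- `M` makes the probability in Markov's inequality for `noiseTotal` at most `ε / 3`
  set M := 3 * (c + 1) / ε with hM
  have hM0 : 0 < M := by positivity
  obtain ⟨κ, hκ, C, hC, hdet⟩ := exists_errors_le_of_noiseBounds r (s := ν) hB0 hg hτ hM0.le
  refine ⟨C, hC, ?_⟩
  set k₀ : Fin K := ⟨0, by omega⟩
  have hcast := tendsto_natCast_atTop_atTop (R := ℝ)
  have hse := fun k => hcast.comp (tendsto_sizeExcept hK hp k)
  have hinv : Tendsto (fun n => 1 / (Lstar (p n) (T n) : ℝ)) atTop (𝓝 0) := by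
    simp only [one_div]
    exact (hcast.comp (tendsto_Lstar hK hp hT)).inv_tendsto_atTop
  have hgram : Tendsto (fun n => (ν ^ 2) ^ 2 * (1 / (sizeExcept (p n) k₀ : ℝ) + 3 / (p n k₀ : ℝ)))
      atTop (𝓝 0) := by
    have h1 := (hse k₀).inv_tendsto_atTop
    have h2 := (hcast.comp (hp k₀)).inv_tendsto_atTop
    have h3 := (h1.add (h2.const_mul 3)).const_mul ((ν ^ 2) ^ 2)
    simpa [div_eq_mul_inv] using h3
  have hsmall : ∀ᶠ n in atTop, ∀ k, √(p n k / size (p n) : ℝ) ≤ κ := by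
    refine eventually_all.2 fun k => ?_
    filter_upwards [(hse k).inv_tendsto_atTop.eventually_le_const (by positivity : 0 < κ ^ 2),
      eventually_pos hp] with n hn hpn
    have hk : (p n k : ℝ) ≠ 0 := by exact_mod_cast (hpn k).ne'
    refine Real.sqrt_le_iff.2 ⟨hκ.le, (le_of_eq ?_).trans hn⟩
    rw [size_eq_mul_sizeExcept (p n) k]
    push_cast
    simp only [Pi.inv_apply, Function.comp_apply]
    field_simp
  have hε3 : 0 < ε / 3 := by positivity
  filter_upwards [eventually_pos hp, hT.eventually_gt_atTop 0, eventually_measure_le hθH hε3,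
    hgap, hsmall, hinv.eventually_le_const hκ,
    hgram.eventually_le_const (by positivity : 0 < ε / 3 * κ ^ 4)]
    with n hpn hTn hμ hgn hκn hρκ hgramn
  have hL : (0 : ℝ) < Lstar (p n) (T n) := by
    exact_mod_cast Lstar_pos (by omega : 1 ≤ K) hpn hTn
  obtain ⟨ρ, hρ⟩ : ∃ x : ℝ, x = 1 / (Lstar (p n) (T n) : ℝ) := ⟨_, rfl⟩
  rw [← hρ] at hρκ ⊢
  have hρ0 : 0 < ρ := by rw [hρ]; positivity
  have hρs : 1 / (size (p n) : ℝ) ≤ ρ := by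
    rw [hρ]
    exact one_div_le_one_div_of_le hL (by exact_mod_cast Lstar_le_size _ _)
  have hρT : ∀ k, 1 / ((T n : ℝ) * sizeExcept (p n) k) ≤ ρ := fun k => by
    rw [hρ]
    exact one_div_le_one_div_of_le hL (by exact_mod_cast Lstar_le_mul_sizeExcept _ _ k)
  have hfam := noiseFamily_of_subGaussian (h₂ n) (h₃ n)
  set m : Fin (T n) → ℝ := fun t => (∑ i, ∫ ω, E n t ω i ^ 2 ∂μ n) / size (p n) with hm
  have hm_le : ∀ t, m t ≤ ν ^ 2 := fun t => mean_tensorNorm_sq_le hpn (hfam.slice t)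
  have htot := (integral_noiseTotal_le hτ hTn hpn hB (h₁.mem n) hfam hρs hρT).measure_lt_le
    (fun ω => noiseTotal_nonneg _ _ _ hρ0 _) hM0
  -- the power `κ⁴` turns the second moment of the Gram norms into the bound `κ` of
  -- `NoiseBounds.gram`
  have hgr := (IntegralLE.avg (by positivity) fun t =>
    integral_unfoldGramNorm_sq_le hpn (hfam.slice t) k₀).measure_lt_le
    (fun ω => by positivity) (by positivity : 0 < κ ^ 4)
  have htot' : c / M ≤ ε / 3 := by
    have h1 : ε / 3 * M = c + 1 := by
      rw [hM]
      field_simp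
    rw [div_le_iff₀ hM0, h1]
    linarith
  have hgr' : (ν ^ 2) ^ 2 * (1 / (sizeExcept (p n) k₀ : ℝ) + 3 / (p n k₀ : ℝ)) / κ ^ 4 ≤
      ε / 3 := (div_le_iff₀ (by positivity)).2 hgramn
  have hsub : {ω | ¬ ((∀ k, loadingError (θ₀ n) (θH n ω) k ≤ C * ρ) ∧
      factorError (θ₀ n) (θH n ω) ≤ C * ρ)} ⊆
      ({ω | ¬ IsHuberEstimator τ 𝒜 𝓕 (fun t => X n t ω) (θH n ω)} ∪
        {ω | M < noiseTotal (θ₀ n) (fun t => E n t ω) τ ρ m}) ∪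
        {ω | κ ^ 4 < (T n : ℝ)⁻¹ * ∑ t, (unfoldGramNorm k₀ (E n t ω) / size (p n)) ^ 2} := by
    intro ω hω
    by_contra hcon
    simp only [Set.mem_union, Set.mem_ofPred_eq, not_or, not_not, not_lt] at hcon
    exact hω (hdet (p n) (T n) 𝒜 𝓕 (θ₀ n) (θH n ω) (fun t => E n t ω) (fun t => X n t ω) k₀ m ρ
      hpn hB (fun t => hX n t ω) hκn hρs hρκ (h₁.mem n) hgn.1 hgn.2
      (noiseBounds_of_noiseTotal_le hρ0 hκ.le hm_le hcon.1.2 hcon.2) hcon.1.1)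
  calc _ ≤ μ n _ := measure_mono hsub
    _ ≤ (ENNReal.ofReal (ε / 3) + ENNReal.ofReal (ε / 3)) + ENNReal.ofReal (ε / 3) :=
        (measure_union_le _ _).trans (add_le_add ((measure_union_le _ _).trans (add_le_add hμ
          (htot.trans (ENNReal.ofReal_le_ofReal htot'))))
          (hgr.trans (ENNReal.ofReal_le_ofReal hgr')))
    _ = ENNReal.ofReal ε := by
        rw [← ENNReal.ofReal_add hε3.le hε3.le, ← ENNReal.ofReal_add (by positivity) hε3.le]
        congr 1
        ring

end Rate

end TensorFactor

theorem mainTheorem2 {K : ℕ} (hK : 1 ≤ K) (r : Fin K → ℕ)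
    (p : ℕ → Fin K → ℕ) (T : ℕ → ℕ)
    (hp : ∀ k, Tendsto (fun n => p n k) atTop atTop) (hT : Tendsto T atTop atTop)
    {Ω : ℕ → Type*} [∀ n, MeasurableSpace (Ω n)] (μ : ∀ n, Measure (Ω n))
    [∀ n, IsProbabilityMeasure (μ n)]
    (𝒜 : ∀ k, Set (Fin (r k) → ℝ)) (𝓕 : Set (TensorFactor.Tensor r))
    (θ₀ : ∀ n, TensorFactor.Param (p n) r (T n))
    (E X : ∀ n, Fin (T n) → Ω n → TensorFactor.Tensor (p n))
    (hX : ∀ n t ω, X n t ω = (θ₀ n).common t + E n t ω)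
    (h₁ : TensorFactor.ParamAssumption r p T 𝒜 𝓕 θ₀)
    (h₂ : ∀ n, TensorFactor.IndepErrors (μ n) (E n))
    (ν : ℝ) (hν : 0 < ν) (h₃ : ∀ n, TensorFactor.SubGaussianErrors (μ n) ν (E n))
    (τ : ℝ) (hτ : 0 < τ)
    (θH : ∀ n, Ω n → TensorFactor.Param (p n) r (T n))
    (hθH : Tendsto (fun n => μ n {ω | ¬ TensorFactor.IsHuberEstimator τ 𝒜 𝓕
      (fun t => X n t ω) (θH n ω)}) atTop (𝓝 0)) :
    (∀ k, TensorFactor.IsBigOP μ (fun n ω => TensorFactor.loadingError (θ₀ n) (θH n ω) k)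
      (fun n => 1 / (TensorFactor.Lstar (p n) (T n) : ℝ))) ∧
    TensorFactor.IsBigOP μ (fun n ω => TensorFactor.factorError (θ₀ n) (θH n ω))
      (fun n => 1 / (TensorFactor.Lstar (p n) (T n) : ℝ)) := by
  open TensorFactor in
  have key : ∀ ε : ℝ, 0 < ε → ∃ C : ℝ, 0 < C ∧ ∀ᶠ n in atTop, μ n {ω |
      ¬ ((∀ k, loadingError (θ₀ n) (θH n ω) k ≤ C * (1 / (Lstar (p n) (T n) : ℝ))) ∧
        factorError (θ₀ n) (θH n ω) ≤ C * (1 / (Lstar (p n) (T n) : ℝ)))} ≤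
          ENNReal.ofReal ε := by
    intro ε hε
    rcases hK.eq_or_lt with hK1 | hK2
    · exact eventually_errors_le_of_order_one hK1.symm hp hT h₁ hθH hε
    · exact eventually_errors_le_of_two_le hK2 hp hT hX h₁ h₂ h₃ hτ hθH hε
  refine ⟨fun k ε hε => ?_, fun ε hε => ?_⟩
  · obtain ⟨C, hC, h⟩ := key ε hε
    refine ⟨C, hC, h.mono fun n hn => (measure_mono fun ω hω hle => ?_).trans hn⟩
    rw [Set.mem_ofPred_eq] at hω
    refine hω.not_ge ?_
    rw [abs_of_nonneg (TensorFactor.loadingError_nonneg _ _ _)]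
    exact hle.1 k
  · obtain ⟨C, hC, h⟩ := key ε hε
    refine ⟨C, hC, h.mono fun n hn => (measure_mono fun ω hω hle => ?_).trans hn⟩
    rw [Set.mem_ofPred_eq] at hω
    refine hω.not_ge ?_
    rw [abs_of_nonneg (TensorFactor.factorError_nonneg _ _)]
    exact hle.2
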